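/- Notation. For a separable metrizable space $E$, $D_E$ is the set of right-continuous paths $[0,\infty)\to E$ with left limits (RCLL), with the Skorokhod ($J_1$) topology and its Borel $\sigma$-algebra; $X$ is the coordinate process, $\theta_t$ the shift, $\mathcal F^0_t=\sigma(X_s;\,s\le t)$, $\mathcal F_t=\bigcap_{s>t}\mathcal F^0_s$, and $\mathfrak P(D_E)$ is the set of Borel probability measures on $D_E$ with the weak topology. Setting. Let $F$ be a locally compact Hausdorff space with a countable base, $d\ge 0$, $E=[0,\infty)\times\mathbb R^d\times F$, $\tilde E=E\times[0,\infty)$, and write $X=(T,S,\eta)$ on $D_E$. Let $(\mathbb P^x)_{x\in E}$ be a family in $\mathfrak P(D_E)$ such that: 1. (Markovian dynamics) $x\mapsto\mathbb P^x$ is Borel, $\mathbb P^x[X_0=x]=1$ for all $x$, and $\mathbb E^x[G\circ\theta_\tau\mid\mathcal F_\tau]=\mathbb E^{X_\tau}[G]$, $\mathbb P^x$-a.s., for all $x$, all bounded $(\mathcal F_t)$-stopping times $\tau$ and all bounded Borel $G:D_E\to\mathbb R$. 2. (Finite horizon) For all $x$, $\mathbb P^x$-a.s., $T_t=T_0-t$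 for all $t\le T_0$; and for $x\in\{0\}\times\mathbb R^d\times F$, $\mathbb P^x$ is the Dirac mass at the constant path $x$. 3. (NFLVR) For each $x$, the set $\mathcal M^x$ of all $\mathbb Q\in\mathfrak P(D_E)$ which are equivalent to $\mathbb P^x$ and under which $S$ is a local martingale with respect to $(\mathcal F^0_t)$ is non-empty. 4. (Uniform local boundedness from below) With $\tau_n=\inf\{t\ge0:|S_t|\ge n\}$, for each $n$ there is $a_n\in\mathbb R$ such that for all $x=(t_0,s,\eta_0)\in E$ with $|s|<n$, $\mathbb P^x$-a.s., every coordinate of $S_{t\wedge\tau_n}$ is at least $a_n$ for all $t\ge0$. For $\mathbb P,\mathbb Q\in\mathfrak P(D_E)$ with $\mathbb Q\ll\mathbb P$, let $Z^{\mathbb P,\mathbb Q}$ denote an RCLL version, with values in $[0,\infty)$, of the density process $\mathbb E^{\mathbb P}[\frac{d\mathbb Q}{d\mathbb P}\mid\mathcal F_t]$, $t\ge0$. For $x\in E$ and $\mathbb Q\in\mathcal M^x$ put $Z^{\mathbb Q}=Z^{\mathbb P^x,\mathbb Q}$; for $(x,z)\in\tilde E$ let $\tilde{\mathcal P}^{x,z}\subseteq\mathfrak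 P(D_{\tilde E})$ be the set of all $\mathbb P^x$-laws of $(X,zZ^{\mathbb Q})$ with $\mathbb Q\in\mathcal M^x$. Proposition. The graph $\{((x,z),\mu):(x,z)\in\tilde E,\ \mu\in\tilde{\mathcal P}^{x,z}\}$ is an analytic subset of $\tilde E\times\mathfrak P(D_{\tilde E})$. Moreover, $Z^{\mathbb P,\mathbb Q}$ exists for all $\mathbb P,\mathbb Q\in\mathfrak P(D_E)$ with $\mathbb Q\ll\mathbb P$, the $\mathbb P$-law of $(X,Z^{\mathbb P,\mathbb Q})$ on $D_{\tilde E}$ does not depend on the choice of the version, and the map sending $(\mathbb P,\mathbb Q)$ to this law is Borel on $\{(\mathbb P,\mathbb Q)\in\mathfrak P(D_E)^2:\mathbb Q\ll\mathbb P\}$. -/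

import Mathlib

open MeasureTheory ProbabilityTheory Filter Topology
open scoped NNReal

/-! ### Right-continuous paths with left limits and the Skorokhod topology -/

/-- The set `D_E` of all right-continuous paths `[0, ∞) → E` with left limits. -/
structure RCLLPath (E : Type*) [TopologicalSpace E] where
  toFun : ℝ≥0 → E
  rightCont' : ∀ t, ContinuousWithinAt toFun (Set.Ici t) t
  leftLim' : ∀ t, ∃ l, Tendsto toFun (𝓝[<] t) (𝓝 l)

namespace RCLLPath

variable {E E' : Type*} [TopologicalSpace E] [TopologicalSpace E']

instance : CoeFun (RCLLPath E) (fun _ => ℝ≥0 → E) := ⟨toFun⟩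

/-- The constant path. -/
def const (x : E) : RCLLPath E where
  toFun := fun _ => x
  rightCont' _ := continuousWithinAt_const
  leftLim' _ := ⟨x, tendsto_const_nhds⟩

/-- The path `t ↦ (ω t, ω' t)`; this is the identification of `D_E × D_E'` with `D_(E × E')`. -/
def pair (ω : RCLLPath E) (ω' : RCLLPath E') : RCLLPath (E × E') where
  toFun t := (ω t, ω' t)
  rightCont' t := (ω.rightCont' t).prodMk (ω'.rightCont' t)
  leftLim' t := by
    obtain ⟨l, hl⟩ := ω.leftLim' t
    obtain ⟨l', hl'⟩ := ω'.leftLim' t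
    exact ⟨(l, l'), hl.prodMk_nhds hl'⟩

/-- The path `t ↦ f (ω t)` for continuous `f`. -/
def comp (f : E → E') (hf : Continuous f) (ω : RCLLPath E) : RCLLPath E' where
  toFun t := f (ω t)
  rightCont' t := hf.continuousAt.comp_continuousWithinAt (ω.rightCont' t)
  leftLim' t := by
    obtain ⟨l, hl⟩ := ω.leftLim' t
    exact ⟨f l, (hf.tendsto l).comp hl⟩

/-- The shift operator `θ_t`: `(θ_t ω) s = ω (t + s)`. -/
def shift (t : ℝ≥0) (ω : RCLLPath E) : RCLLPath E where
  toFun s := ω (t + s)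
  rightCont' s := by
    refine (ω.rightCont' (t + s)).comp (f := fun u : ℝ≥0 => t + u)
      (by fun_prop) (fun u hu => ?_)
    have : s ≤ u := hu
    exact add_le_add_right this t
  leftLim' s := by
    obtain ⟨l, hl⟩ := ω.leftLim' (t + s)
    refine ⟨l, hl.comp (tendsto_nhdsWithin_iff.2 ⟨?_, ?_⟩)⟩
    · exact (Continuous.tendsto (by fun_prop : Continuous fun u : ℝ≥0 => t + u) s).mono_left
        nhdsWithin_le_nhds
    · filter_upwards [self_mem_nhdsWithin] with u hu
      have : u < s := hu
      exact add_lt_add_right this t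

/-- The basic Skorokhod neighbourhood of a path `ω`, for a given distance function `d` on `E`:
all paths which, up to time `T`, are `ε`-close to `ω` after a change of time (an increasing
bijection of `[0, ∞)`) that is `ε`-close to the identity up to time `T`. -/
def skorokhodNhd (d : E → E → ℝ) (ω : RCLLPath E) (T : ℝ≥0) (ε : ℝ) : Set (RCLLPath E) :=
  {ω' | ∃ l : ℝ≥0 ≃o ℝ≥0, ∀ t ≤ T, dist (l t) t < ε ∧ d (ω' t) (ω (l t)) < ε}

lemma skorokhodNhd_mono (d : E → E → ℝ) (ω : RCLLPath E) {T T' : ℝ≥0} {ε ε' : ℝ}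
    (hT : T' ≤ T) (hε : ε ≤ ε') : skorokhodNhd d ω T ε ⊆ skorokhodNhd d ω T' ε' := by
  rintro ω' ⟨l, hl⟩
  exact ⟨l, fun t ht => ⟨(hl t (ht.trans hT)).1.trans_le hε, (hl t (ht.trans hT)).2.trans_le hε⟩⟩

/-- The Skorokhod (J1) topology on `D_E`, for a metrizable space `E`. A compatible metric on `E` is
fixed to define it; the topology does not depend on this choice. -/
instance [TopologicalSpace.MetrizableSpace E] : TopologicalSpace (RCLLPath E) where
  IsOpen U := ∀ ω ∈ U, ∃ T : ℝ≥0, ∃ ε > 0,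
    skorokhodNhd (TopologicalSpace.metrizableSpaceMetric E).dist ω T ε ⊆ U
  isOpen_univ := fun _ _ => ⟨0, 1, one_pos, Set.subset_univ _⟩
  isOpen_inter := by
    rintro U V hU hV ω ⟨hωU, hωV⟩
    obtain ⟨T, ε, hε, h⟩ := hU ω hωU
    obtain ⟨T', ε', hε', h'⟩ := hV ω hωV
    exact ⟨max T T', min ε ε', lt_min hε hε', Set.subset_inter
      ((skorokhodNhd_mono _ _ (le_max_left _ _) (min_le_left _ _)).trans h)
      ((skorokhodNhd_mono _ _ (le_max_right _ _) (min_le_right _ _)).trans h')⟩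
  isOpen_sUnion := by
    rintro 𝒰 h𝒰 ω ⟨U, hU, hω⟩
    obtain ⟨T, ε, hε, h⟩ := h𝒰 U hU ω hω
    exact ⟨T, ε, hε, h.trans (Set.subset_sUnion_of_mem hU)⟩

lemma isOpen_skorokhod_iff [TopologicalSpace.MetrizableSpace E] (U : Set (RCLLPath E)) :
    IsOpen U ↔ ∀ ω ∈ U, ∃ T : ℝ≥0, ∃ ε > 0,
      skorokhodNhd (TopologicalSpace.metrizableSpaceMetric E).dist ω T ε ⊆ U := Iff.rfl

/-- `D_E` carries the Borel `σ`-algebra of the Skorokhod topology. -/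
instance [TopologicalSpace.MetrizableSpace E] : MeasurableSpace (RCLLPath E) := borel _

instance [TopologicalSpace.MetrizableSpace E] : BorelSpace (RCLLPath E) := ⟨rfl⟩

/-- The coordinate process `X`. -/
def coord (t : ℝ≥0) (ω : RCLLPath E) : E := ω t

lemma isOpen_hit [TopologicalSpace.MetrizableSpace E] (a b : ℝ≥0) {G : Set E} (hG : IsOpen G) :
    IsOpen {ω : RCLLPath E | ∃ s, a < s ∧ s < b ∧ ω s ∈ G} := by
  let _ := TopologicalSpace.metrizableSpaceMetric E
  rw [isOpen_skorokhod_iff]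
  rintro ω ⟨s, has, hsb, hs⟩
  obtain ⟨δ, hδ, hball⟩ := Metric.isOpen_iff.1 hG _ hs
  have h1 : (0 : ℝ) < s - a := sub_pos.2 (by exact_mod_cast has)
  have h2 : (0 : ℝ) < b - s := sub_pos.2 (by exact_mod_cast hsb)
  refine ⟨b, min δ (min (s - a) (b - s)), lt_min hδ (lt_min h1 h2), ?_⟩
  rintro ω' ⟨l, hl⟩
  have key : l.symm s < b := by
    by_contra hcon
    have hbs : b ≤ l.symm s := not_lt.1 hcon
    have hlb : l b ≤ s := by simpa using l.monotone hbs
    have := (hl b le_rfl).1.trans_le ((min_le_right _ _).trans (min_le_right _ _))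
    rw [NNReal.dist_eq, abs_lt] at this
    have hlb' : (l b : ℝ) ≤ s := by exact_mod_cast hlb
    linarith [this.1]
  obtain ⟨hd, hω⟩ := hl (l.symm s) key.le
  rw [l.apply_symm_apply] at hd hω
  refine ⟨l.symm s, ?_, key, hball (hω.trans_le (min_le_left _ _))⟩
  have := hd.trans_le ((min_le_right _ _).trans (min_le_left _ _))
  rw [NNReal.dist_eq, abs_lt] at this
  have : (a : ℝ) < (l.symm s : ℝ≥0) := by linarith [this.2]
  exact_mod_cast this

lemma measurable_coord [TopologicalSpace.MetrizableSpace E] [MeasurableSpace E] [BorelSpace E]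
    (t : ℝ≥0) : Measurable (coord t : RCLLPath E → E) := by
  let _ := TopologicalSpace.metrizableSpaceMetric E
  refine measurable_of_isClosed fun F hF => ?_
  have heq : coord t ⁻¹' F = ⋂ n : ℕ, {ω : RCLLPath E | ∃ s, t < s ∧
      s < t + 1 / ((n : ℝ≥0) + 1) ∧ ω s ∈ Metric.thickening (1 / ((n : ℝ) + 1)) F} := by
    ext ω
    simp only [Set.mem_preimage, coord, Set.mem_iInter, Set.mem_ofPred_eq]
    have hright : Tendsto ω (𝓝[>] t) (𝓝 (ω t)) :=
      (ω.rightCont' t).mono_left (nhdsWithin_mono _ Set.Ioi_subset_Ici_self)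
    constructor
    · intro h n
      have hn : (0 : ℝ) < 1 / ((n : ℝ) + 1) := by positivity
      have hn' : t < t + 1 / ((n : ℝ≥0) + 1) := lt_add_of_pos_right _ (by positivity)
      have hmem : ω t ∈ Metric.thickening (1 / ((n : ℝ) + 1)) F :=
        Metric.self_subset_thickening hn F h
      have hev : ∀ᶠ s in 𝓝[>] t, ω s ∈ Metric.thickening (1 / ((n : ℝ) + 1)) F :=
        hright.eventually (Metric.isOpen_thickening.mem_nhds hmem)
      obtain ⟨s, hs, hs'⟩ := (hev.and (Ioo_mem_nhdsGT hn')).exists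
      exact ⟨s, hs'.1, hs'.2, hs⟩
    · intro h
      choose s hts hst hs using h
      have hlim : Tendsto s atTop (𝓝[>] t) := by
        refine tendsto_nhdsWithin_iff.2 ⟨?_, Eventually.of_forall hts⟩
        refine tendsto_of_tendsto_of_tendsto_of_le_of_le (g := fun _ => t)
          (h := fun n : ℕ => t + 1 / ((n : ℝ≥0) + 1)) tendsto_const_nhds ?_
          (fun n => (hts n).le) (fun n => (hst n).le)
        simpa using tendsto_const_nhds.add
          (tendsto_one_div_add_atTop_nhds_zero_nat (𝕜 := ℝ≥0))
      have hω : Tendsto (fun n => ω (s n)) atTop (𝓝 (ω t)) := hright.comp hlim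
      choose y hyF hy using fun n => Metric.mem_thickening_iff.1 (hs n)
      refine hF.mem_of_tendsto (f := y) (b := atTop) ?_ (Eventually.of_forall hyF)
      refine tendsto_iff_dist_tendsto_zero.2 ?_
      have hbound : Tendsto (fun n : ℕ => 1 / ((n : ℝ) + 1) + dist (ω (s n)) (ω t)) atTop
          (𝓝 0) := by
        simpa using tendsto_one_div_add_atTop_nhds_zero_nat.add
          (tendsto_iff_dist_tendsto_zero.1 hω)
      refine squeeze_zero (fun _ => dist_nonneg) (fun n => ?_) hbound
      calc dist (y n) (ω t) ≤ dist (y n) (ω (s n)) + dist (ω (s n)) (ω t) := dist_triangle _ _ _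
        _ ≤ _ := by
          gcongr
          rw [dist_comm]
          exact (hy n).le
  rw [heq]
  exact MeasurableSet.iInter fun n => (isOpen_hit _ _ Metric.isOpen_thickening).measurableSet

/-- The raw filtration `𝔽⁰` generated by the coordinate process. -/
noncomputable def rawFiltration (E : Type*) [TopologicalSpace E]
    [TopologicalSpace.MetrizableSpace E] [SecondCountableTopology E] [MeasurableSpace E]
    [BorelSpace E] : Filtration ℝ≥0 (inferInstance : MeasurableSpace (RCLLPath E)) :=
  Filtration.natural (coord : ℝ≥0 → RCLLPath E → E)
    fun t => (measurable_coord t).stronglyMeasurable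

/-- The right-continuous hull `𝔽` of the raw filtration: `ℱ_t = ⋂_{s > t} ℱ⁰_s`. -/
noncomputable def filtration (E : Type*) [TopologicalSpace E]
    [TopologicalSpace.MetrizableSpace E] [SecondCountableTopology E] [MeasurableSpace E]
    [BorelSpace E] : Filtration ℝ≥0 (inferInstance : MeasurableSpace (RCLLPath E)) :=
  (rawFiltration E).rightCont

end RCLLPath

/-! ### The market model -/

namespace Market

open RCLLPath

/-- The state space `E = [0, ∞) × ℝ^d × F`. -/
abbrev State (d : ℕ) (F : Type*) : Type _ := ℝ≥0 × EuclideanSpace ℝ (Fin d) × F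

/-- The augmented state space `Ẽ = E × [0, ∞)`. -/
abbrev AugState (d : ℕ) (F : Type*) : Type _ := State d F × ℝ≥0

section Density

variable {E : Type*} [TopologicalSpace E] [TopologicalSpace.MetrizableSpace E]
  [SecondCountableTopology E] [MeasurableSpace E] [BorelSpace E]

/-- `Z` is an RCLL version of the density process `Z_t = 𝔼^P[dQ/dP | ℱ_t]` of `Q` with respect
to `P`. It is viewed as a `D_[0,∞)`-valued random element on `D_E`. -/
structure IsDensityProcess (P Q : ProbabilityMeasure (RCLLPath E))
    (Z : RCLLPath E → RCLLPath ℝ≥0) : Prop where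
  measurable : Measurable Z
  ae_eq_condExp : ∀ t, (fun ω => (Z ω t : ℝ)) =ᵐ[(P : Measure (RCLLPath E))]
    (P : Measure (RCLLPath E))[fun ω =>
      ((Q : Measure (RCLLPath E)).rnDeriv (P : Measure (RCLLPath E)) ω).toReal | filtration E t]

/-- The `P`-law of the pair of processes `(X, z Z)`, a measure on `D_(E × [0,∞))`. -/
noncomputable def augLaw (P : ProbabilityMeasure (RCLLPath E)) (z : ℝ≥0)
    (Z : RCLLPath E → RCLLPath ℝ≥0) : Measure (RCLLPath (E × ℝ≥0)) :=
  (P : Measure (RCLLPath E)).map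
    fun ω => ω.pair ((Z ω).comp (fun y => z * y) (continuous_const_mul z))

end Density

section Model

variable {d : ℕ} {F : Type*} [TopologicalSpace F] [T2Space F] [LocallyCompactSpace F]
  [SecondCountableTopology F] [MeasurableSpace F] [BorelSpace F]

/-- The time-to-go process. -/
def timeToGo (t : ℝ≥0) (ω : RCLLPath (State d F)) : ℝ≥0 := (ω t).1

/-- The asset-price process. -/
def price (t : ℝ≥0) (ω : RCLLPath (State d F)) : EuclideanSpace ℝ (Fin d) := (ω t).2.1

/-- The time `τ_n = inf {t ≥ 0 : |S_t| ≥ n}` (which is `⊤` if there is no such `t`). -/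
noncomputable def exitTime (n : ℕ) : RCLLPath (State d F) → WithTop ℝ≥0 :=
  hittingAfter price {s : EuclideanSpace ℝ (Fin d) | (n : ℝ) ≤ ‖s‖} 0

/-- `(P x)` is a canonical strong Markov family. -/
structure IsCanonicalStrongMarkov (P : State d F → ProbabilityMeasure (RCLLPath (State d F))) :
    Prop where
  borel : Measurable[borel (State d F), borel (ProbabilityMeasure (RCLLPath (State d F)))] P
  start : ∀ x, ∀ᵐ ω ∂(P x : Measure (RCLLPath (State d F))), ω 0 = x
  strongMarkov : ∀ (τ : RCLLPath (State d F) → ℝ≥0)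
    (hτ : IsStoppingTime (filtration (State d F)) fun ω => (τ ω : WithTop ℝ≥0)),
    (∃ c, ∀ ω, τ ω ≤ c) →
    ∀ x, ∀ G : RCLLPath (State d F) → ℝ, Measurable G → (∃ C, ∀ ω, |G ω| ≤ C) →
      (P x : Measure (RCLLPath (State d F)))[fun ω => G (ω.shift (τ ω)) | hτ.measurableSpace]
        =ᵐ[(P x : Measure (RCLLPath (State d F)))]
      fun ω => ∫ ω', G ω' ∂(P (ω (τ ω)) : Measure (RCLLPath (State d F)))

/-- Finite horizon: time-to-go decreases at unit speed until it reaches zero, and the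
states with no time to go are absorbing. -/
structure HasFiniteHorizon (P : State d F → ProbabilityMeasure (RCLLPath (State d F))) :
    Prop where
  countdown : ∀ x, ∀ᵐ ω ∂(P x : Measure (RCLLPath (State d F))),
    ∀ t ≤ timeToGo 0 ω, (timeToGo t ω : ℝ) = timeToGo 0 ω - t
  absorbing : ∀ x : State d F, x.1 = 0 →
    (P x : Measure (RCLLPath (State d F))) = Measure.dirac (RCLLPath.const x)

/-- The set `ℳ^x` of all probability measures `Q` equivalent to `P x` under which the price
process is a local martingale (with respect to the raw filtration). -/
def martingaleMeasures (P : State d F → ProbabilityMeasure (RCLLPath (State d F)))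
    (x : State d F) : Set (ProbabilityMeasure (RCLLPath (State d F))) :=
  {Q | (Q : Measure (RCLLPath (State d F))) ≪ (P x : Measure (RCLLPath (State d F))) ∧
    (P x : Measure (RCLLPath (State d F))) ≪ (Q : Measure (RCLLPath (State d F))) ∧
    Locally (fun Y => Martingale Y (rawFiltration (State d F))
        (Q : Measure (RCLLPath (State d F))))
      (rawFiltration (State d F)) price (Q : Measure (RCLLPath (State d F)))}

/-- Absence of arbitrage, as existence of an equivalent local-martingale measure. -/
def NFLVR (P : State d F → ProbabilityMeasure (RCLLPath (State d F))) : Prop :=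
  ∀ x, (martingaleMeasures P x).Nonempty

/-- Uniform local boundedness from below: for each `n`, a single constant `a` bounds all
coordinates of the stopped process `S^{τ_n}` from below, `P x`-almost surely, for all initial
states `x` whose price component lies in the open ball of radius `n` (so that `τ_n > 0`). -/
def UniformlyLocallyBoundedBelow
    (P : State d F → ProbabilityMeasure (RCLLPath (State d F))) : Prop :=
  ∀ n : ℕ, ∃ a : ℝ, ∀ x : State d F, ‖x.2.1‖ < n →
    ∀ᵐ ω ∂(P x : Measure (RCLLPath (State d F))),
      ∀ t i, a ≤ stoppedProcess price (exitTime n) t ω i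

/-- The set `𝒫̃^{x,z}` of the `P x`-laws of `(X, z Z^Q)`, where `Q` ranges over `ℳ^x` and `Z^Q` is
an RCLL version of the density process of `Q` with respect to `P x`. -/
def augFamily (P : State d F → ProbabilityMeasure (RCLLPath (State d F)))
    (y : AugState d F) : Set (ProbabilityMeasure (RCLLPath (AugState d F))) :=
  {R | ∃ Q ∈ martingaleMeasures P y.1, ∃ Z, IsDensityProcess (P y.1) Q Z ∧
    (R : Measure (RCLLPath (AugState d F))) = augLaw (P y.1) y.2 Z}

end Model
end Market

/-! The graph is the image of a Borel set under a Borel map defined on a Polish space. The Borel set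
is the graph of `martingaleMeasures`, and the map sends `(x, z, Q)` to `((x, z), law of (X, z
Z^Q))`. Three points carry the argument.

The graph of `martingaleMeasures` is Borel (`measurableSet_graph_martingaleMeasures`). Being a local
martingale involves an unknown localizing sequence, so it is first reduced to one fixed sequence:
`levelTime n`, the time at which the running supremum of the price norm reaches `n`. These times are
stopping times of the raw filtration and do not depend on `Q`. The price stopped there is bounded
from below, so Fatou's lemma along an arbitrary localizing sequence makes it integrable. The
pathwise bound `norm_stoppedPrice_le` then gives dominated convergence, and the stopped price is a
true martingale (`martingale_stoppedPrice`, `mem_martingaleMeasures_iff`). For a fixed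
right-continuous process with such a bound, the martingale property amounts to countably many
integral conditions, each Borel in the law (`measurableSet_martingale`). Absolute continuity is
Borel by the theory of kernels.

The law of `(X, z Z)` is a Borel function of `(z, P, Q)` (`measurable_densityLaw`). The raw
`σ`-algebra at time `t` is generated by the path stopped at `t`. Hence the Radon–Nikodym derivative
of the stopped laws, taken as kernels in `(P, Q)`, gives a jointly measurable density at each
rational time. Doob's maximal and upcrossing inequalities give one-sided limits along the rationals,
and the path of right limits is an RCLL version for the right-continuous hull. Versions agree at all
rational times almost surely, so the law does not depend on the choice.

The spaces must be tame enough. The Skorokhod topology is metrizable and separable, and its Borel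
sets are generated by the coordinates (`measurable_of_coord`). Restriction to rational times is a
measurable embedding when `E` is Polish, so paths embed in the reals, and distribution functions
parametrize the laws by the Polish space `ℚ → ℝ` (`exists_measurable_surjective`). The weak Borel
`σ`-algebra on laws is the one generated by the evaluations, which is what kernels use. -/

namespace RCLLPath

/-! ### Metrizability of the Skorokhod topology -/

section SkorokhodTopology

@[ext]
lemma ext {E : Type*} [TopologicalSpace E] {ω ω' : RCLLPath E} (h : ∀ t, ω t = ω' t) : ω = ω' := by
  cases ω; cases ω'; congr 1; exact funext h

lemma tendsto_nhdsGT {E : Type*} [TopologicalSpace E] (ω : RCLLPath E) (t : ℝ≥0) :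
    Tendsto ω (𝓝[>] t) (𝓝 (ω t)) :=
  (ω.rightCont' t).mono_left (nhdsWithin_mono _ Set.Ioi_subset_Ici_self)

/-- The entourage of pairs of paths which are `ε`-close up to time `T`. -/
def skorokhodEntourage {E : Type*} [TopologicalSpace E] (d : E → E → ℝ) (T : ℝ≥0) (ε : ℝ) :
    Set (RCLLPath E × RCLLPath E) :=
  {p | p.2 ∈ skorokhodNhd d p.1 T ε}

lemma skorokhodNhd_self {E : Type*} [MetricSpace E] (ω : RCLLPath E) (T : ℝ≥0) {ε : ℝ}
    (hε : 0 < ε) : ω ∈ skorokhodNhd dist ω T ε :=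
  ⟨OrderIso.refl _, fun t _ => by simpa using hε⟩

/-- The inverse time change works. A time up to `T` is the image of a time up to `T + 1`, because
displacements are below `ε ≤ 1`; this is the reason for the extra unit of horizon. -/
lemma skorokhodNhd_symm {E : Type*} [MetricSpace E] {ω ω' : RCLLPath E} {T : ℝ≥0} {ε : ℝ}
    (hε : ε ≤ 1) (h : ω' ∈ skorokhodNhd dist ω (T + 1) ε) :
    ω ∈ skorokhodNhd dist ω' T ε := by
  obtain ⟨l, hl⟩ := h
  refine ⟨l.symm, fun t ht => ?_⟩
  have key : l.symm t ≤ T + 1 := by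
    by_contra hcon
    have hlt : T + 1 < l.symm t := not_le.1 hcon
    have h1 : l (T + 1) < t := by simpa using l.strictMono hlt
    have h2 := (hl (T + 1) le_rfl).1
    rw [NNReal.dist_eq, abs_lt] at h2
    have h3 : (l (T + 1) : ℝ) < t := by exact_mod_cast h1
    have h4 : (t : ℝ) ≤ T := by exact_mod_cast ht
    push_cast at h2
    linarith [h2.1]
  obtain ⟨h1, h2⟩ := hl _ key
  rw [l.apply_symm_apply] at h1 h2
  exact ⟨by rwa [dist_comm], by rwa [dist_comm]⟩

/-- Compose the time changes; the inner one moves `[0, T]` into `[0, T + 1]`, where the outer one is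
still controlled. -/
lemma skorokhodNhd_trans {E : Type*} [MetricSpace E] {ω ω' ω'' : RCLLPath E} {T : ℝ≥0} {ε : ℝ}
    (hε : ε ≤ 1) (h : ω' ∈ skorokhodNhd dist ω (T + 1) (ε / 2))
    (h' : ω'' ∈ skorokhodNhd dist ω' (T + 1) (ε / 2)) :
    ω'' ∈ skorokhodNhd dist ω T ε := by
  obtain ⟨l, hl⟩ := h
  obtain ⟨l', hl'⟩ := h'
  refine ⟨l'.trans l, fun t ht => ?_⟩
  obtain ⟨h1, h2⟩ := hl' t (ht.trans (by simp))
  have key : l' t ≤ T + 1 := by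
    rw [NNReal.dist_eq, abs_lt] at h1
    have h4 : (t : ℝ) ≤ T := by exact_mod_cast ht
    have : (l' t : ℝ) ≤ T + 1 := by linarith [h1.2]
    exact_mod_cast this
  obtain ⟨h3, h4⟩ := hl _ key
  rw [OrderIso.trans_apply]
  refine ⟨?_, ?_⟩
  · linarith [dist_triangle (l (l' t)) (l' t) t]
  · linarith [dist_triangle (ω'' t) (ω' (l' t)) (ω (l (l' t)))]

/-- The uniformity of the Skorokhod topology. -/
noncomputable def skorokhodUniformity (E : Type*) [MetricSpace E] :
    Filter (RCLLPath E × RCLLPath E) :=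
  ⨅ n : ℕ, 𝓟 (skorokhodEntourage dist (n : ℝ≥0) (1 / ((n : ℝ) + 1)))

lemma skorokhodUniformity_hasBasis (E : Type*) [MetricSpace E] :
    (skorokhodUniformity E).HasBasis (fun _ : ℕ => True)
      fun n => skorokhodEntourage dist (n : ℝ≥0) (1 / ((n : ℝ) + 1)) := by
  refine hasBasis_iInf_principal (Antitone.directed_ge fun m n hmn => ?_)
  rintro ⟨ω, ω'⟩ h
  exact skorokhodNhd_mono dist ω (by exact_mod_cast hmn)
    (one_div_le_one_div_of_le (by positivity) (by gcongr)) h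

lemma skorokhodEntourage_mem_uniformity {E : Type*} [MetricSpace E] (T : ℝ≥0) {ε : ℝ}
    (hε : 0 < ε) : skorokhodEntourage dist T ε ∈ skorokhodUniformity E := by
  obtain ⟨n, hn⟩ := exists_nat_ge T
  obtain ⟨m, hm⟩ := exists_nat_one_div_lt hε
  refine (skorokhodUniformity_hasBasis E).mem_iff.2 ⟨max n m, trivial, ?_⟩
  rintro ⟨ω, ω'⟩ h
  refine skorokhodNhd_mono dist ω (hn.trans (by exact_mod_cast le_max_left n m)) ?_ h
  refine le_trans (one_div_le_one_div_of_le (by positivity) ?_) hm.le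
  gcongr
  exact le_max_right n m

/-- The uniform structure inducing the Skorokhod topology. -/
noncomputable def skorokhodCore (E : Type*) [MetricSpace E] :
    UniformSpace.Core (RCLLPath E) where
  uniformity := skorokhodUniformity E
  refl := by
    refine (skorokhodUniformity_hasBasis E).ge_iff.2 fun n _ => ?_
    rintro ⟨ω, ω'⟩ h
    obtain rfl : ω = ω' := h
    exact skorokhodNhd_self ω _ (by positivity)
  symm := by
    refine (skorokhodUniformity_hasBasis E).tendsto_right_iff.2 fun n _ => ?_
    filter_upwards [skorokhodEntourage_mem_uniformity (E := E) ((n : ℝ≥0) + 1)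
      (ε := 1 / ((n : ℝ) + 1)) (by positivity)] with p hp
    refine skorokhodNhd_symm ?_ hp
    rw [div_le_one (by positivity)]
    linarith [n.cast_nonneg (α := ℝ)]
  comp := by
    refine (skorokhodUniformity_hasBasis E).ge_iff.2 fun n _ => ?_
    have hn : (1 : ℝ) / ((n : ℝ) + 1) ≤ 1 := by
      rw [div_le_one (by positivity)]
      linarith [n.cast_nonneg (α := ℝ)]
    refine mem_of_superset (mem_lift' (skorokhodEntourage_mem_uniformity (E := E) ((n : ℝ≥0) + 1)
      (ε := 1 / ((n : ℝ) + 1) / 2) (by positivity))) ?_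
    rintro ⟨ω, ω''⟩ ⟨ω', h, h'⟩
    exact skorokhodNhd_trans hn h h'

variable {E : Type*} [TopologicalSpace E] [TopologicalSpace.MetrizableSpace E]

/-- The topology is defined by its open sets, which alone does not make `skorokhodNhd` a
neighbourhood. The identification with a uniform topology supplies this, and metrizability follows
from the countable basis of entourages. -/
lemma skorokhodCore_toTopologicalSpace :
    (UniformSpace.ofCore (@skorokhodCore E
      (TopologicalSpace.metrizableSpaceMetric E))).toTopologicalSpace =
      (inferInstance : TopologicalSpace (RCLLPath E)) := by
  let _ := TopologicalSpace.metrizableSpaceMetric E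
  let u := UniformSpace.ofCore (skorokhodCore E)
  refine TopologicalSpace.ext_iff.2 fun U => ?_
  rw [isOpen_skorokhod_iff, isOpen_uniformity]
  refine forall₂_congr fun ω _ => ?_
  constructor
  · intro h
    obtain ⟨n, -, hn⟩ := (skorokhodUniformity_hasBasis E).mem_iff.1 h
    exact ⟨n, 1 / ((n : ℝ) + 1), by positivity, fun ω' h' => @hn (ω, ω') h' rfl⟩
  · rintro ⟨T, ε, hε, h⟩
    refine mem_of_superset (skorokhodEntourage_mem_uniformity (E := E) T hε) ?_
    rintro ⟨ω₁, ω₂⟩ h' (rfl : ω₁ = ω)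
    exact h h'

lemma skorokhodNhd_mem_nhds (ω : RCLLPath E) (T : ℝ≥0) {ε : ℝ} (hε : 0 < ε) :
    skorokhodNhd (TopologicalSpace.metrizableSpaceMetric E).dist ω T ε ∈ 𝓝 ω := by
  let _ := TopologicalSpace.metrizableSpaceMetric E
  let u := UniformSpace.ofCore (skorokhodCore E)
  have h := UniformSpace.ball_mem_nhds (α := RCLLPath E) ω
    (skorokhodEntourage_mem_uniformity (E := E) T hε)
  rwa [skorokhodCore_toTopologicalSpace] at h

lemma mem_nhds_iff_skorokhodNhd (ω : RCLLPath E) (U : Set (RCLLPath E)) :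
    U ∈ 𝓝 ω ↔ ∃ T : ℝ≥0, ∃ ε > 0,
      skorokhodNhd (TopologicalSpace.metrizableSpaceMetric E).dist ω T ε ⊆ U := by
  constructor
  · intro h
    obtain ⟨V, hVU, hV, hω⟩ := mem_nhds_iff.1 h
    obtain ⟨T, ε, hε, h⟩ := (isOpen_skorokhod_iff V).1 hV ω hω
    exact ⟨T, ε, hε, h.trans hVU⟩
  · rintro ⟨T, ε, hε, h⟩
    exact mem_of_superset (skorokhodNhd_mem_nhds ω T hε) h

lemma tendsto_skorokhod_iff {ι : Type*} {f : Filter ι} {x : ι → RCLLPath E} {ω : RCLLPath E} :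
    Tendsto x f (𝓝 ω) ↔ ∀ (T : ℝ≥0), ∀ ε > 0, ∀ᶠ i in f,
      x i ∈ skorokhodNhd (TopologicalSpace.metrizableSpaceMetric E).dist ω T ε := by
  constructor
  · exact fun h T ε hε => h (skorokhodNhd_mem_nhds ω T hε)
  · intro h U hU
    obtain ⟨T, ε, hε, hTU⟩ := (mem_nhds_iff_skorokhodNhd ω U).1 hU
    exact mem_map.2 (mem_of_superset (h T ε hε) fun i hi => hTU hi)

instance : TopologicalSpace.PseudoMetrizableSpace (RCLLPath E) := by
  let _ := TopologicalSpace.metrizableSpaceMetric E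
  let u := UniformSpace.ofCore (skorokhodCore E)
  have : (uniformity (RCLLPath E)).IsCountablyGenerated :=
    (skorokhodUniformity_hasBasis E).isCountablyGenerated
  have h := UniformSpace.pseudoMetrizableSpace (X := RCLLPath E)
  rwa [skorokhodCore_toTopologicalSpace] at h

/-- Inseparable paths hit the same open sets during the same open time intervals (`isOpen_hit`). If
they differed at `t`, right-continuity would give disjoint open sets that only one of them visits
just after `t`. -/
instance : T0Space (RCLLPath E) := by
  refine ⟨fun ω ω' h => ext fun t => ?_⟩
  by_contra hne
  obtain ⟨U, V, hU, hV, hωU, hωV, hUV⟩ := t2_separation hne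
  have h1 : ∀ᶠ s in 𝓝[>] t, ω' s ∈ V := ω'.tendsto_nhdsGT t (hV.mem_nhds hωV)
  obtain ⟨b, hb, hbV⟩ := (mem_nhdsGT_iff_exists_Ioo_subset).1 h1
  have h2 : ∀ᶠ s in 𝓝[>] t, ω s ∈ U := ω.tendsto_nhdsGT t (hU.mem_nhds hωU)
  obtain ⟨s, hs, hs'⟩ := (h2.and (Ioo_mem_nhdsGT hb)).exists
  obtain ⟨s', h3, h4, h5⟩ := (h.mem_open_iff (isOpen_hit t b hU)).1 ⟨s, hs'.1, hs'.2, hs⟩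
  exact Set.disjoint_left.1 hUV h5 (hbV ⟨h3, h4⟩)

instance : TopologicalSpace.MetrizableSpace (RCLLPath E) :=
  inferInstance

end SkorokhodTopology

end RCLLPath

/-! ### Approximation of paths by step paths -/

namespace RCLLPath

section StepApproximation

/-- Induction along a path: a property of times holds for all times if it holds at `0` and
propagates over intervals on which the path stays in a small ball. -/
lemma induction_of_small_oscillation {E : Type*} [MetricSpace E] (ω : RCLLPath E) {ε : ℝ}
    (hε : 0 < ε) (C : ℝ≥0 → Prop) (h0 : C 0)
    (step : ∀ s s', s < s' → ∀ a, (∀ r ∈ Set.Ico s s', dist (ω r) a < ε) → C s → C s') :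
    ∀ s, C s := by
  by_contra hcon
  push Not at hcon
  obtain ⟨s₁, hs₁⟩ := hcon
  set A : Set ℝ≥0 := {s | ∀ r ≤ s, C r} with hA
  have hA0 : (0 : ℝ≥0) ∈ A := fun r hr => by rwa [nonpos_iff_eq_zero.1 hr]
  have hbdd : BddAbove A := ⟨s₁, fun s hs => by
    by_contra h
    exact hs₁ (hs s₁ (not_le.1 h).le)⟩
  set s := sSup A with hs
  have hlt : ∀ r < s, C r := fun r hr => by
    obtain ⟨r', hr', hrr'⟩ := exists_lt_of_lt_csSup ⟨0, hA0⟩ hr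
    exact hr' r hrr'.le
  -- The left limit at `s` provides the centre of a ball containing the path just before `s`, so the
  -- property passes to the supremum; right-continuity then carries it beyond.
  have hCs : C s := by
    rcases eq_or_ne s 0 with h | h
    · rwa [h]
    have hpos : 0 < s := pos_iff_ne_zero.2 h
    obtain ⟨a, ha⟩ := ω.leftLim' s
    have hev : ∀ᶠ r in 𝓝[<] s, dist (ω r) a < ε := ha (Metric.ball_mem_nhds a hε)
    obtain ⟨b, hb, hbs⟩ := (mem_nhdsLT_iff_exists_Ioo_subset' hpos).1 hev
    obtain ⟨r, hr⟩ := exists_between (show b < s from hb)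
    exact step r s hr.2 a (fun r' hr' => hbs ⟨hr.1.trans_le hr'.1, hr'.2⟩) (hlt r hr.2)
  have hev : ∀ᶠ r in 𝓝[≥] s, dist (ω r) (ω s) < ε := ω.rightCont' s (Metric.ball_mem_nhds _ hε)
  obtain ⟨b, hb, hbs⟩ := (mem_nhdsGE_iff_exists_Ico_subset).1 hev
  have hb' : b ∈ A := fun r hr => by
    rcases lt_trichotomy r s with h | h | h
    · exact hlt r h
    · rwa [h]
    · exact step s r h (ω s) (fun r' hr' => hbs ⟨hr'.1, hr'.2.trans_le hr⟩) hCs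
  exact absurd (le_csSup hbdd hb') (not_le.2 hb)

/-- Replace a time change after time `u` by one with constant slope `c`. -/
lemma exists_orderIso_glue (l : ℝ≥0 ≃o ℝ≥0) (u : ℝ≥0) {c : ℝ≥0} (hc : 0 < c) :
    ∃ l' : ℝ≥0 ≃o ℝ≥0, (∀ t ≤ u, l' t = l t) ∧ ∀ t, u ≤ t → l' t = l u + c * (t - u) := by
  set g : ℝ≥0 → ℝ≥0 := fun t => l (min t u) + c * (t - u) with hg
  have h1 : ∀ t ≤ u, g t = l t := fun t ht => by simp [hg, ht, tsub_eq_zero_of_le ht]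
  have h2 : ∀ t, u ≤ t → g t = l u + c * (t - u) := fun t ht => by simp [hg, ht]
  have hmono : StrictMono g := by
    intro s t hst
    rcases le_or_gt t u with ht | ht
    · rw [h1 t ht, h1 s (hst.le.trans ht)]
      exact l.strictMono hst
    · rw [h2 t ht.le]
      rcases le_or_gt s u with hs | hs
      · rw [h1 s hs]
        refine lt_of_le_of_lt (l.monotone hs) (lt_add_of_pos_right _ ?_)
        exact mul_pos hc (tsub_pos_of_lt ht)
      · rw [h2 s hs.le]
        gcongr
        exact tsub_lt_tsub_right_of_le hs.le hst
  have hsurj : Function.Surjective g := by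
    intro y
    rcases le_or_gt y (l u) with hy | hy
    · refine ⟨l.symm y, ?_⟩
      rw [h1 _ (by rwa [OrderIso.symm_apply_le]), l.apply_symm_apply]
    · refine ⟨u + (y - l u) / c, ?_⟩
      rw [h2 _ (by simp), add_tsub_cancel_left, mul_div_cancel₀ _ hc.ne',
        add_tsub_cancel_of_le hy.le]
  exact ⟨hmono.orderIsoOfSurjective g hsurj, h1, h2⟩

/-- Interpolate linearly from `(u, s)` to `(u', s')` and continue with slope one. The displacement
on `[u, u']` is a convex combination of those at the two ends, and it is constant afterwards, so it
stays below `ε`. -/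
lemma exists_orderIso_extend (l : ℝ≥0 ≃o ℝ≥0) {u u' s s' : ℝ≥0} {ε : ℝ}
    (hl : ∀ t, dist (l t) t < ε) (hus : l u = s) (hu : u < u') (hs : s < s')
    (h' : dist s' u' < ε) :
    ∃ l' : ℝ≥0 ≃o ℝ≥0, (∀ t ≤ u, l' t = l t) ∧ l' u' = s' ∧ ∀ t, dist (l' t) t < ε := by
  have hc : 0 < (s' - s) / (u' - u) := div_pos (tsub_pos_of_lt hs) (tsub_pos_of_lt hu)
  obtain ⟨l₁, h₁, h₁'⟩ := exists_orderIso_glue l u hc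
  obtain ⟨l₂, h₂, h₂'⟩ := exists_orderIso_glue l₁ u' one_pos
  have hu's' : l₁ u' = s' := by
    rw [h₁' u' hu.le, hus, div_mul_cancel₀ _ (tsub_pos_of_lt hu).ne', add_tsub_cancel_of_le hs.le]
  refine ⟨l₂, fun t ht => by rw [h₂ t (ht.trans hu.le), h₁ t ht], by rw [h₂ u' le_rfl, hu's'],
    fun t => ?_⟩
  have hdu := hl u
  rw [hus] at hdu
  rcases le_or_gt t u with ht | ht
  · rw [h₂ t (ht.trans hu.le), h₁ t ht]
    exact hl t
  rcases le_or_gt t u' with ht' | ht'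
  · rw [h₂ t ht', h₁' t ht.le, hus]
    rw [NNReal.dist_eq, abs_lt] at hdu h' ⊢
    push_cast [NNReal.coe_sub ht.le, NNReal.coe_sub hu.le, NNReal.coe_sub hs.le]
    have e1 : (u : ℝ) < t := by exact_mod_cast ht
    have e2 : (t : ℝ) ≤ u' := by exact_mod_cast ht'
    have e3 : (0 : ℝ) < u' - u := by linarith
    set θ : ℝ := (t - u) / (u' - u) with hθ
    have hθ0 : 0 ≤ θ := div_nonneg (by linarith) e3.le
    have hθ1 : θ ≤ 1 := by rw [hθ, div_le_one e3]; linarith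
    have ht_eq : (t : ℝ) = u + θ * (u' - u) := by rw [hθ]; field_simp; ring
    have hkey : (s : ℝ) + (s' - s) / (u' - u) * (t - u) - t
        = (1 - θ) * (s - u) + θ * (s' - u') := by
      rw [show (s' - s : ℝ) / (u' - u) * (t - u) = θ * (s' - s) by rw [hθ]; ring]
      linear_combination (-1) * ht_eq
    rw [hkey]
    constructor
    · rcases hθ0.eq_or_lt with h | h
      · rw [← h]; linarith [hdu.1]
      · nlinarith [mul_lt_mul_of_pos_left h'.1 h,
          mul_le_mul_of_nonneg_left hdu.1.le (sub_nonneg.2 hθ1)]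
    · rcases hθ0.eq_or_lt with h | h
      · rw [← h]; linarith [hdu.2]
      · nlinarith [mul_lt_mul_of_pos_left h'.2 h,
          mul_le_mul_of_nonneg_left hdu.2.le (sub_nonneg.2 hθ1)]
  · rw [h₂' t ht'.le, hu's', one_mul]
    rw [NNReal.dist_eq] at h' ⊢
    push_cast [NNReal.coe_sub ht'.le]
    convert h' using 2
    ring

/-- The step path which is equal to `a k` on `[k / (n + 1), (k + 1) / (n + 1))`. -/
noncomputable def stepPath {E : Type*} [TopologicalSpace E] (n : ℕ) (a : ℕ → E) : RCLLPath E where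
  toFun t := a ⌊((n : ℝ≥0) + 1) * t⌋₊
  rightCont' t := by
    have hn : (0 : ℝ≥0) < (n : ℝ≥0) + 1 := by positivity
    refine (tendsto_const_nhds (x := a ⌊((n : ℝ≥0) + 1) * t⌋₊)).congr' ?_
    have h : t < (⌊((n : ℝ≥0) + 1) * t⌋₊ + 1) / ((n : ℝ≥0) + 1) := by
      rw [lt_div_iff₀' hn]
      exact Nat.lt_floor_add_one _
    filter_upwards [Ico_mem_nhdsGE h] with s hs
    congr 1
    refine le_antisymm (Nat.floor_mono (mul_le_mul_of_nonneg_left hs.1 hn.le)) ?_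
    rw [← Nat.lt_add_one_iff, Nat.floor_lt (by positivity)]
    have := hs.2
    rw [lt_div_iff₀' hn] at this
    exact_mod_cast this
  leftLim' t := by
    have hn : (0 : ℝ≥0) < (n : ℝ≥0) + 1 := by positivity
    rcases eq_or_ne t 0 with rfl | ht
    · exact ⟨a 0, by simp⟩
    have hpos : 0 < t := pos_iff_ne_zero.2 ht
    have hceil : 0 < ⌈((n : ℝ≥0) + 1) * t⌉₊ := Nat.ceil_pos.2 (mul_pos hn hpos)
    obtain ⟨c, hc⟩ : ∃ c, ⌈((n : ℝ≥0) + 1) * t⌉₊ = c + 1 :=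
      ⟨_, (Nat.succ_pred_eq_of_pos hceil).symm⟩
    have hct : (c : ℝ≥0) < ((n : ℝ≥0) + 1) * t := Nat.lt_ceil.1 (by omega)
    have htc : ((n : ℝ≥0) + 1) * t ≤ c + 1 := by
      have := Nat.le_ceil (((n : ℝ≥0) + 1) * t)
      rw [hc] at this
      exact_mod_cast this
    have h : (c : ℝ≥0) / ((n : ℝ≥0) + 1) < t := by rwa [div_lt_iff₀' hn]
    refine ⟨a c, (tendsto_const_nhds (x := a c)).congr' ?_⟩
    filter_upwards [Ioo_mem_nhdsLT h] with s hs
    congr 1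
    symm
    rw [Nat.floor_eq_iff (by positivity)]
    refine ⟨?_, (mul_lt_mul_of_pos_left hs.2 hn).trans_le htc⟩
    have := hs.1
    rw [div_lt_iff₀' hn] at this
    exact this.le

/-- Up to time `T` only finitely many values matter, and the identity serves as time change. -/
lemma continuous_stepPath {E : Type*} [TopologicalSpace E] [TopologicalSpace.MetrizableSpace E]
    (n : ℕ) : Continuous (stepPath n : (ℕ → E) → RCLLPath E) := by
  let _ := TopologicalSpace.metrizableSpaceMetric E
  refine continuous_iff_continuousAt.2 fun a => tendsto_skorokhod_iff.2 fun T ε hε => ?_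
  have h : ∀ᶠ a' : ℕ → E in 𝓝 a, ∀ k ∈ Finset.range (⌊((n : ℝ≥0) + 1) * T⌋₊ + 1),
      dist (a' k) (a k) < ε := by
    refine (Filter.eventually_all_finset _).2 fun k _ => ?_
    exact (continuous_apply k).continuousAt.eventually (Metric.ball_mem_nhds (a k) hε)
  filter_upwards [h] with a' ha'
  refine ⟨OrderIso.refl _, fun t ht => ⟨by simpa using hε, ha' _ ?_⟩⟩
  rw [Finset.mem_range, Nat.lt_add_one_iff]
  exact Nat.floor_mono (mul_le_mul_of_nonneg_left ht (by positivity))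

/-- The time change has to match the jumps of the path with grid points. It is built piece by piece
over intervals of small oscillation, sending the first grid point at or after `s` to `s`. -/
lemma tendsto_stepPath {E : Type*} [TopologicalSpace E] [TopologicalSpace.MetrizableSpace E]
    (ω : RCLLPath E) :
    Tendsto (fun n : ℕ => stepPath n fun k => ω (k / ((n : ℝ≥0) + 1))) atTop (𝓝 ω) := by
  let _ := TopologicalSpace.metrizableSpaceMetric E
  refine tendsto_skorokhod_iff.2 fun T ε hε => ?_
  have hmain : ∀ s : ℝ≥0, ∀ᶠ n : ℕ in atTop, ∃ l : ℝ≥0 ≃o ℝ≥0, (∀ t, dist (l t) t < ε) ∧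
      l (⌈((n : ℝ≥0) + 1) * s⌉₊ / ((n : ℝ≥0) + 1)) = s ∧
      ∀ t < ⌈((n : ℝ≥0) + 1) * s⌉₊ / ((n : ℝ≥0) + 1),
        dist (stepPath n (fun k => ω (k / ((n : ℝ≥0) + 1))) t) (ω (l t)) < ε := by
    -- Half of `ε`, since the sampled value and the true value are both compared with the centre `a`
    -- of the ball.
    refine induction_of_small_oscillation ω (half_pos hε) _ ?_ ?_
    · exact Eventually.of_forall fun n => ⟨OrderIso.refl _, by simpa using hε, by simp, by simp⟩
    · intro s s' hss' a ha hs
      have hε' : ∀ᶠ n : ℕ in atTop, 1 / ((n : ℝ) + 1) < ε :=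
        tendsto_one_div_add_atTop_nhds_zero_nat.eventually (gt_mem_nhds hε)
      have hgap : ∀ᶠ n : ℕ in atTop, 1 / ((n : ℝ) + 1) < s' - s :=
        tendsto_one_div_add_atTop_nhds_zero_nat.eventually
          (gt_mem_nhds (sub_pos.2 (by exact_mod_cast hss')))
      -- The mesh must be smaller than `s' - s` for the two grid points to be distinct, and smaller
      -- than `ε` for the displacement at `u'`.
      filter_upwards [hs, hε', hgap] with n ⟨l, hl, hls, hlt⟩ hn1 hn2
      have hn : (0 : ℝ≥0) < (n : ℝ≥0) + 1 := by positivity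
      have hnR : (0 : ℝ) < (n : ℝ) + 1 := by positivity
      set u := (⌈((n : ℝ≥0) + 1) * s⌉₊ : ℝ≥0) / ((n : ℝ≥0) + 1) with hu
      set u' := (⌈((n : ℝ≥0) + 1) * s'⌉₊ : ℝ≥0) / ((n : ℝ≥0) + 1) with hu'
      have hsu : s ≤ u := by
        rw [hu, le_div_iff₀' hn]
        exact Nat.le_ceil _
      have hsu' : s' ≤ u' := by
        rw [hu', le_div_iff₀' hn]
        exact Nat.le_ceil _
      have hus : (u : ℝ) < s + 1 / ((n : ℝ) + 1) := by
        have := Nat.ceil_lt_add_one (a := ((n : ℝ≥0) + 1) * s) (by positivity)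
        have : u < s + 1 / ((n : ℝ≥0) + 1) := by
          rw [hu, div_lt_iff₀' hn, mul_add, mul_one_div_cancel hn.ne']
          exact this
        exact_mod_cast this
      have hus' : (u' : ℝ) < s' + 1 / ((n : ℝ) + 1) := by
        have := Nat.ceil_lt_add_one (a := ((n : ℝ≥0) + 1) * s') (by positivity)
        have : u' < s' + 1 / ((n : ℝ≥0) + 1) := by
          rw [hu', div_lt_iff₀' hn, mul_add, mul_one_div_cancel hn.ne']
          exact this
        exact_mod_cast this
      have huu' : u < u' := by
        have : (s' : ℝ) ≤ u' := by exact_mod_cast hsu'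
        have : (u : ℝ) < u' := by linarith
        exact_mod_cast this
      have hd : dist s' u' < ε := by
        have : (s' : ℝ) ≤ u' := by exact_mod_cast hsu'
        rw [NNReal.dist_eq, abs_lt]
        constructor <;> linarith
      obtain ⟨l', hl'u, hl'u', hl'⟩ := exists_orderIso_extend l hl hls huu' hss' hd
      refine ⟨l', hl', hl'u', fun t ht => ?_⟩
      rcases lt_or_ge t u with htu | htu
      · rw [hl'u t htu.le]
        exact hlt t htu
      have h1 : l' t ∈ Set.Ico s s' := by
        refine ⟨?_, ?_⟩
        · rw [← hls, ← hl'u u le_rfl]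
          exact l'.monotone htu
        · rw [← hl'u']
          exact l'.strictMono ht
      have h2 : (⌊((n : ℝ≥0) + 1) * t⌋₊ : ℝ≥0) / ((n : ℝ≥0) + 1) ∈ Set.Ico s s' := by
        refine ⟨hsu.trans ?_, ?_⟩
        · rw [hu]
          gcongr
          refine Nat.le_floor ?_
          rwa [hu, div_le_iff₀' hn] at htu
        · rw [div_lt_iff₀' hn, ← Nat.lt_ceil, Nat.floor_lt (by positivity)]
          rwa [hu', lt_div_iff₀' hn] at ht
      calc dist (ω ((⌊((n : ℝ≥0) + 1) * t⌋₊ : ℝ≥0) / ((n : ℝ≥0) + 1))) (ω (l' t))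
          ≤ _ := dist_triangle_right _ _ a
        _ < ε / 2 + ε / 2 := add_lt_add (ha _ h2) (ha _ h1)
        _ = ε := add_halves ε
  -- Control is strict before the grid point, so a horizon beyond `T` is needed to include `T`
  -- itself.
  filter_upwards [hmain (T + 1)] with n ⟨l, hl, hls, hlt⟩
  refine ⟨l, fun t ht => ⟨hl t, hlt t (ht.trans_lt ?_)⟩⟩
  have hn : (0 : ℝ≥0) < (n : ℝ≥0) + 1 := by positivity
  rw [lt_div_iff₀' hn]
  exact lt_of_lt_of_le (mul_lt_mul_of_pos_left (lt_add_one T) hn) (Nat.le_ceil _)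

end StepApproximation

end RCLLPath

/-! ### Measurability on path space -/

namespace RCLLPath

section Measurability

instance {E : Type*} [TopologicalSpace E] [TopologicalSpace.MetrizableSpace E]
    [SecondCountableTopology E] : SecondCountableTopology (RCLLPath E) := by
  have h : TopologicalSpace.IsSeparable (Set.univ : Set (RCLLPath E)) := by
    have h1 : TopologicalSpace.IsSeparable
        (closure (⋃ n, Set.range (stepPath n : (ℕ → E) → RCLLPath E))) :=
      (TopologicalSpace.IsSeparable.iUnion fun n =>
        TopologicalSpace.isSeparable_range (continuous_stepPath n)).closure
    refine h1.mono fun ω _ => mem_closure_of_tendsto (tendsto_stepPath ω) ?_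
    exact Eventually.of_forall fun n => Set.mem_iUnion.2 ⟨n, Set.mem_range_self _⟩
  have : TopologicalSpace.SeparableSpace (RCLLPath E) := TopologicalSpace.isSeparable_univ_iff.1 h
  let _ := TopologicalSpace.metrizableSpaceMetric (RCLLPath E)
  exact UniformSpace.secondCountable_of_separable _

variable {E : Type*} [TopologicalSpace E] [TopologicalSpace.MetrizableSpace E]
  [SecondCountableTopology E] [MeasurableSpace E] [BorelSpace E]

/-- A path is the limit of its step approximations, each of which is a continuous function of
countably many coordinates. So the coordinates generate the Borel `σ`-algebra. -/
lemma measurable_of_coord {α : Type*} [MeasurableSpace α] {f : α → RCLLPath E}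
    (hf : ∀ t, Measurable fun a => f a t) : Measurable f := by
  refine measurable_of_tendsto_metrizable
    (f := fun (n : ℕ) a => stepPath n fun k => f a (k / ((n : ℝ≥0) + 1))) (fun n => ?_)
    (tendsto_pi_nhds.2 fun a => tendsto_stepPath (f a))
  exact (continuous_stepPath n).measurable.comp (measurable_pi_lambda _ fun k => hf _)

lemma measurable_apply (t : ℝ≥0) : Measurable fun ω : RCLLPath E => ω t :=
  measurable_coord t

/-- Evaluate at the next grid point strictly after the given time: this takes countably many times
and converges by right-continuity. -/
lemma measurable_uncurry_apply : Measurable fun p : ℝ≥0 × RCLLPath E => p.2 p.1 := by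
  refine measurable_of_tendsto_metrizable
    (f := fun (n : ℕ) (p : ℝ≥0 × RCLLPath E) => p.2 ((⌊(n + 1) * p.1⌋₊ + 1) / (n + 1)))
    (fun n => ?_)
    (tendsto_pi_nhds.2 fun p => ?_)
  · have h : Measurable fun q : ℕ × RCLLPath E => q.2 (((q.1 : ℝ≥0) + 1) / (n + 1)) :=
      measurable_from_prod_countable_right fun k => measurable_apply (((k : ℝ≥0) + 1) / (n + 1))
    exact h.comp ((Nat.measurable_floor.comp (measurable_fst.const_mul _)).prodMk measurable_snd)
  · refine (p.2.tendsto_nhdsGT p.1).comp (tendsto_nhdsWithin_iff.2 ⟨?_, Eventually.of_forall ?_⟩)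
    · refine tendsto_of_tendsto_of_tendsto_of_le_of_le (g := fun _ => p.1)
          (h := fun n : ℕ => p.1 + 1 / ((n : ℝ≥0) + 1)) tendsto_const_nhds ?_
          (fun n => ?_) (fun n => ?_)
      · simpa using tendsto_const_nhds.add
          (tendsto_one_div_add_atTop_nhds_zero_nat (𝕜 := ℝ≥0))
      · have hn : (0 : ℝ≥0) < (n : ℝ≥0) + 1 := by positivity
        change p.1 ≤ _ / _
        rw [le_div_iff₀' hn]
        exact (Nat.lt_floor_add_one _).le
      · have hn : (0 : ℝ≥0) < (n : ℝ≥0) + 1 := by positivity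
        change _ / _ ≤ _
        rw [div_le_iff₀' hn, mul_add, mul_one_div_cancel hn.ne']
        gcongr
        exact Nat.floor_le (by positivity)
    · intro n
      have hn : (0 : ℝ≥0) < (n : ℝ≥0) + 1 := by positivity
      change p.1 < _ / _
      rw [lt_div_iff₀' hn]
      exact Nat.lt_floor_add_one _

lemma measurable_pair {E' : Type*} [TopologicalSpace E'] [TopologicalSpace.MetrizableSpace E']
    [SecondCountableTopology E'] [MeasurableSpace E'] [BorelSpace E'] :
    Measurable fun p : RCLLPath E × RCLLPath E' => p.1.pair p.2 :=
  measurable_of_coord fun t =>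
    ((measurable_apply t).comp measurable_fst).prodMk ((measurable_apply t).comp measurable_snd)

lemma measurable_comp_const_mul :
    Measurable fun p : ℝ≥0 × RCLLPath ℝ≥0 =>
      p.2.comp (fun y => p.1 * y) (continuous_const_mul p.1) :=
  measurable_of_coord fun t => measurable_fst.mul ((measurable_apply t).comp measurable_snd)

/-- The path stopped at the deterministic time `t`. -/
def stopAt {E : Type*} [TopologicalSpace E] (t : ℝ≥0) (ω : RCLLPath E) : RCLLPath E where
  toFun s := ω (min s t)
  rightCont' s := by
    refine (ω.rightCont' (min s t)).comp (f := fun u : ℝ≥0 => min u t)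
      (by fun_prop) (fun u hu => ?_)
    exact min_le_min_right t hu
  leftLim' s := by
    rcases le_or_gt s t with hs | hs
    · obtain ⟨l, hl⟩ := ω.leftLim' s
      refine ⟨l, hl.congr' ?_⟩
      filter_upwards [self_mem_nhdsWithin] with u hu
      rw [min_eq_left ((show u < s from hu).le.trans hs)]
    · refine ⟨ω t, (tendsto_const_nhds (x := ω t)).congr' ?_⟩
      filter_upwards [Ioo_mem_nhdsLT hs] with u hu
      rw [min_eq_right hu.1.le]

lemma stopAt_apply {E : Type*} [TopologicalSpace E] (t s : ℝ≥0) (ω : RCLLPath E) :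
    stopAt t ω s = ω (min s t) := rfl

lemma measurable_stopAt (t : ℝ≥0) : Measurable (stopAt t : RCLLPath E → RCLLPath E) :=
  measurable_of_coord fun _ => measurable_apply _

/-- Represents the past as the `σ`-algebra of one path-valued random element, so densities and
generators on it come from those of path space. -/
lemma rawFiltration_eq_comap_stopAt (t : ℝ≥0) :
    (rawFiltration E t : MeasurableSpace (RCLLPath E)) =
      MeasurableSpace.comap (stopAt t) inferInstance := by
  refine le_antisymm ?_ ?_
  · refine iSup₂_le fun s hs => ?_
    borelize E
    rintro _ ⟨B, hB, rfl⟩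
    refine ⟨coord s ⁻¹' B, measurable_coord s hB, ?_⟩
    ext ω
    simp [coord, stopAt_apply, min_eq_left hs]
  · rw [← measurable_iff_comap_le]
    refine @measurable_of_coord E _ _ _ _ _ _ (rawFiltration E t) _ fun s => ?_
    have h : (MeasurableSpace.comap (coord (min s t)) inferInstance : MeasurableSpace (RCLLPath E))
        ≤ rawFiltration E t :=
      le_iSup₂_of_le (f := fun (j : ℝ≥0) (_ : j ≤ t) =>
        (MeasurableSpace.comap (coord j) inferInstance : MeasurableSpace (RCLLPath E)))
        (min s t) (min_le_right _ _) le_rfl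
    exact (comap_measurable (coord (min s t))).mono h le_rfl

/-- Galmarino's test: a Borel functional unaffected by stopping the path at `t` is known at time
`t`. -/
lemma measurable_rawFiltration_of_stopAt {β : Type*} [MeasurableSpace β] {f : RCLLPath E → β}
    (hf : Measurable f) {t : ℝ≥0} (h : ∀ ω, f (stopAt t ω) = f ω) :
    Measurable[rawFiltration E t] f := by
  rw [rawFiltration_eq_comap_stopAt]
  have : f = f ∘ stopAt t := funext fun ω => (h ω).symm
  rw [this]
  exact hf.comp (comap_measurable _)

end Measurability

end RCLLPath

/-! ### Paths seen along the rational times -/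

namespace RCLLPath

section RationalTimes

lemma exists_nnrat_btwn {a b : ℝ≥0} (h : a < b) : ∃ q : ℚ≥0, a < q ∧ (q : ℝ≥0) < b := by
  obtain ⟨q, hq0, h1, h2⟩ := (NNReal.lt_iff_exists_rat_btwn a b).1 h
  lift q to ℚ≥0 using hq0
  have : (q : ℝ≥0) = Real.toNNReal (q : ℚ) := by
    rw [← NNReal.coe_inj, Real.coe_toNNReal _ (by positivity)]
    norm_cast
  exact ⟨q, by rwa [this], by rwa [this]⟩

/-- The filter of rational times approaching `t` strictly from the right. -/
def ratRight (t : ℝ≥0) : Filter ℚ≥0 := comap (fun q : ℚ≥0 => (q : ℝ≥0)) (𝓝[>] t)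

/-- The filter of rational times approaching `t` strictly from the left. -/
def ratLeft (t : ℝ≥0) : Filter ℚ≥0 := comap (fun q : ℚ≥0 => (q : ℝ≥0)) (𝓝[<] t)

lemma eventually_ratRight {t : ℝ≥0} {p : ℚ≥0 → Prop} :
    (∀ᶠ q in ratRight t, p q) ↔ ∃ b > t, ∀ q : ℚ≥0, t < q → (q : ℝ≥0) < b → p q := by
  rw [ratRight, eventually_comap]
  constructor
  · intro h
    obtain ⟨b, hb, hbs⟩ := (mem_nhdsGT_iff_exists_Ioo_subset).1 h
    exact ⟨b, hb, fun q h1 h2 => hbs ⟨h1, h2⟩ q rfl⟩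
  · rintro ⟨b, hb, h⟩
    filter_upwards [Ioo_mem_nhdsGT hb] with x hx q hq
    exact h q (hq ▸ hx.1) (hq ▸ hx.2)

lemma eventually_ratLeft {t : ℝ≥0} (ht : 0 < t) {p : ℚ≥0 → Prop} :
    (∀ᶠ q in ratLeft t, p q) ↔ ∃ b < t, ∀ q : ℚ≥0, b < q → (q : ℝ≥0) < t → p q := by
  rw [ratLeft, eventually_comap]
  constructor
  · intro h
    obtain ⟨b, hb, hbs⟩ := (mem_nhdsLT_iff_exists_Ioo_subset' ht).1 h
    exact ⟨b, hb, fun q h1 h2 => hbs ⟨h1, h2⟩ q rfl⟩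
  · rintro ⟨b, hb, h⟩
    filter_upwards [Ioo_mem_nhdsLT hb] with x hx q hq
    exact h q (hq ▸ hx.1) (hq ▸ hx.2)

instance (t : ℝ≥0) : (ratRight t).NeBot := by
  refine ⟨fun h => ?_⟩
  have h' : ∀ᶠ q in ratRight t, False := by rw [h]; exact eventually_bot
  obtain ⟨b, hb, h⟩ := eventually_ratRight.1 h'
  obtain ⟨q, hq, hq'⟩ := exists_nnrat_btwn hb
  exact h q hq hq'

lemma ratLeft_neBot {t : ℝ≥0} (ht : 0 < t) : (ratLeft t).NeBot := by
  refine ⟨fun h => ?_⟩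
  have h' : ∀ᶠ q in ratLeft t, False := by rw [h]; exact eventually_bot
  obtain ⟨b, hb, h⟩ := (eventually_ratLeft ht).1 h'
  obtain ⟨q, hq, hq'⟩ := exists_nnrat_btwn hb
  exact h q hq hq'

lemma ratLeft_zero : ratLeft 0 = ⊥ := by
  simp [ratLeft]

lemma tendsto_ratRight {E : Type*} [TopologicalSpace E] (ω : RCLLPath E) (t : ℝ≥0) :
    Tendsto (fun q : ℚ≥0 => ω q) (ratRight t) (𝓝 (ω t)) :=
  (ω.tendsto_nhdsGT t).comp tendsto_comap

/-- A rational sequence decreasing strictly to `t`. -/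
lemma exists_seq_ratRight (t : ℝ≥0) : ∃ r : ℕ → ℚ≥0, (∀ n, t < r n) ∧
    (∀ n, (r n : ℝ≥0) < t + 1 / ((n : ℝ≥0) + 1)) ∧ Tendsto r atTop (ratRight t) := by
  choose r hr hr' using fun n : ℕ =>
    exists_nnrat_btwn (a := t) (b := t + 1 / ((n : ℝ≥0) + 1))
      (lt_add_of_pos_right _ (by positivity))
  refine ⟨r, hr, hr', tendsto_comap_iff.2 (tendsto_nhdsWithin_iff.2
    ⟨?_, Eventually.of_forall hr⟩)⟩
  refine tendsto_of_tendsto_of_tendsto_of_le_of_le (g := fun _ => t)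
      (h := fun n : ℕ => t + 1 / ((n : ℝ≥0) + 1)) tendsto_const_nhds ?_
      (fun n => (hr n).le) (fun n => (hr' n).le)
  simpa using tendsto_const_nhds.add (tendsto_one_div_add_atTop_nhds_zero_nat (𝕜 := ℝ≥0))

/-- A function on the rational times with one-sided limits extends, via its right limits, to a
right-continuous path with left limits. -/
lemma exists_rightLim_path {E : Type*} [TopologicalSpace E] [RegularSpace E] {f : ℚ≥0 → E}
    (hr : ∀ t, ∃ l, Tendsto f (ratRight t) (𝓝 l)) (hl : ∀ t, ∃ l, Tendsto f (ratLeft t) (𝓝 l)) :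
    ∃ g : RCLLPath E, ∀ t, Tendsto f (ratRight t) (𝓝 (g t)) := by
  choose g hg using hr
  have key : ∀ (V : Set E), IsClosed V → ∀ a b : ℝ≥0,
      (∀ q : ℚ≥0, a < q → (q : ℝ≥0) < b → f q ∈ V) → ∀ t, a ≤ t → t < b → g t ∈ V := by
    intro V hV a b h t hat htb
    refine hV.mem_of_tendsto (hg t) (eventually_ratRight.2 ⟨b, htb, fun q h1 h2 => ?_⟩)
    exact h q (hat.trans_lt h1) h2
  refine ⟨⟨g, fun t => ?_, fun t => ?_⟩, hg⟩
  · refine (closed_nhds_basis (g t)).tendsto_right_iff.2 fun V hV => ?_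
    obtain ⟨b, hb, hbV⟩ := eventually_ratRight.1 (hg t hV.1)
    filter_upwards [Ico_mem_nhdsGE hb] with s hs
    exact key V hV.2 t b hbV s hs.1 hs.2
  · rcases eq_or_ne t 0 with rfl | ht
    · exact ⟨g 0, by simp⟩
    have hpos : 0 < t := pos_iff_ne_zero.2 ht
    obtain ⟨l, hl⟩ := hl t
    refine ⟨l, (closed_nhds_basis l).tendsto_right_iff.2 fun V hV => ?_⟩
    obtain ⟨b, hb, hbV⟩ := (eventually_ratLeft hpos).1 (hl hV.1)
    filter_upwards [Ioo_mem_nhdsLT hb] with s hs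
    exact key V hV.2 b t hbV s hs.1.le hs.2

/-- Over any three nearby rational times, one of the two consecutive increments of `f` is small. -/
def SmallTripleOscillation {E : Type*} [MetricSpace E] (f : ℚ≥0 → E) : Prop :=
  ∀ N k : ℕ, ∃ m : ℕ, ∀ r s u : ℚ≥0, r < s → s < u → u ≤ N → (u : ℝ≥0) ≤ r + 1 / (m + 1) →
    dist (f r) (f s) ≤ 1 / ((k : ℝ) + 1) ∨ dist (f s) (f u) ≤ 1 / ((k : ℝ) + 1)

/-- `f` is right-continuous along the rational times. -/
def RatRightCont {E : Type*} [MetricSpace E] (f : ℚ≥0 → E) : Prop :=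
  ∀ (q : ℚ≥0) (k : ℕ), ∃ m : ℕ, ∀ r : ℚ≥0, q < r → (r : ℝ≥0) < q + 1 / (m + 1) →
    dist (f r) (f q) ≤ 1 / ((k : ℝ) + 1)

/-- Near each time `t` the path is almost constant on either side of `t`. Of three ordered nearby
times, the first two lie before `t` or the last two lie at or after it, according to the middle one.
A Lebesgue number makes this uniform on `[0, N]`. -/
lemma smallTripleOscillation_of_path {E : Type*} [MetricSpace E] (ω : RCLLPath E) :
    SmallTripleOscillation fun q : ℚ≥0 => ω q := by
  intro N k
  set η : ℝ := 1 / ((k : ℝ) + 1) with hη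
  have hη0 : 0 < η := by positivity
  have hloc : ∀ t : ℝ≥0, ∃ U : Set ℝ≥0, IsOpen U ∧ t ∈ U ∧ ∀ r ∈ U, ∀ s ∈ U, ∀ u ∈ U, r < s →
      s < u → dist (ω r) (ω s) ≤ η ∨ dist (ω s) (ω u) ≤ η := by
    intro t
    obtain ⟨l, hl⟩ := ω.leftLim' t
    have h1 := eventually_nhdsWithin_iff.1 (hl (Metric.ball_mem_nhds l (half_pos hη0)))
    have h2 := eventually_nhdsWithin_iff.1
      (ω.rightCont' t (Metric.ball_mem_nhds (ω t) (half_pos hη0)))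
    obtain ⟨U, hU, hUo, htU⟩ := eventually_nhds_iff.1 (h1.and h2)
    refine ⟨U, hUo, htU, fun r hr s hs u hu hrs hsu => ?_⟩
    rcases lt_or_ge s t with hst | hst
    · left
      have e1 : dist (ω r) l < η / 2 := (hU r hr).1 (hrs.trans hst)
      have e2 : dist (ω s) l < η / 2 := (hU s hs).1 hst
      linarith [dist_triangle_right (ω r) (ω s) l]
    · right
      have e1 : dist (ω s) (ω t) < η / 2 := (hU s hs).2 hst
      have e2 : dist (ω u) (ω t) < η / 2 := (hU u hu).2 (hst.trans hsu.le)
      linarith [dist_triangle_right (ω s) (ω u) (ω t)]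
  choose U hUo htU hU using hloc
  obtain ⟨δ, hδ, hball⟩ := lebesgue_number_lemma_of_metric (isCompact_Icc (a := (0 : ℝ≥0)) (b := N))
    hUo (fun t _ => Set.mem_iUnion.2 ⟨t, htU t⟩)
  obtain ⟨m, hm⟩ := exists_nat_one_div_lt hδ
  refine ⟨m, fun r s u hrs hsu huN hur => ?_⟩
  have c1 : (r : ℝ≥0) < s := by exact_mod_cast hrs
  have c2 : (s : ℝ≥0) < u := by exact_mod_cast hsu
  have c3 : (u : ℝ≥0) ≤ N := by exact_mod_cast huN
  have d1 : ((r : ℝ≥0) : ℝ) < (s : ℝ≥0) := NNReal.coe_lt_coe.2 c1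
  have d2 : ((s : ℝ≥0) : ℝ) < (u : ℝ≥0) := NNReal.coe_lt_coe.2 c2
  have d3 : ((u : ℝ≥0) : ℝ) ≤ (r : ℝ≥0) + 1 / ((m : ℝ) + 1) := by
    have := NNReal.coe_le_coe.2 hur
    push_cast at this ⊢
    exact this
  obtain ⟨t, ht⟩ := hball s ⟨zero_le, c2.le.trans c3⟩
  refine hU t r (ht ?_) s (ht (Metric.mem_ball_self hδ)) u (ht ?_) c1 c2
  · rw [Metric.mem_ball, NNReal.dist_eq, abs_lt]
    constructor <;> linarith
  · rw [Metric.mem_ball, NNReal.dist_eq, abs_lt]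
    constructor <;> linarith

lemma ratRightCont_of_path {E : Type*} [MetricSpace E] (ω : RCLLPath E) :
    RatRightCont fun q : ℚ≥0 => ω q := by
  intro q k
  have hη : (0 : ℝ) < 1 / ((k : ℝ) + 1) := by positivity
  obtain ⟨b, hb, h⟩ := eventually_ratRight.1
    (ω.tendsto_ratRight q (Metric.closedBall_mem_nhds (ω q) hη))
  obtain ⟨m, hm⟩ := exists_nat_one_div_lt (tsub_pos_of_lt hb)
  refine ⟨m, fun r hr hr' => h r (by exact_mod_cast hr) (hr'.trans ?_)⟩
  rw [add_comm]
  exact lt_tsub_iff_right.1 hm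

/-- Otherwise every set of the filter contains a pair with increment at least `ε`. Since the filter
approaches its limit from one side, two such pairs can be placed as `x₁ < y₁ < x₂ < y₂`. The triples
`x₁, y₁, x₂` and `x₁, y₁, y₂` put both `f x₂` and `f y₂` within `ε / 2` of `f y₁`, a contradiction.
-/
lemma SmallTripleOscillation.cauchy {E : Type*} [MetricSpace E] {f : ℚ≥0 → E}
    (hf : SmallTripleOscillation f) {F : Filter ℚ≥0} [F.NeBot] (N : ℕ)
    (hN : ∀ᶠ q in F, q ≤ (N : ℚ≥0))
    (hF : ∀ δ : ℝ≥0, 0 < δ → ∃ I ∈ F, ∀ r ∈ I, ∀ s ∈ I, (s : ℝ≥0) ≤ r + δ)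
    (hmono : ∃ I ∈ F, (∀ x ∈ I, ∀ᶠ z in F, z < x) ∨ (∀ x ∈ I, ∀ᶠ z in F, x < z)) :
    Cauchy (map f F) := by
  refine Metric.cauchy_iff.2 ⟨inferInstance, fun ε hε => ?_⟩
  obtain ⟨k, hk⟩ := exists_nat_one_div_lt (half_pos hε)
  obtain ⟨m, hm⟩ := hf N k
  obtain ⟨I, hI, hIδ⟩ := hF (1 / (m + 1)) (by positivity)
  obtain ⟨J, hJ, hJm⟩ := hmono
  by_contra! hcon
  have hpair : ∀ K ∈ F, ∃ x ∈ K, ∃ y ∈ K, x < y ∧ ε ≤ dist (f x) (f y) := by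
    intro K hK
    obtain ⟨_, ⟨x, hx, rfl⟩, _, ⟨y, hy, rfl⟩, hxy⟩ := hcon (f '' K) (image_mem_map hK)
    rcases lt_trichotomy x y with h | h | h
    · exact ⟨x, hx, y, hy, h, hxy⟩
    · rw [h, dist_self] at hxy
      exact absurd hε (not_lt.2 hxy)
    · exact ⟨y, hy, x, hx, h, by rwa [dist_comm]⟩
  have hfin : ∀ x₁ ∈ I, ∀ y₁ ∈ I, ∀ x₂ ∈ I, ∀ y₂ ∈ I, x₁ < y₁ → y₁ < x₂ → x₂ < y₂ → x₂ ≤ N →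
      y₂ ≤ N → ε ≤ dist (f x₁) (f y₁) → ε ≤ dist (f x₂) (f y₂) → False := by
    intro x₁ hx₁ y₁ hy₁ x₂ hx₂ y₂ hy₂ h1 h2 h3 hN1 hN2 e1 e2
    have a1 := (hm x₁ y₁ x₂ h1 h2 hN1 (hIδ x₁ hx₁ x₂ hx₂)).resolve_left (by linarith)
    have a2 := (hm x₁ y₁ y₂ h1 (h2.trans h3) hN2 (hIδ x₁ hx₁ y₂ hy₂)).resolve_left (by linarith)
    linarith [dist_triangle_left (f x₂) (f y₂) (f y₁)]
  obtain ⟨x, ⟨⟨hxI, hxJ⟩, hxN⟩, y, ⟨⟨hyI, hyJ⟩, hyN⟩, hxy, hd⟩ :=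
    hpair ((I ∩ J) ∩ {q | q ≤ (N : ℚ≥0)}) (inter_mem (inter_mem hI hJ) hN)
  rcases hJm with h | h
  · obtain ⟨x', ⟨⟨hx'I, _⟩, hx'l⟩, y', ⟨⟨hy'I, _⟩, hy'l⟩, hxy', hd'⟩ :=
      hpair ((I ∩ J) ∩ {z | z < x}) (inter_mem (inter_mem hI hJ) (h x hxJ))
    exact hfin x' hx'I y' hy'I x hxI y hyI hxy' hy'l hxy hxN hyN hd' hd
  · obtain ⟨x', ⟨⟨hx'I, hx'N⟩, hx'l⟩, y', ⟨⟨hy'I, hy'N⟩, hy'l⟩, hxy', hd'⟩ :=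
      hpair ((I ∩ {q | q ≤ (N : ℚ≥0)}) ∩ {z | y < z}) (inter_mem (inter_mem hI hN) (h y hyJ))
    exact hfin x hxI y hyI x' hx'I y' hy'I hxy hx'l hxy' hx'N hy'N hd hd'

lemma SmallTripleOscillation.exists_tendsto_ratRight {E : Type*} [MetricSpace E] [CompleteSpace E]
    {f : ℚ≥0 → E} (hf : SmallTripleOscillation f) (t : ℝ≥0) :
    ∃ l, Tendsto f (ratRight t) (𝓝 l) := by
  obtain ⟨N, hN⟩ := exists_nat_gt t
  refine CompleteSpace.complete (hf.cauchy N ?_ ?_ ?_)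
  · exact eventually_ratRight.2 ⟨N, hN, fun q _ h => by exact_mod_cast h.le⟩
  · intro δ hδ
    refine ⟨{q | t < q ∧ (q : ℝ≥0) < t + δ}, eventually_ratRight.2
      ⟨t + δ, lt_add_of_pos_right _ hδ, fun q h h' => ⟨h, h'⟩⟩, fun r hr s hs => ?_⟩
    exact hs.2.le.trans (by gcongr; exact hr.1.le)
  · refine ⟨{q | t < q}, eventually_ratRight.2 ⟨N, hN, fun q h _ => h⟩, Or.inl fun x hx => ?_⟩
    exact eventually_ratRight.2 ⟨x, hx, fun q _ h => by exact_mod_cast h⟩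

lemma SmallTripleOscillation.exists_tendsto_ratLeft {E : Type*} [MetricSpace E] [CompleteSpace E]
    {f : ℚ≥0 → E} (hf : SmallTripleOscillation f) (t : ℝ≥0) :
    ∃ l, Tendsto f (ratLeft t) (𝓝 l) := by
  rcases eq_or_ne t 0 with rfl | ht
  · exact ⟨f 0, by simp [ratLeft_zero]⟩
  have hpos : 0 < t := pos_iff_ne_zero.2 ht
  have := ratLeft_neBot hpos
  obtain ⟨N, hN⟩ := exists_nat_gt t
  refine CompleteSpace.complete (hf.cauchy N ?_ ?_ ?_)
  · exact (eventually_ratLeft hpos).2 ⟨0, hpos, fun q _ h => by exact_mod_cast (h.trans hN).le⟩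
  · intro δ hδ
    refine ⟨{q | t - δ ≤ q ∧ (q : ℝ≥0) < t}, (eventually_ratLeft hpos).2
      ⟨t - δ, tsub_lt_self hpos hδ, fun q h h' => ⟨h.le, h'⟩⟩, fun r hr s hs => ?_⟩
    exact hs.2.le.trans (tsub_le_iff_right.1 hr.1)
  · refine ⟨{q | (q : ℝ≥0) < t}, (eventually_ratLeft hpos).2 ⟨0, hpos, fun q _ h => h⟩,
      Or.inr fun x hx => ?_⟩
    exact (eventually_ratLeft hpos).2 ⟨x, hx, fun q h _ => by exact_mod_cast h⟩

/-- Restriction of a path to the rational times. -/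
def ratRestrict {E : Type*} [TopologicalSpace E] (ω : RCLLPath E) : ℚ≥0 → E := fun q => ω q

lemma ratRestrict_injective {E : Type*} [TopologicalSpace E] [T2Space E] :
    Function.Injective (ratRestrict : RCLLPath E → ℚ≥0 → E) := by
  intro ω ω' h
  refine ext fun t => tendsto_nhds_unique (ω.tendsto_ratRight t) ?_
  have h' : (fun q : ℚ≥0 => ω q) = fun q : ℚ≥0 => ω' q := h
  rw [h']
  exact ω'.tendsto_ratRight t

/-- The triple condition provides the one-sided limits, hence a path of right limits;
right-continuity along the rationals makes that path extend `f`. Both conditions involve only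
countably many quantifiers, so the range is Borel. -/
lemma range_ratRestrict {E : Type*} [MetricSpace E] [CompleteSpace E] :
    Set.range (ratRestrict : RCLLPath E → ℚ≥0 → E) =
      {f | SmallTripleOscillation f ∧ RatRightCont f} := by
  ext f
  constructor
  · rintro ⟨ω, rfl⟩
    exact ⟨smallTripleOscillation_of_path ω, ratRightCont_of_path ω⟩
  · rintro ⟨h1, h2⟩
    obtain ⟨g, hg⟩ := exists_rightLim_path h1.exists_tendsto_ratRight h1.exists_tendsto_ratLeft
    refine ⟨g, funext fun q => ?_⟩
    refine tendsto_nhds_unique (hg q) (Metric.nhds_basis_closedBall.tendsto_right_iff.2 ?_)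
    intro ε hε
    obtain ⟨k, hk⟩ := exists_nat_one_div_lt hε
    obtain ⟨m, hm⟩ := h2 q k
    refine eventually_ratRight.2 ⟨q + 1 / (m + 1), lt_add_of_pos_right _ (by positivity), ?_⟩
    exact fun r hr hr' => (hm r (by exact_mod_cast hr) hr').trans hk.le

lemma measurableEmbedding_ratRestrict {E : Type*} [TopologicalSpace E] [PolishSpace E]
    [MeasurableSpace E] [BorelSpace E] :
    MeasurableEmbedding (ratRestrict : RCLLPath E → ℚ≥0 → E) := by
  have hrange : MeasurableSet (Set.range (ratRestrict : RCLLPath E → ℚ≥0 → E)) := by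
    let _ := TopologicalSpace.upgradeIsCompletelyMetrizable E
    have hd : ∀ r s : ℚ≥0, Measurable fun f : ℚ≥0 → E => dist (f r) (f s) := fun r s =>
      (measurable_pi_apply r).dist (measurable_pi_apply s)
    have hle : ∀ (r s : ℚ≥0) (c : ℝ), Measurable fun f : ℚ≥0 → E => dist (f r) (f s) ≤ c :=
      fun r s c => measurableSet_setOfPred.1 (measurableSet_le (hd r s) measurable_const)
    rw [range_ratRestrict, measurableSet_setOfPred]
    unfold SmallTripleOscillation RatRightCont
    refine Measurable.and ?_ ?_
    · exact .forall fun N => .forall fun k => .exists fun m => .forall fun r => .forall fun s =>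
        .forall fun u => .forall fun _ => .forall fun _ => .forall fun _ => .forall fun _ =>
          (hle r s _).or (hle s u _)
    · exact .forall fun q => .forall fun k => .exists fun m => .forall fun r => .forall fun _ =>
        .forall fun _ => hle r q _
  have hmeas : Measurable (ratRestrict : RCLLPath E → ℚ≥0 → E) :=
    measurable_pi_lambda _ fun q => measurable_apply _
  refine ⟨ratRestrict_injective, hmeas, fun A hA => ?_⟩
  -- Each coordinate is a limit of coordinates at rational times, so every Borel set of paths is a
  -- preimage under the restriction.
  have hcomap : Measurable[MeasurableSpace.comap ratRestrict inferInstance]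
      (id : RCLLPath E → RCLLPath E) := by
    refine @measurable_of_coord E _ _ _ _ _ _ (MeasurableSpace.comap ratRestrict inferInstance) _
      fun t => ?_
    obtain ⟨r, -, -, hr⟩ := exists_seq_ratRight t
    refine @measurable_of_tendsto_metrizable _ _ (MeasurableSpace.comap ratRestrict inferInstance)
      _ _ _ _ (fun n ω => ω (r n)) _ (fun n => ?_)
      (tendsto_pi_nhds.2 fun ω => (ω.tendsto_ratRight t).comp hr)
    exact (measurable_pi_apply (r n)).comp (comap_measurable ratRestrict)
  obtain ⟨B, hB, hBA⟩ := hcomap hA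
  have : ratRestrict '' A = B ∩ Set.range ratRestrict := by
    rw [← Set.preimage_id (s := A), ← hBA, Set.image_preimage_eq_inter_range]
  rw [this]
  exact hB.inter hrange

end RationalTimes

end RCLLPath

/-! ### The weak topology and its Borel sets -/

namespace MeasureTheory.ProbabilityMeasure

section WeakTopology

variable {Ω : Type*} [TopologicalSpace Ω] [TopologicalSpace.MetrizableSpace Ω]
  [SecondCountableTopology Ω] [MeasurableSpace Ω] [BorelSpace Ω]

/-- The probability measure with weights `w` at the points of `s`. -/
noncomputable def ofWeights (s : Finset Ω) (w : {w : s → ℝ≥0 // ∑ y, w y = 1}) :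
    ProbabilityMeasure Ω :=
  ⟨∑ y, (w.1 y) • Measure.dirac (y : Ω), ⟨by
    simp only [Measure.coe_finsetSum, Measure.smul_apply, Finset.sum_apply, measure_univ]
    have := congrArg (fun x : ℝ≥0 => (x : ENNReal)) w.2
    simpa [ENNReal.smul_def] using this⟩⟩

lemma continuous_ofWeights (s : Finset Ω) : Continuous (ofWeights s) := by
  refine continuous_iff_continuousAt.2 fun w => ?_
  refine ProbabilityMeasure.tendsto_iff_forall_lintegral_tendsto.2 fun f => ?_
  have h : ∀ w, ∫⁻ x, f x ∂(ofWeights s w : Measure Ω) =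
      ((∑ y, w.1 y * f (y : Ω) : ℝ≥0) : ENNReal) := by
    intro w
    change ∫⁻ x, f x ∂(∑ y, (w.1 y) • Measure.dirac (y : Ω)) = _
    rw [lintegral_finsetSum_measure, ENNReal.ofNNReal_finsetSum]
    refine Finset.sum_congr rfl fun y _ => ?_
    rw [ENNReal.coe_mul, ← lintegral_dirac (y : Ω) (fun x => (f x : ENNReal))]
    exact lintegral_smul_measure (w.1 y) _
  simp only [h]
  refine ENNReal.tendsto_coe.2 (Continuous.tendsto ?_ w)
  exact continuous_finsetSum _ fun y _ =>
    ((continuous_apply y).comp continuous_subtype_val).mul continuous_const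

/-- The weights of the image of `μ` under a simple function. -/
noncomputable def simpleWeights (f : SimpleFunc Ω Ω) (μ : ProbabilityMeasure Ω) :
    {w : f.range → ℝ≥0 // ∑ y, w y = 1} :=
  ⟨fun y => μ (f ⁻¹' {(y : Ω)}), by
    have h := f.sum_range_measure_preimage_singleton (μ : Measure Ω)
    rw [measure_univ] at h
    rw [← ENNReal.coe_inj, ENNReal.ofNNReal_finsetSum, ENNReal.coe_one, ← h,
      ← Finset.sum_coe_sort f.range]
    simp⟩

lemma measurable_measure_apply {Ω : Type*} [MeasurableSpace Ω] {A : Set Ω} (hA : MeasurableSet A) :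
    Measurable fun μ : ProbabilityMeasure Ω => (μ : Measure Ω) A :=
  (Measure.measurable_coe hA).comp measurable_subtype_coe

lemma measurable_simpleWeights (f : SimpleFunc Ω Ω) : Measurable (simpleWeights f) := by
  refine Measurable.subtype_mk (measurable_pi_lambda _ fun y => ?_)
  exact ENNReal.measurable_toNNReal.comp (measurable_measure_apply (f.measurableSet_preimage _))

lemma ofWeights_simpleWeights (f : SimpleFunc Ω Ω) (μ : ProbabilityMeasure Ω) :
    ofWeights f.range (simpleWeights f μ) = μ.map f.measurable.aemeasurable := by
  refine Subtype.ext (Measure.ext fun A hA => ?_)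
  change (∑ y : f.range, (μ (f ⁻¹' {(y : Ω)})) • Measure.dirac (y : Ω)) A =
    Measure.map f (μ : Measure Ω) A
  have h := (f.map (A.indicator fun _ => (1 : ENNReal))).lintegral_eq_lintegral (μ : Measure Ω)
  rw [SimpleFunc.map_lintegral, ← Finset.sum_coe_sort f.range] at h
  rw [Measure.map_apply f.measurable hA, ← lintegral_indicator_one (f.measurable hA)]
  simp only [Measure.coe_finsetSum, Finset.sum_apply]
  refine Eq.trans ?_ (h.symm.trans (lintegral_congr fun x => ?_))
  · refine Finset.sum_congr rfl fun y _ => ?_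
    rw [Measure.smul_apply, Measure.dirac_apply' _ hA, mul_comm, ENNReal.smul_def, smul_eq_mul,
      ProbabilityMeasure.ennreal_coeFn_eq_coeFn_toMeasure]
    rfl
  · rfl

/-- A sequence of simple functions converging pointwise to the identity. -/
lemma exists_simpleFunc_tendsto_id [Nonempty Ω] :
    ∃ f : ℕ → SimpleFunc Ω Ω, ∀ x, Tendsto (fun n => f n x) atTop (𝓝 x) := by
  let _ := TopologicalSpace.metrizableSpaceMetric Ω
  refine ⟨SimpleFunc.approxOn id measurable_id Set.univ (Classical.arbitrary Ω) (Set.mem_univ _),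
    fun x => SimpleFunc.tendsto_approxOn measurable_id (Set.mem_univ _) (by simp)⟩

/-- Dominated convergence against a bounded continuous test function. For simple functions, every
law is thus a weak limit of finitely supported laws with prescribed supports. -/
lemma tendsto_map_of_tendsto_id {f : ℕ → Ω → Ω} (hf : ∀ n, Measurable (f n))
    (hlim : ∀ x, Tendsto (fun n => f n x) atTop (𝓝 x)) (μ : ProbabilityMeasure Ω) :
    Tendsto (fun n => μ.map (hf n).aemeasurable) atTop (𝓝 μ) := by
  refine ProbabilityMeasure.tendsto_iff_forall_integral_tendsto.2 fun g => ?_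
  have h : ∀ n, ∫ x, g x ∂(μ.map (hf n).aemeasurable : Measure Ω) =
      ∫ x, g (f n x) ∂(μ : Measure Ω) :=
    fun n => integral_map (hf n).aemeasurable g.continuous.measurable.aestronglyMeasurable
  simp only [h]
  refine tendsto_integral_of_dominated_convergence (fun _ => ‖g‖)
    (fun n => (g.continuous.measurable.comp (hf n)).aestronglyMeasurable) (integrable_const _)
    (fun n => ae_of_all _ fun x => g.norm_coe_le_norm _)
    (ae_of_all _ fun x => (g.continuous.tendsto x).comp (hlim x))

instance : SecondCountableTopology (ProbabilityMeasure Ω) := by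
  rcases isEmpty_or_nonempty Ω with h | h
  · have : IsEmpty (ProbabilityMeasure Ω) :=
      ⟨fun μ => h.elim μ.nonempty.some⟩
    infer_instance
  obtain ⟨f, hf⟩ := exists_simpleFunc_tendsto_id (Ω := Ω)
  have h : TopologicalSpace.IsSeparable (Set.univ : Set (ProbabilityMeasure Ω)) := by
    have h1 : TopologicalSpace.IsSeparable
        (closure (⋃ n, Set.range (ofWeights (f n).range))) :=
      (TopologicalSpace.IsSeparable.iUnion fun n =>
        TopologicalSpace.isSeparable_range (continuous_ofWeights _)).closure
    refine h1.mono fun μ _ => mem_closure_of_tendsto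
      (tendsto_map_of_tendsto_id (fun n => (f n).measurable) hf μ)
      (Eventually.of_forall fun n => ?_)
    exact Set.mem_iUnion.2 ⟨n, simpleWeights (f n) μ, ofWeights_simpleWeights _ _⟩
  have : TopologicalSpace.SeparableSpace (ProbabilityMeasure Ω) :=
    TopologicalSpace.isSeparable_univ_iff.1 h
  let _ := TopologicalSpace.metrizableSpaceMetric (ProbabilityMeasure Ω)
  exact UniformSpace.secondCountable_of_separable _

/-- Closed sets form a generating `π`-system, and their measures are limits of integrals of bounded
continuous functions. The general source `α` allows the identity with the weak Borel `σ`-algebra to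
be inserted. -/
lemma measurable_toMeasure_comp_of_continuous {α : Type*} [TopologicalSpace α] [MeasurableSpace α]
    [BorelSpace α] {φ : α → ProbabilityMeasure Ω} (hφ : Continuous φ) :
    Measurable fun a => (φ a : Measure Ω) := by
  refine Measurable.measure_of_isPiSystem_of_isProbabilityMeasure
    ((BorelSpace.measurable_eq (α := Ω)).trans borel_eq_generateFrom_isClosed)
    isPiSystem_isClosed fun F (hF : IsClosed F) => ?_
  refine ENNReal.measurable_of_tendsto
    (f := fun (n : ℕ) a => ∫⁻ x, hF.apprSeq n x ∂(φ a : Measure Ω)) (fun n => ?_)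
    (tendsto_pi_nhds.2 fun a => HasOuterApproxClosed.tendsto_lintegral_apprSeq hF _)
  exact ((ProbabilityMeasure.continuous_lintegral_boundedContinuousFunction _).comp hφ).measurable

/-- Replace `μ` by its image under a simple function: the value of `φ` is then a continuous function
of finitely many numbers `μ(A)`, and it converges to `φ μ`. -/
lemma measurable_of_continuous {Y : Type*} [TopologicalSpace Y]
    [TopologicalSpace.PseudoMetrizableSpace Y] [MeasurableSpace Y] [BorelSpace Y]
    {φ : ProbabilityMeasure Ω → Y} (hφ : Continuous φ) : Measurable φ := by
  rcases isEmpty_or_nonempty Ω with h | h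
  · have : IsEmpty (ProbabilityMeasure Ω) := ⟨fun μ => h.elim μ.nonempty.some⟩
    exact measurable_of_empty φ
  obtain ⟨f, hf⟩ := exists_simpleFunc_tendsto_id (Ω := Ω)
  refine measurable_of_tendsto_metrizable
    (f := fun (n : ℕ) μ => φ (ofWeights (f n).range (simpleWeights (f n) μ))) (fun n => ?_)
    (tendsto_pi_nhds.2 fun μ => ?_)
  · exact (hφ.comp (continuous_ofWeights _)).measurable.comp (measurable_simpleWeights _)
  · simp only [ofWeights_simpleWeights]
    exact (hφ.tendsto μ).comp (tendsto_map_of_tendsto_id (fun n => (f n).measurable) hf μ)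

instance : BorelSpace (ProbabilityMeasure Ω) := by
  refine ⟨le_antisymm ?_ ?_⟩
  · exact (@measurable_toMeasure_comp_of_continuous Ω _ _ _ _ _ (ProbabilityMeasure Ω) _ (borel _)
      (@BorelSpace.mk _ _ (borel _) rfl) id continuous_id).comap_le
  · intro s hs
    exact @measurable_of_continuous Ω _ _ _ _ _ (ProbabilityMeasure Ω) _ _ (borel _)
      (@BorelSpace.mk _ _ (borel _) rfl) id continuous_id s hs

/-- The probability measures on a measurable subspace of the reals are parametrized by the
functions on the rationals. -/
lemma exists_measurable_surjective {Ω : Type*} [MeasurableSpace Ω] [Nonempty Ω] {e : Ω → ℝ}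
    (he : MeasurableEmbedding e) :
    ∃ g : (ℚ → ℝ) → ProbabilityMeasure Ω, Measurable g ∧ Function.Surjective g := by
  have hid : Measurable (id : (ℚ → ℝ) → ℚ → ℝ) := measurable_id
  obtain ⟨e', he', hee'⟩ := he.exists_measurable_extend (g := id) measurable_id
    fun _ => inferInstance
  set ν : (ℚ → ℝ) → Measure ℝ := fun c => (stieltjesOfMeasurableRat id hid c).measure with hν
  have hprob : ∀ c, IsProbabilityMeasure (ν c) := fun c => inferInstance
  have hνm : Measurable ν := measurable_measure_stieltjesOfMeasurableRat hid
  refine ⟨fun c => ⟨(ν c).map e', Measure.isProbabilityMeasure_map he'.aemeasurable⟩,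
    Measurable.subtype_mk ((Measure.measurable_map e' he').comp hνm), fun μ => ?_⟩
  have : IsProbabilityMeasure ((μ : Measure Ω).map e) :=
    Measure.isProbabilityMeasure_map he.measurable.aemeasurable
  -- The parameter of `μ` is the restriction to the rationals of the distribution function of its
  -- image on the line.
  set c : ℚ → ℝ := fun q => cdf ((μ : Measure Ω).map e) q with hc
  have hpt : IsRatStieltjesPoint (id : (ℚ → ℝ) → ℚ → ℝ) c := by
    refine ⟨fun q r hqr => monotone_cdf _ (by exact_mod_cast hqr),
      (tendsto_cdf_atTop _).comp (tendsto_ratCast_atTop_iff.2 tendsto_id),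
      (tendsto_cdf_atBot _).comp (tendsto_ratCast_atBot_iff.2 tendsto_id), fun t => ?_⟩
    rw [show id c t = cdf ((μ : Measure Ω).map e) t from rfl,
      ← StieltjesFunction.iInf_rat_gt_eq (cdf ((μ : Measure Ω).map e)) (t : ℝ)]
    exact Equiv.iInf_congr (Equiv.subtypeEquivRight fun r => by simp) fun r => rfl
  have hνc : ν c = (μ : Measure Ω).map e := by
    refine ext_of_generate_finite _ Real.borel_eq_generateFrom_Iic_rat Real.isPiSystem_Iic_rat ?_
      (by simp)
    intro s hs
    obtain ⟨q, rfl⟩ : ∃ q : ℚ, s = Set.Iic (q : ℝ) := by simpa [eq_comm] using hs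
    rw [hν, measure_stieltjesOfMeasurableRat_Iic, stieltjesOfMeasurableRat_eq,
      toRatCDF_of_isRatStieltjesPoint hpt, ← ofReal_cdf]
    rfl
  refine ⟨c, Subtype.ext ?_⟩
  change (ν c).map e' = (μ : Measure Ω)
  rw [hνc, Measure.map_map he' he.measurable, hee', Measure.map_id]

end WeakTopology
end MeasureTheory.ProbabilityMeasure

/-! ### Upcrossings and one-sided limits -/

namespace RCLLPath

section Upcrossings

/-- The `k`-th point of the grid of mesh `1 / m!`. -/
def gridTime (m k : ℕ) : ℚ≥0 := (k : ℚ≥0) / (m.factorial : ℚ≥0)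

lemma gridTime_mono (m : ℕ) : Monotone (gridTime m) := fun i j hij => by
  unfold gridTime
  gcongr

lemma gridTime_lt_iff {m i j : ℕ} : gridTime m i < gridTime m j ↔ i < j := by
  have : (0 : ℚ≥0) < (m.factorial : ℚ≥0) := by exact_mod_cast m.factorial_pos
  rw [gridTime, gridTime, div_lt_div_iff_of_pos_right this]
  exact_mod_cast Iff.rfl

lemma gridTime_mul_factorial (m N : ℕ) : gridTime m (N * m.factorial) = N := by
  have : (m.factorial : ℚ≥0) ≠ 0 := by exact_mod_cast m.factorial_ne_zero
  rw [gridTime]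
  push_cast
  field_simp

/-- This is the reason for factorials: a rational time belongs to all grids from some index on. -/
lemma exists_gridTime_eq (q : ℚ≥0) {m : ℕ} (hm : q.den ≤ m) : ∃ k, gridTime m k = q := by
  obtain ⟨c, hc⟩ := Nat.dvd_factorial q.den_pos hm
  refine ⟨q.num * c, ?_⟩
  have h1 : (q.den : ℚ≥0) ≠ 0 := by exact_mod_cast q.den_ne_zero
  have h2 : (c : ℚ≥0) ≠ 0 := by
    have := m.factorial_ne_zero
    rw [hc] at this
    exact_mod_cast right_ne_zero_of_mul this
  rw [gridTime, hc]
  push_cast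
  rw [mul_div_mul_right _ _ h2, NNRat.num_div_den]

/-- `f` has `K` successive upcrossings of `[a, b]` between the rational times `lo` and `hi`. -/
def HasUpcrossings (f : ℚ≥0 → ℝ≥0) (a b : ℝ≥0) : ℕ → ℚ≥0 → ℚ≥0 → Prop
  | 0, lo, hi => lo ≤ hi
  | K + 1, lo, hi => ∃ s t, lo < s ∧ s < t ∧ f s < a ∧ b < f t ∧ HasUpcrossings f a b K t hi

lemma HasUpcrossings.mono {f : ℚ≥0 → ℝ≥0} {a b : ℝ≥0} {K : ℕ} {lo lo' hi : ℚ≥0}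
    (h : HasUpcrossings f a b K lo hi) (hlo : lo' ≤ lo) : HasUpcrossings f a b K lo' hi := by
  cases K with
  | zero => exact hlo.trans h
  | succ K =>
    obtain ⟨s, t, h1, h2⟩ := h
    exact ⟨s, t, hlo.trans_lt h1, h2⟩

/-- On a fine enough grid all the chosen times are grid points, and each pair adds a discrete
upcrossing. The count runs strictly before its index, hence `i + 1` and `j + 1`. -/
lemma HasUpcrossings.le_upcrossingsBefore {Ω : Type*} {M : ℚ≥0 → Ω → ℝ≥0} {ω : Ω} {a b : ℝ≥0}
    (hab : a < b) {K : ℕ} {lo hi : ℚ≥0} (h : HasUpcrossings (fun q => M q ω) a b K lo hi) :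
    ∀ᶠ m : ℕ in atTop, ∀ i j, gridTime m i = lo → gridTime m j = hi →
      upcrossingsBefore (a : ℝ) b (fun k ω => (M (gridTime m k) ω : ℝ)) (i + 1) ω + K ≤
        upcrossingsBefore (a : ℝ) b (fun k ω => (M (gridTime m k) ω : ℝ)) (j + 1) ω := by
  have hab' : (a : ℝ) < b := by exact_mod_cast hab
  induction K generalizing lo with
  | zero =>
    refine Eventually.of_forall fun m i j hi hj => ?_
    refine upcrossingsBefore_mono hab' ?_ ω
    have h' : lo ≤ _ := h
    rw [← hi, ← hj] at h'
    by_contra hlt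
    exact absurd h' (not_le.2 (gridTime_lt_iff.2 (by omega)))
  | succ K ih =>
    obtain ⟨s, t, hs, hst, hsa, htb, hK⟩ := h
    filter_upwards [ih hK, eventually_ge_atTop s.den, eventually_ge_atTop t.den]
      with m hm hms hmt i j hi hj
    obtain ⟨ks, hks⟩ := exists_gridTime_eq s hms
    obtain ⟨kt, hkt⟩ := exists_gridTime_eq t hmt
    have h1 : i < ks := by rw [← gridTime_lt_iff (m := m), hi, hks]; exact hs
    have h2 : ks < kt := by rw [← gridTime_lt_iff (m := m), hks, hkt]; exact hst
    have h3 := upcrossingsBefore_lt_of_exists_upcrossing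
      (f := fun k ω => (M (gridTime m k) ω : ℝ)) (ω := ω) hab' (N := i + 1) (N₁ := ks) (N₂ := kt)
      h1 (by rw [hks]; exact_mod_cast hsa) h2.le (by rw [hkt]; exact_mod_cast htb)
    have h4 := hm kt j hkt hj
    omega

/-- The upcrossings are produced backwards in time: each new one is inserted between `t` and those
already found. -/
lemma exists_hasUpcrossings_of_frequently_ratRight {f : ℚ≥0 → ℝ≥0} {a b : ℝ≥0} {t : ℝ≥0}
    (ha : ∃ᶠ q in ratRight t, f q < a) (hb : ∃ᶠ q in ratRight t, b < f q) {N : ℚ≥0} (hN : t < N)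
    (K : ℕ) : HasUpcrossings f a b K 0 N := by
  suffices h : ∃ lo : ℚ≥0, t < lo ∧ HasUpcrossings f a b K lo N by
    obtain ⟨lo, -, h⟩ := h
    exact h.mono zero_le
  induction K with
  | zero => exact ⟨N, hN, le_rfl⟩
  | succ K ih =>
    obtain ⟨lo, hlo, h⟩ := ih
    obtain ⟨u, hub, htu, hulo⟩ := (hb.and_eventually
      ((eventually_ratRight (p := fun q => t < q ∧ (q : ℝ≥0) < lo)).2
        ⟨lo, hlo, fun q h h' => ⟨h, h'⟩⟩)).exists
    obtain ⟨s, hsa, hts, hsu⟩ := (ha.and_eventually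
      ((eventually_ratRight (p := fun q => t < q ∧ (q : ℝ≥0) < u)).2
        ⟨u, htu, fun q h h' => ⟨h, h'⟩⟩)).exists
    obtain ⟨lo', h1, h2⟩ := exists_nnrat_btwn hts
    exact ⟨lo', h1, s, u, by exact_mod_cast h2, by exact_mod_cast hsu, hsa, hub,
      h.mono (by exact_mod_cast hulo.le)⟩

lemma exists_hasUpcrossings_of_frequently_ratLeft {f : ℚ≥0 → ℝ≥0} {a b : ℝ≥0} {t : ℝ≥0}
    (ht : 0 < t) (ha : ∃ᶠ q in ratLeft t, f q < a) (hb : ∃ᶠ q in ratLeft t, b < f q) {N : ℚ≥0}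
    (hN : t < N) (K : ℕ) : HasUpcrossings f a b K 0 N := by
  suffices h : ∀ lo : ℚ≥0, (lo : ℝ≥0) < t → HasUpcrossings f a b K lo N from
    h 0 (by simpa using ht)
  induction K with
  | zero => exact fun lo hlo => by exact_mod_cast (hlo.trans hN).le
  | succ K ih =>
    intro lo hlo
    obtain ⟨s, hsa, hts, hsu⟩ := (ha.and_eventually
      ((eventually_ratLeft ht (p := fun q => (lo : ℝ≥0) < q ∧ (q : ℝ≥0) < t)).2
        ⟨lo, hlo, fun q h h' => ⟨h, h'⟩⟩)).exists
    obtain ⟨u, hub, htu, hulo⟩ := (hb.and_eventually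
      ((eventually_ratLeft ht (p := fun q => (s : ℝ≥0) < q ∧ (q : ℝ≥0) < t)).2
        ⟨s, hsu, fun q h h' => ⟨h, h'⟩⟩)).exists
    exact ⟨s, u, by exact_mod_cast hts, by exact_mod_cast htu, hsa, hub, ih u hulo⟩

lemma dense_range_nnratCast : Dense (Set.range fun q : ℚ≥0 => (q : ℝ≥0)) := by
  refine dense_of_exists_between fun {a b} hab => ?_
  obtain ⟨q, h1, h2⟩ := exists_nnrat_btwn hab
  exact ⟨q, ⟨q, rfl⟩, h1, h2⟩

/-- A function on the rational times, which is locally bounded and has finitely many upcrossings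
over compact time intervals, has one-sided limits. -/
lemma exists_tendsto_of_upcrossings {f : ℚ≥0 → ℝ≥0}
    (hbdd : ∀ N : ℕ, ∃ C, ∀ q : ℚ≥0, q ≤ N → f q ≤ C)
    (hup : ∀ (N : ℕ) (a b : ℚ≥0), a < b → ∃ K, ¬ HasUpcrossings f a b K 0 N) :
    (∀ t, ∃ l, Tendsto f (ratRight t) (𝓝 l)) ∧ ∀ t, ∃ l, Tendsto f (ratLeft t) (𝓝 l) := by
  refine ⟨fun t => ?_, fun t => ?_⟩
  · obtain ⟨N, hN⟩ := exists_nat_gt t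
    obtain ⟨C, hC⟩ := hbdd N
    refine tendsto_of_no_upcrossings dense_range_nnratCast ?_ ?_ ?_
    · rintro _ ⟨a, rfl⟩ _ ⟨b, rfl⟩ hab ⟨h1, h2⟩
      obtain ⟨K, hK⟩ := hup N a b (NNRat.cast_lt.1 hab)
      exact hK (exists_hasUpcrossings_of_frequently_ratRight h1 h2 (by exact_mod_cast hN) K)
    · exact isBoundedUnder_of_eventually_le (a := C) (eventually_ratRight.2
        ⟨N, hN, fun q _ h => hC q (by exact_mod_cast h.le)⟩)
    · exact isBoundedUnder_of_eventually_ge (a := 0) (Eventually.of_forall fun _ => zero_le)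
  · rcases eq_or_ne t 0 with rfl | ht
    · exact ⟨0, by simp [ratLeft_zero]⟩
    have hpos : 0 < t := pos_iff_ne_zero.2 ht
    obtain ⟨N, hN⟩ := exists_nat_gt t
    obtain ⟨C, hC⟩ := hbdd N
    refine tendsto_of_no_upcrossings dense_range_nnratCast ?_ ?_ ?_
    · rintro _ ⟨a, rfl⟩ _ ⟨b, rfl⟩ hab ⟨h1, h2⟩
      obtain ⟨K, hK⟩ := hup N a b (NNRat.cast_lt.1 hab)
      exact hK (exists_hasUpcrossings_of_frequently_ratLeft hpos h1 h2 (by exact_mod_cast hN) K)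
    · exact isBoundedUnder_of_eventually_le (a := C) ((eventually_ratLeft hpos).2
        ⟨0, hpos, fun q _ h => hC q (by exact_mod_cast (h.trans hN).le)⟩)
    · exact isBoundedUnder_of_eventually_ge (a := 0) (Eventually.of_forall fun _ => zero_le)

end Upcrossings

/-! ### Regularity of closed martingales along the rational times -/

section Martingale

variable {Ω : Type*} {m0 : MeasurableSpace Ω} {P : Measure Ω} [IsProbabilityMeasure P]
  {𝓕 : Filtration ℝ≥0 m0} {ξ : Ω → ℝ} {M : ℚ≥0 → Ω → ℝ≥0}

/-- The filtration along the grid of mesh `1 / m!`. -/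
def gridFiltration (𝓕 : Filtration ℝ≥0 m0) (m : ℕ) : Filtration ℕ m0 where
  seq k := 𝓕 (gridTime m k)
  mono' i j hij := 𝓕.mono (by exact_mod_cast gridTime_mono m hij)
  le' _ := 𝓕.le _

lemma martingale_grid (hmeas : ∀ q : ℚ≥0, Measurable[𝓕 q] (M q))
    (hM : ∀ q : ℚ≥0, (fun ω => (M q ω : ℝ)) =ᵐ[P] P[ξ | 𝓕 q]) (m : ℕ) :
    Martingale (fun k ω => (M (gridTime m k) ω : ℝ)) (gridFiltration 𝓕 m) P := by
  refine ⟨fun k => ?_, fun i j hij => ?_⟩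
  · exact (NNReal.continuous_coe.measurable.comp (hmeas _)).stronglyMeasurable
  · have hle : gridFiltration 𝓕 m i ≤ gridFiltration 𝓕 m j := (gridFiltration 𝓕 m).mono hij
    calc P[fun ω => (M (gridTime m j) ω : ℝ) | gridFiltration 𝓕 m i]
        =ᵐ[P] P[P[ξ | 𝓕 (gridTime m j)] | gridFiltration 𝓕 m i] := condExp_congr_ae (hM _)
      _ =ᵐ[P] P[ξ | gridFiltration 𝓕 m i] := condExp_condExp_of_le hle (𝓕.le _)
      _ =ᵐ[P] fun ω => (M (gridTime m i) ω : ℝ) := (hM _).symm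

lemma integral_grid (hM : ∀ q : ℚ≥0, (fun ω => (M q ω : ℝ)) =ᵐ[P] P[ξ | 𝓕 q]) (q : ℚ≥0) :
    ∫ ω, (M q ω : ℝ) ∂P = ∫ ω, ξ ω ∂P := by
  rw [integral_congr_ae (hM q), integral_condExp (𝓕.le _)]

lemma ae_bounded_of_martingale (hmeas : ∀ q : ℚ≥0, Measurable[𝓕 q] (M q))
    (hM : ∀ q : ℚ≥0, (fun ω => (M q ω : ℝ)) =ᵐ[P] P[ξ | 𝓕 q]) :
    ∀ᵐ ω ∂P, ∀ N : ℕ, ∃ C, ∀ q : ℚ≥0, q ≤ N → M q ω ≤ C := by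
  refine ae_all_iff.2 fun N => ?_
  set I := ENNReal.ofReal (∫ ω, ξ ω ∂P) with hI
  set A : ℕ → ℕ → Set Ω := fun C m =>
    {ω | ∃ k ≤ N * m.factorial, (C : ℝ≥0) ≤ M (gridTime m k) ω} with hA
  -- Doob's maximal inequality on the grid; the bound is the same for all grids.
  have hAle : ∀ C m, C * P (A C m) ≤ I := by
    intro C m
    have hmart := martingale_grid hmeas hM m
    have h := maximal_ineq hmart.submartingale (fun k ω => NNReal.coe_nonneg _) (ε := C)
      (N * m.factorial)
    have hset : A C m = {ω | ((C : ℝ≥0) : ℝ) ≤ (Finset.range (N * m.factorial + 1)).sup'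
        Finset.nonempty_range_add_one fun k => (M (gridTime m k) ω : ℝ)} := by
      ext ω
      simp only [hA, Set.mem_ofPred_eq, Finset.le_sup'_iff, Finset.mem_range, NNReal.coe_le_coe,
        Nat.lt_add_one_iff]
    rw [← hset] at h
    refine le_trans (by exact_mod_cast h) (ENNReal.ofReal_le_ofReal ?_)
    rw [← integral_grid hM (gridTime m (N * m.factorial))]
    exact setIntegral_le_integral (hmart.integrable _) (ae_of_all _ fun _ => NNReal.coe_nonneg _)
  -- The grids are nested, so the bound passes to the union over all of them.
  have hAmono : ∀ C, Monotone (A C) := by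
    refine fun C => monotone_nat_of_le_succ fun m ω => ?_
    rintro ⟨k, hk, hC⟩
    refine ⟨k * (m + 1), ?_, ?_⟩
    · rw [Nat.factorial_succ]
      nlinarith
    · have : gridTime (m + 1) (k * (m + 1)) = gridTime m k := by
        rw [gridTime, gridTime, Nat.factorial_succ]
        push_cast
        rw [mul_comm (k : ℚ≥0), mul_div_mul_left]
        positivity
      rwa [this]
  have hU : ∀ C : ℕ, C * P (⋃ m, A C m) ≤ I := by
    intro C
    rw [(hAmono C).measure_iUnion, ENNReal.mul_iSup]
    exact iSup_le (hAle C)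
  rw [ae_iff]
  set B := {ω | ¬ ∃ C, ∀ q : ℚ≥0, q ≤ N → M q ω ≤ C} with hB
  have hsub : ∀ C : ℕ, B ⊆ ⋃ m, A C m := by
    intro C ω hω
    simp only [hB, Set.mem_ofPred_eq, not_exists, not_forall, not_le] at hω
    obtain ⟨q, hqN, hq⟩ := hω C
    obtain ⟨k, hk⟩ := exists_gridTime_eq q le_rfl
    refine Set.mem_iUnion.2 ⟨q.den, k, ?_, by rw [hk]; exact hq.le⟩
    by_contra hlt
    have := gridTime_lt_iff (m := q.den).2 (not_le.1 hlt)
    rw [gridTime_mul_factorial, hk] at this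
    exact absurd hqN (not_le.2 this)
  by_contra hne
  have hbound : ∀ C : ℕ, (C : ENNReal) ≤ I / P B := fun C => by
    rw [ENNReal.le_div_iff_mul_le (Or.inl hne) (Or.inl (measure_ne_top P B))]
    exact (mul_le_mul_right (measure_mono (hsub C)) _).trans (hU C)
  have hlt : I / P B < ⊤ := ENNReal.div_lt_top ENNReal.ofReal_ne_top hne
  obtain ⟨C, hC⟩ := ENNReal.exists_nat_gt hlt.ne
  exact absurd (hbound C) (not_le.2 hC)

lemma ae_upcrossings_of_martingale (hmeas : ∀ q : ℚ≥0, Measurable[𝓕 q] (M q))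
    (hM : ∀ q : ℚ≥0, (fun ω => (M q ω : ℝ)) =ᵐ[P] P[ξ | 𝓕 q]) :
    ∀ᵐ ω ∂P, ∀ (N : ℕ) (a b : ℚ≥0), a < b →
      ∃ K, ¬ HasUpcrossings (fun q => M q ω) a b K 0 N := by
  refine ae_all_iff.2 fun N => ae_all_iff.2 fun a => ae_all_iff.2 fun b => ?_
  by_cases hab : a < b
  swap
  · exact ae_of_all _ fun ω h => absurd h hab
  have habR : (((a : ℝ≥0) : ℝ)) < ((b : ℝ≥0) : ℝ) := by exact_mod_cast hab
  set U : ℕ → Ω → ℕ := fun m => upcrossingsBefore ((a : ℝ≥0) : ℝ) ((b : ℝ≥0) : ℝ)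
    (fun k ω => (M (gridTime m k) ω : ℝ)) (N * m.factorial + 1) with hU
  have hUm : ∀ m, Measurable (U m) := fun m =>
    (martingale_grid hmeas hM m).stronglyAdapted.measurable_upcrossingsBefore habR
  set I := ENNReal.ofReal ((∫ ω, ξ ω ∂P) / (((b : ℝ≥0) : ℝ) - ((a : ℝ≥0) : ℝ))) with hI
  -- Doob's upcrossing inequality, where the positive part of `M - a` is at most `M` because `a` and
  -- `M` are nonnegative.
  have hint : ∀ m, ∫⁻ ω, (U m ω : ENNReal) ∂P ≤ I := by
    intro m
    have hmart := martingale_grid hmeas hM m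
    have h := hmart.submartingale.mul_integral_upcrossingsBefore_le_integral_pos_part
      ((a : ℝ≥0) : ℝ) ((b : ℝ≥0) : ℝ) (N * m.factorial + 1)
    have h2 : ∫ ω, ((M (gridTime m (N * m.factorial + 1)) ω : ℝ) - ((a : ℝ≥0) : ℝ))⁺ ∂P ≤
        ∫ ω, ξ ω ∂P := by
      rw [← integral_grid hM (gridTime m (N * m.factorial + 1))]
      refine integral_mono_of_nonneg (ae_of_all _ fun ω => posPart_nonneg _)
        (hmart.integrable _) (ae_of_all _ fun ω => ?_)
      exact max_le (by simp) (NNReal.coe_nonneg _)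
    have h3 : ∫⁻ ω, (U m ω : ENNReal) ∂P = ENNReal.ofReal (∫ ω, (U m ω : ℝ) ∂P) := by
      rw [ofReal_integral_eq_lintegral_ofReal
        (hmart.stronglyAdapted.integrable_upcrossingsBefore habR)
        (ae_of_all _ fun ω => Nat.cast_nonneg _)]
      simp [U]
    rw [h3, hI]
    refine ENNReal.ofReal_le_ofReal ?_
    rw [le_div_iff₀' (sub_pos.2 habR)]
    exact h.trans h2
  -- Fatou's lemma. Having `K` upcrossings for every `K` would make this `liminf` infinite.
  have hlim : ∀ᵐ ω ∂P, liminf (fun m => (U m ω : ENNReal)) atTop < ⊤ := by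
    have hUm' : ∀ m, Measurable fun ω => (U m ω : ENNReal) := fun m =>
      (measurable_of_countable _).comp (hUm m)
    have hle : ∫⁻ ω, liminf (fun m => (U m ω : ENNReal)) atTop ∂P ≤ I := by
      refine (lintegral_liminf_le hUm').trans (liminf_le_of_le (by isBoundedDefault) fun c hc => ?_)
      obtain ⟨m, hm⟩ := hc.exists
      exact hm.trans (hint m)
    exact ae_lt_top (Measurable.liminf hUm') (hle.trans_lt ENNReal.ofReal_lt_top).ne
  filter_upwards [hlim] with ω hω _
  by_contra! hcon
  obtain ⟨K, hK⟩ := ENNReal.exists_nat_gt hω.ne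
  refine absurd hK (not_lt.2 (le_liminf_of_le (by isBoundedDefault) ?_))
  filter_upwards [(hcon K).le_upcrossingsBefore (by exact_mod_cast hab)] with m hm
  have := hm 0 (N * m.factorial) (by simp [gridTime]) (gridTime_mul_factorial m N)
  exact_mod_cast (Nat.le_add_left _ _).trans this

lemma ae_exists_tendsto_of_martingale (hmeas : ∀ q : ℚ≥0, Measurable[𝓕 q] (M q))
    (hM : ∀ q : ℚ≥0, (fun ω => (M q ω : ℝ)) =ᵐ[P] P[ξ | 𝓕 q]) :
    ∀ᵐ ω ∂P, (∀ t, ∃ l, Tendsto (fun q => M q ω) (ratRight t) (𝓝 l)) ∧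
      ∀ t, ∃ l, Tendsto (fun q => M q ω) (ratLeft t) (𝓝 l) := by
  filter_upwards [ae_bounded_of_martingale hmeas hM, ae_upcrossings_of_martingale hmeas hM]
    with ω h1 h2 using exists_tendsto_of_upcrossings h1 h2

/-- Right limits of a closed martingale close the right-continuous hull of the filtration. -/
lemma rightLim_ae_eq_condExp (hξ : Integrable ξ P) (hmeas : ∀ q : ℚ≥0, Measurable[𝓕 q] (M q))
    (hM : ∀ q : ℚ≥0, (fun ω => (M q ω : ℝ)) =ᵐ[P] P[ξ | 𝓕 q]) {t : ℝ≥0} {g : Ω → ℝ≥0}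
    (hg : ∀ᵐ ω ∂P, Tendsto (fun q => M q ω) (ratRight t) (𝓝 (g ω))) :
    (fun ω => (g ω : ℝ)) =ᵐ[P] P[ξ | 𝓕.rightCont t] := by
  obtain ⟨r, hrt, hr1, hr⟩ := exists_seq_ratRight t
  have hFt : (𝓕.rightCont t : MeasurableSpace Ω) = ⨅ s > t, 𝓕 s := Filtration.rightCont_eq _ _
  have hlim : ∀ᵐ ω ∂P, Tendsto (fun n => (M (r n) ω : ℝ)) atTop (𝓝 (g ω : ℝ)) := by
    filter_upwards [hg] with ω hω
    exact (NNReal.tendsto_coe.2 (hω.comp hr))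
  have hui : UniformIntegrable (fun n ω => (M (r n) ω : ℝ)) 1 P :=
    (hξ.uniformIntegrable_condExp fun n => 𝓕.le (r n)).ae_eq fun n => (hM (r n)).symm
  have hgL : MemLp (fun ω => (g ω : ℝ)) 1 P := hui.memLp_of_ae_tendsto hlim
  have hL1 := tendsto_Lp_finite_of_tendsto_ae le_rfl ENNReal.one_ne_top hui.1 hgL hui.2.1 hlim
  refine ae_eq_condExp_of_forall_setIntegral_eq (𝓕.rightCont.le t) hξ
    (fun s _ _ => (memLp_one_iff_integrable.1 hgL).integrableOn) (fun s hs _ => ?_) ?_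
  · have hs' : ∀ n, MeasurableSet[𝓕 (r n)] s := fun n => by
      rw [hFt] at hs
      exact (iInf₂_le (r n : ℝ≥0) (hrt n) : _ ≤ (𝓕 (r n) : MeasurableSpace Ω)) s hs
    have h1 : ∀ n, ∫ ω in s, (M (r n) ω : ℝ) ∂P = ∫ ω in s, ξ ω ∂P := fun n => by
      rw [setIntegral_congr_ae ((𝓕.le _) s (hs' n)) ((hM (r n)).mono fun ω h _ => h),
        setIntegral_condExp (𝓕.le _) hξ (hs' n)]
    have h2 := tendsto_setIntegral_of_L1' (fun ω => (g ω : ℝ)) hgL.1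
      (Eventually.of_forall fun n => memLp_one_iff_integrable.1 (hui.memLp n)) hL1 s
    simp only [h1] at h2
    exact (tendsto_nhds_unique h2 tendsto_const_nhds)
  -- `g` itself need not be adapted. The `limsup` along `r` is a version that is: dropping finitely
  -- many terms shows that it is known at each time `s > t`.
  · set h : Ω → ENNReal := fun ω => limsup (fun n => (M (r n) ω : ENNReal)) atTop with hh
    have hanti : ∀ s > t, ∃ n₀, ∀ n ≥ n₀, (r n : ℝ≥0) ≤ s := fun s hs => by
      have := hr.eventually ((eventually_ratRight (p := fun q => (q : ℝ≥0) ≤ s)).2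
        ⟨s, hs, fun q _ h => h.le⟩)
      exact eventually_atTop.1 this
    have hmeas_h : Measurable[𝓕.rightCont t] h := by
      intro B hB
      rw [hFt]
      refine MeasurableSpace.measurableSet_iInf.2 fun s => MeasurableSpace.measurableSet_iInf.2
        fun hs => ?_
      obtain ⟨n₀, hn₀⟩ := hanti s hs
      have heq : h = fun ω => limsup (fun n => (M (r (n + n₀)) ω : ENNReal)) atTop :=
        funext fun ω => (limsup_nat_add (fun n => (M (r n) ω : ENNReal)) n₀).symm
      have : Measurable[𝓕 s] h := by
        rw [heq]
        refine @Measurable.limsup _ _ _ _ _ (𝓕 s) _ _ _ _ fun n => ?_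
        exact ENNReal.continuous_coe.measurable.comp
          ((hmeas _).mono (𝓕.mono (hn₀ _ (by omega))) le_rfl)
      exact this hB
    refine ⟨fun ω => (h ω).toReal, (ENNReal.measurable_toReal.comp hmeas_h).stronglyMeasurable, ?_⟩
    filter_upwards [hg] with ω hω
    have : h ω = g ω := (ENNReal.tendsto_coe.2 (hω.comp hr)).limsup_eq
    simp [this]

end Martingale

end RCLLPath

/-! ### Measurable regularization -/

namespace RCLLPath

lemma tendsto_ratRight_add_one_div (q : ℚ≥0) :
    Tendsto (fun n : ℕ => q + 1 / ((n : ℚ≥0) + 1)) atTop (ratRight (q : ℝ≥0)) := by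
  refine tendsto_comap_iff.2 (tendsto_nhdsWithin_iff.2 ⟨?_, Eventually.of_forall fun n => ?_⟩)
  · have h : Tendsto (fun n : ℕ => (q : ℝ≥0) + 1 / ((n : ℝ≥0) + 1)) atTop (𝓝 (q + 0)) :=
      tendsto_const_nhds.add (tendsto_one_div_add_atTop_nhds_zero_nat (𝕜 := ℝ≥0))
    rw [add_zero] at h
    refine h.congr fun n => ?_
    simp
  · simp only [Function.comp_apply, Set.mem_Ioi, NNRat.cast_lt]
    exact lt_add_of_pos_right _ (by positivity)

/-- Take right limits at rational times by a `limsup`, which is measurable for every `f`, and apply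
a measurable left inverse of `ratRestrict`. Off the range of `ratRestrict` that inverse is a mere
default. -/
lemma exists_regularization : ∃ R : (ℚ≥0 → ℝ≥0) → RCLLPath ℝ≥0, Measurable R ∧
    ∀ f, ((∀ t, ∃ l, Tendsto f (ratRight t) (𝓝 l)) ∧ ∀ t, ∃ l, Tendsto f (ratLeft t) (𝓝 l)) →
      ∀ t, Tendsto f (ratRight t) (𝓝 (R f t)) := by
  obtain ⟨e, he, hee⟩ := (measurableEmbedding_ratRestrict (E := ℝ≥0)).exists_measurable_extend
    (g := id) measurable_id fun _ => ⟨const 0⟩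
  set L : (ℚ≥0 → ℝ≥0) → ℚ≥0 → ℝ≥0 := fun f q =>
    (limsup (fun n : ℕ => (f (q + 1 / ((n : ℚ≥0) + 1)) : ENNReal)) atTop).toNNReal with hL
  have hLm : Measurable L := measurable_pi_lambda _ fun q => ENNReal.measurable_toNNReal.comp
    (Measurable.limsup fun n => ENNReal.continuous_coe.measurable.comp (measurable_pi_apply _))
  refine ⟨e ∘ L, he.comp hLm, fun f hf => ?_⟩
  obtain ⟨g, hg⟩ := exists_rightLim_path hf.1 hf.2
  have hLf : L f = ratRestrict g := by
    funext q
    have := (ENNReal.tendsto_coe.2 ((hg q).comp (tendsto_ratRight_add_one_div q))).limsup_eq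
    simp only [hL]
    exact (congrArg ENNReal.toNNReal this).trans (ENNReal.toNNReal_coe _)
  have : (e ∘ L) f = g := by
    rw [Function.comp_apply, hLf]
    exact congrFun hee g
  rwa [this]

/-- A measurable choice of the path of right limits of a function on the rational times. -/
noncomputable def regularize : (ℚ≥0 → ℝ≥0) → RCLLPath ℝ≥0 := exists_regularization.choose

lemma measurable_regularize : Measurable regularize := exists_regularization.choose_spec.1

lemma tendsto_regularize {f : ℚ≥0 → ℝ≥0}
    (hf : (∀ t, ∃ l, Tendsto f (ratRight t) (𝓝 l)) ∧ ∀ t, ∃ l, Tendsto f (ratLeft t) (𝓝 l))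
    (t : ℝ≥0) : Tendsto f (ratRight t) (𝓝 (regularize f t)) :=
  exists_regularization.choose_spec.2 f hf t

end RCLLPath

/-! ### Density processes and their laws -/

namespace Market

open RCLLPath

section Density

variable {E : Type*} [TopologicalSpace E] [TopologicalSpace.MetrizableSpace E]
  [SecondCountableTopology E] [MeasurableSpace E] [BorelSpace E]

/-- The law of the path stopped at time `t`, as a kernel in the underlying law. -/
noncomputable def stopKernel (E : Type*) [TopologicalSpace E] [TopologicalSpace.MetrizableSpace E]
    [SecondCountableTopology E] [MeasurableSpace E] [BorelSpace E] (t : ℝ≥0) :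
    Kernel (ProbabilityMeasure (RCLLPath E)) (RCLLPath E) where
  toFun P := (P : Measure (RCLLPath E)).map (stopAt t)
  measurable' := (Measure.measurable_map _ (measurable_stopAt t)).comp measurable_subtype_coe

instance (t : ℝ≥0) : IsMarkovKernel (stopKernel E t) :=
  ⟨fun _ => Measure.isProbabilityMeasure_map (measurable_stopAt t).aemeasurable⟩

/-- The density of `Q` with respect to `P` on the `σ`-algebra of the path stopped at time `t`,
chosen jointly measurably in `((P, Q), ω)`. -/
noncomputable def stoppedDensity (t : ℝ≥0)
    (p : ProbabilityMeasure (RCLLPath E) × ProbabilityMeasure (RCLLPath E)) (ω : RCLLPath E) :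
    ℝ≥0 :=
  (Kernel.rnDeriv ((stopKernel E t).comap Prod.snd measurable_snd)
    ((stopKernel E t).comap Prod.fst measurable_fst) p (stopAt t ω)).toNNReal

lemma measurable_stoppedDensity (t : ℝ≥0) :
    Measurable fun x : (ProbabilityMeasure (RCLLPath E) × ProbabilityMeasure (RCLLPath E)) ×
      RCLLPath E => stoppedDensity t x.1 x.2 :=
  ENNReal.measurable_toNNReal.comp ((Kernel.measurable_rnDeriv _ _).comp
    (measurable_fst.prodMk ((measurable_stopAt t).comp measurable_snd)))

lemma measurable_stoppedDensity_rawFiltration (t : ℝ≥0)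
    (p : ProbabilityMeasure (RCLLPath E) × ProbabilityMeasure (RCLLPath E)) :
    Measurable[rawFiltration E t] (stoppedDensity t p) := by
  refine measurable_rawFiltration_of_stopAt
    ((measurable_stoppedDensity t).comp (measurable_const.prodMk measurable_id)) fun ω => ?_
  have : stopAt t (stopAt t ω) = stopAt t ω := RCLLPath.ext fun s => by simp [stopAt_apply]
  simp only [stoppedDensity, Function.comp_apply, id_eq, this]

/-- Past events are preimages under `stopAt t`. Changing variables, the integral over such an event
becomes that of the density of the stopped laws, which is the `Q`-probability of the event. -/
lemma stoppedDensity_ae_eq_condExp (t : ℝ≥0) {P Q : ProbabilityMeasure (RCLLPath E)}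
    (hQP : (Q : Measure (RCLLPath E)) ≪ (P : Measure (RCLLPath E))) :
    (fun ω => (stoppedDensity t (P, Q) ω : ℝ)) =ᵐ[(P : Measure (RCLLPath E))]
      (P : Measure (RCLLPath E))[fun ω =>
        ((Q : Measure (RCLLPath E)).rnDeriv (P : Measure (RCLLPath E)) ω).toReal |
          rawFiltration E t] := by
  set h := Kernel.rnDeriv ((stopKernel E t).comap Prod.snd measurable_snd)
    ((stopKernel E t).comap Prod.fst measurable_fst) (P, Q) with hh
  have hP' : IsProbabilityMeasure ((P : Measure (RCLLPath E)).map (stopAt t)) :=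
    Measure.isProbabilityMeasure_map (measurable_stopAt t).aemeasurable
  have hQ' : IsProbabilityMeasure ((Q : Measure (RCLLPath E)).map (stopAt t)) :=
    Measure.isProbabilityMeasure_map (measurable_stopAt t).aemeasurable
  have hae : h =ᵐ[(P : Measure (RCLLPath E)).map (stopAt t)]
      ((Q : Measure (RCLLPath E)).map (stopAt t)).rnDeriv
        ((P : Measure (RCLLPath E)).map (stopAt t)) :=
    Kernel.rnDeriv_eq_rnDeriv_measure
      (κ := (stopKernel E t).comap Prod.snd measurable_snd)
      (η := (stopKernel E t).comap Prod.fst measurable_fst) (a := (P, Q))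
  have hhm : Measurable h := (Kernel.measurable_rnDeriv _ _).comp
    (measurable_const.prodMk measurable_id)
  have hint' : Integrable (fun ω => (h ω).toReal) ((P : Measure (RCLLPath E)).map (stopAt t)) :=
    (Measure.integrable_toReal_rnDeriv
      (μ := (Q : Measure (RCLLPath E)).map (stopAt t))).congr
      (hae.mono fun ω hω => by simp only [hω])
  have hint : Integrable (fun ω => (stoppedDensity t (P, Q) ω : ℝ)) (P : Measure (RCLLPath E)) :=
    hint'.comp_measurable (measurable_stopAt t)
  refine ae_eq_condExp_of_forall_setIntegral_eq ((rawFiltration E).le t)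
    Measure.integrable_toReal_rnDeriv (fun s _ _ => hint.integrableOn) (fun s hs _ => ?_)
    (NNReal.continuous_coe.measurable.comp
      (measurable_stoppedDensity_rawFiltration t (P, Q))).aestronglyMeasurable
  rw [Measure.setIntegral_toReal_rnDeriv hQP]
  rw [rawFiltration_eq_comap_stopAt] at hs
  obtain ⟨B, hB, rfl⟩ := hs
  calc ∫ ω in stopAt t ⁻¹' B, (stoppedDensity t (P, Q) ω : ℝ) ∂(P : Measure (RCLLPath E))
      = ∫ ω in B, (h ω).toReal ∂((P : Measure (RCLLPath E)).map (stopAt t)) := by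
        rw [setIntegral_map hB hhm.ennreal_toReal.aestronglyMeasurable
          (measurable_stopAt t).aemeasurable]
        rfl
    _ = ∫ ω in B, (((Q : Measure (RCLLPath E)).map (stopAt t)).rnDeriv
          ((P : Measure (RCLLPath E)).map (stopAt t)) ω).toReal
            ∂((P : Measure (RCLLPath E)).map (stopAt t)) :=
        integral_congr_ae (ae_restrict_of_ae (hae.mono fun ω hω => by simp only [hω]))
    _ = ((Q : Measure (RCLLPath E)).map (stopAt t)).real B :=
        Measure.setIntegral_toReal_rnDeriv (hQP.map (measurable_stopAt t)) _
    _ = (Q : Measure (RCLLPath E)).real (stopAt t ⁻¹' B) := by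
        rw [measureReal_def, measureReal_def, Measure.map_apply (measurable_stopAt t) hB]

/-- A density process, chosen jointly measurably in `((P, Q), ω)`. -/
noncomputable def densityProcess
    (p : ProbabilityMeasure (RCLLPath E) × ProbabilityMeasure (RCLLPath E)) (ω : RCLLPath E) :
    RCLLPath ℝ≥0 :=
  regularize fun q => stoppedDensity (q : ℝ≥0) p ω

lemma measurable_densityProcess :
    Measurable fun x : (ProbabilityMeasure (RCLLPath E) × ProbabilityMeasure (RCLLPath E)) ×
      RCLLPath E => densityProcess x.1 x.2 :=
  measurable_regularize.comp (measurable_pi_lambda _ fun _ => measurable_stoppedDensity _)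

lemma isDensityProcess_densityProcess {P Q : ProbabilityMeasure (RCLLPath E)}
    (hQP : (Q : Measure (RCLLPath E)) ≪ (P : Measure (RCLLPath E))) :
    IsDensityProcess P Q (densityProcess (P, Q)) where
  measurable := measurable_densityProcess.comp (measurable_const.prodMk measurable_id)
  ae_eq_condExp t := by
    refine rightLim_ae_eq_condExp (𝓕 := rawFiltration E)
      (M := fun q => stoppedDensity (q : ℝ≥0) (P, Q))
      Measure.integrable_toReal_rnDeriv
      (fun q => measurable_stoppedDensity_rawFiltration q (P, Q))
      (fun q => stoppedDensity_ae_eq_condExp q hQP) ?_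
    filter_upwards [ae_exists_tendsto_of_martingale
      (M := fun q => stoppedDensity (q : ℝ≥0) (P, Q))
      (fun q => measurable_stoppedDensity_rawFiltration q (P, Q))
      (fun q => stoppedDensity_ae_eq_condExp q hQP)] with ω hω
    exact tendsto_regularize hω t

/-- Both agree with the same conditional expectation at each of the countably many rational times,
and these determine a path. -/
lemma IsDensityProcess.ae_eq {P Q : ProbabilityMeasure (RCLLPath E)}
    {Z Z' : RCLLPath E → RCLLPath ℝ≥0} (hZ : IsDensityProcess P Q Z)
    (hZ' : IsDensityProcess P Q Z') : Z =ᵐ[(P : Measure (RCLLPath E))] Z' := by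
  have h : ∀ᵐ ω ∂(P : Measure (RCLLPath E)), ∀ q : ℚ≥0, Z ω q = Z' ω q := by
    refine ae_all_iff.2 fun q => ?_
    filter_upwards [hZ.ae_eq_condExp q, hZ'.ae_eq_condExp q] with ω h1 h2
    exact NNReal.coe_injective (h1.trans h2.symm)
  filter_upwards [h] with ω hω using ratRestrict_injective (funext hω)

lemma augLaw_congr {P Q : ProbabilityMeasure (RCLLPath E)} {Z Z' : RCLLPath E → RCLLPath ℝ≥0}
    (hZ : IsDensityProcess P Q Z) (hZ' : IsDensityProcess P Q Z') (z : ℝ≥0) :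
    augLaw P z Z = augLaw P z Z' :=
  Measure.map_congr ((hZ.ae_eq hZ').mono fun ω hω => by simp only [hω])

lemma measurable_map_prodMk {α Ω Y : Type*} [MeasurableSpace α] [MeasurableSpace Ω]
    [MeasurableSpace Y] {μ : α → Measure Ω} (hμ : Measurable μ) [∀ a, IsProbabilityMeasure (μ a)]
    {G : α × Ω → Y} (hG : Measurable G) : Measurable fun a => (μ a).map fun ω => G (a, ω) := by
  refine Measure.measurable_of_measurable_coe _ fun s hs => ?_
  have h : ∀ a, (μ a).map (fun ω => G (a, ω)) s =
      (⟨μ, hμ⟩ : Kernel α Ω) a (Prod.mk a ⁻¹' (G ⁻¹' s)) :=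
    fun a => Measure.map_apply (hG.comp measurable_prodMk_left) hs
  simp only [h]
  have : IsMarkovKernel (⟨μ, hμ⟩ : Kernel α Ω) :=
    ⟨fun a => inferInstanceAs (IsProbabilityMeasure (μ a))⟩
  exact Kernel.measurable_kernel_prodMk_left (hG hs)

/-- The law of `(X, z Z)` for the density process `Z` of `Q` with respect to `P`. -/
noncomputable def densityLaw
    (x : ℝ≥0 × ProbabilityMeasure (RCLLPath E) × ProbabilityMeasure (RCLLPath E)) :
    ProbabilityMeasure (RCLLPath (E × ℝ≥0)) :=
  ⟨augLaw x.2.1 x.1 (densityProcess x.2), Measure.isProbabilityMeasure_map (by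
    refine (measurable_pair.comp (measurable_id.prodMk (measurable_comp_const_mul.comp
      (measurable_const.prodMk (measurable_densityProcess.comp
        (measurable_const.prodMk measurable_id)))))).aemeasurable)⟩

lemma measurable_densityLaw : Measurable (densityLaw (E := E)) := by
  refine Measurable.subtype_mk (measurable_map_prodMk
    (μ := fun x : ℝ≥0 × ProbabilityMeasure (RCLLPath E) × ProbabilityMeasure (RCLLPath E) =>
      (x.2.1 : Measure (RCLLPath E)))
    (G := fun y => y.2.pair ((densityProcess y.1.2 y.2).comp (fun u => y.1.1 * u)
      (continuous_const_mul y.1.1)))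
    (measurable_subtype_coe.comp (measurable_fst.comp measurable_snd)) ?_)
  refine measurable_pair.comp (measurable_snd.prodMk (measurable_comp_const_mul.comp
    (((measurable_fst.comp measurable_fst)).prodMk (measurable_densityProcess.comp
      ((measurable_snd.comp measurable_fst).prodMk measurable_snd)))))

end Density

end Market

/-! ### Optional stopping in continuous time -/

section OptionalStopping

lemma coe_untopA_of_ne_top {ι : Type*} [Nonempty ι] {x : WithTop ι} (hx : x ≠ ⊤) :
    ((x.untopA : ι) : WithTop ι) = x := by
  rw [WithTop.untopA_eq_untop hx, WithTop.coe_untop]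

variable {Ω : Type*} {m0 : MeasurableSpace Ω} {P : Measure Ω} [IsProbabilityMeasure P]
  {𝓕 : Filtration ℝ≥0 m0}

/-- The discretization from above of a time `r ∈ [s, t]` on a grid of mesh `1 / (m + 1)`. -/
noncomputable def discretizeTime (s t : ℝ≥0) (m : ℕ) (r : ℝ≥0) : ℝ≥0 :=
  min t (s + ((⌊((m : ℝ≥0) + 1) * (r - s)⌋₊ : ℝ≥0) + 1) / (m + 1))

lemma le_discretizeTime {s t r : ℝ≥0} (m : ℕ) (hrt : r ≤ t) :
    r ≤ discretizeTime s t m r := by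
  have hm : (0 : ℝ≥0) < (m : ℝ≥0) + 1 := by positivity
  refine le_min hrt ?_
  rw [← tsub_le_iff_left, le_div_iff₀' hm]
  exact (Nat.lt_floor_add_one _).le

lemma tendsto_discretizeTime {s t r : ℝ≥0} (hsr : s ≤ r) (hrt : r ≤ t) :
    Tendsto (fun m => discretizeTime s t m r) atTop (𝓝[≥] r) := by
  refine tendsto_nhdsWithin_iff.2 ⟨?_, Eventually.of_forall fun m => le_discretizeTime m hrt⟩
  refine tendsto_of_tendsto_of_tendsto_of_le_of_le (g := fun _ => r)
    (h := fun m : ℕ => r + 1 / ((m : ℝ≥0) + 1)) tendsto_const_nhds ?_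
    (fun m => le_discretizeTime m hrt) (fun m => ?_)
  · simpa using tendsto_const_nhds.add (tendsto_one_div_add_atTop_nhds_zero_nat (𝕜 := ℝ≥0))
  · have hm : (0 : ℝ≥0) < (m : ℝ≥0) + 1 := by positivity
    refine (min_le_right _ _).trans ?_
    change _ ≤ r + 1 / ((m : ℝ≥0) + 1)
    rw [add_div, ← add_assoc]
    gcongr
    rw [← le_tsub_iff_left hsr, div_le_iff₀' hm]
    exact Nat.floor_le (by positivity)

/-- The discretized time is at most `r < t` exactly when `ρ` lies strictly before the last grid
point up to `r`. This is known at that grid point, so the filtration need not be right-continuous.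
-/
lemma isStoppingTime_discretizeTime {ρ : Ω → ℝ≥0} {s t : ℝ≥0}
    (hρ : IsStoppingTime 𝓕 fun ω => (ρ ω : WithTop ℝ≥0)) (m : ℕ) (hs : ∀ ω, s ≤ ρ ω) :
    IsStoppingTime 𝓕 fun ω => ((discretizeTime s t m (ρ ω) : ℝ≥0) : WithTop ℝ≥0) := by
  intro r
  have hm : (0 : ℝ≥0) < (m : ℝ≥0) + 1 := by positivity
  simp only [WithTop.coe_le_coe]
  rcases le_or_gt t r with htr | hrt
  · have : {ω | discretizeTime s t m (ρ ω) ≤ r} = Set.univ :=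
      Set.eq_univ_of_forall fun ω => (min_le_left _ _).trans htr
    rw [this]
    exact @MeasurableSet.univ _ (𝓕 r)
  rcases lt_or_ge r s with hrs | hsr
  · have : {ω | discretizeTime s t m (ρ ω) ≤ r} = ∅ := by
      refine Set.eq_empty_of_forall_notMem fun ω hω => ?_
      rcases min_le_iff.1 (show discretizeTime s t m (ρ ω) ≤ r from hω) with h | h
      · exact absurd h (not_le.2 hrt)
      · exact absurd ((le_self_add).trans h) (not_le.2 hrs)
    rw [this]
    exact @MeasurableSet.empty _ (𝓕 r)
  set K := ⌊((m : ℝ≥0) + 1) * (r - s)⌋₊ with hK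
  have hKr : s + (K : ℝ≥0) / (m + 1) ≤ r := by
    rw [← le_tsub_iff_left hsr, div_le_iff₀' hm]
    exact Nat.floor_le (by positivity)
  have : {ω | discretizeTime s t m (ρ ω) ≤ r} =
      {ω | (ρ ω : WithTop ℝ≥0) < ((s + (K : ℝ≥0) / (m + 1) : ℝ≥0) : WithTop ℝ≥0)} := by
    ext ω
    simp only [Set.mem_ofPred_eq, WithTop.coe_lt_coe]
    rw [discretizeTime, min_le_iff, or_iff_right (not_le.2 hrt), ← le_tsub_iff_left hsr,
      div_le_iff₀' hm, ← tsub_lt_iff_left (hs ω), lt_div_iff₀' hm, ← Nat.floor_lt (by positivity),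
      ← Nat.add_one_le_iff, hK, Nat.le_floor_iff (by positivity)]
    push_cast
    rfl
  rw [this]
  exact 𝓕.mono hKr _ (hρ.measurableSet_lt _)

/-- Optional sampling between deterministic times for a right-continuous martingale. -/
lemma MeasureTheory.Martingale.optional_sampling {N : ℝ≥0 → Ω → ℝ} (hN : Martingale N 𝓕 P)
    (hrc : ∀ ω t, ContinuousWithinAt (fun u => N u ω) (Set.Ici t) t) {ρ : Ω → ℝ≥0}
    (hρ : IsStoppingTime 𝓕 fun ω => (ρ ω : WithTop ℝ≥0)) {s t : ℝ≥0} (hs : ∀ ω, s ≤ ρ ω)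
    (ht : ∀ ω, ρ ω ≤ t) :
    Integrable (fun ω => N (ρ ω) ω) P ∧
      ∀ B, MeasurableSet[𝓕 s] B → ∫ ω in B, N (ρ ω) ω ∂P = ∫ ω in B, N s ω ∂P := by
  have hst : ∀ m ω, discretizeTime s t m (ρ ω) ≤ t := fun m ω => min_le_left _ _
  have hdisc := fun m => isStoppingTime_discretizeTime (t := t) hρ m hs
  have hae : ∀ m, (fun ω => N (discretizeTime s t m (ρ ω)) ω) =ᵐ[P]
      P[N t | (hdisc m).measurableSpace] := by
    intro m
    have hle : ∀ ω, ((discretizeTime s t m (ρ ω) : ℝ≥0) : WithTop ℝ≥0) ≤ t := fun ω =>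
      WithTop.coe_le_coe.2 (hst m ω)
    have hc : (Set.range fun ω =>
        ((discretizeTime s t m (ρ ω) : ℝ≥0) : WithTop ℝ≥0)).Countable := by
      refine (Set.countable_range fun k : ℕ =>
        ((min t (s + ((k : ℝ≥0) + 1) / (m + 1)) : ℝ≥0) : WithTop ℝ≥0)).mono ?_
      rintro _ ⟨ω, rfl⟩
      exact ⟨_, rfl⟩
    have h := hN.stoppedValue_ae_eq_condExp_of_le_const_of_countable_range (hdisc m) hle hc
    exact h
  -- Conditional expectations of the single variable `N t` are uniformly integrable, so the limit
  -- from above holds in `L¹`.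
  have hui : UniformIntegrable (fun m ω => N (discretizeTime s t m (ρ ω)) ω) 1 P :=
    ((hN.integrable t).uniformIntegrable_condExp
      fun m => (hdisc m).measurableSpace_le).ae_eq fun m => (hae m).symm
  have hlim : ∀ᵐ ω ∂P, Tendsto (fun m => N (discretizeTime s t m (ρ ω)) ω) atTop
      (𝓝 (N (ρ ω) ω)) :=
    ae_of_all _ fun ω => (hrc ω (ρ ω)).tendsto.comp (tendsto_discretizeTime (hs ω) (ht ω))
  have hL := hui.memLp_of_ae_tendsto hlim
  have hL1 := tendsto_Lp_finite_of_tendsto_ae le_rfl ENNReal.one_ne_top hui.1 hL hui.2.1 hlim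
  refine ⟨memLp_one_iff_integrable.1 hL, fun B hB => ?_⟩
  have h1 : ∀ m, ∫ ω in B, N (discretizeTime s t m (ρ ω)) ω ∂P = ∫ ω in B, N t ω ∂P := by
    intro m
    have hle : 𝓕 s ≤ (hdisc m).measurableSpace := (hdisc m).le_measurableSpace_of_const_le
      fun ω => WithTop.coe_le_coe.2 ((hs ω).trans (le_discretizeTime m (ht ω)))
    rw [setIntegral_congr_ae (𝓕.le s B hB) ((hae m).mono fun ω h _ => h),
      setIntegral_condExp (hdisc m).measurableSpace_le (hN.integrable t) (hle B hB)]
  have h2 := tendsto_setIntegral_of_L1' _ hL.1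
    (Eventually.of_forall fun m => memLp_one_iff_integrable.1 (hui.memLp m)) hL1 B
  simp only [h1] at h2
  rw [tendsto_nhds_unique h2 tendsto_const_nhds]
  rcases isEmpty_or_nonempty Ω with hΩ | ⟨⟨ω⟩⟩
  · simp [Set.eq_empty_of_isEmpty B]
  · exact (hN.setIntegral_eq ((hs ω).trans (ht ω)) hB).symm

/-- Optional stopping for a right-continuous martingale. -/
lemma MeasureTheory.Martingale.optional_stopping {N : ℝ≥0 → Ω → ℝ} (hN : Martingale N 𝓕 P)
    (hrc : ∀ ω t, ContinuousWithinAt (fun u => N u ω) (Set.Ici t) t) {τ : Ω → WithTop ℝ≥0}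
    (hτ : IsStoppingTime 𝓕 τ) :
    (∀ t, Integrable (stoppedProcess N τ t) P) ∧
      ∀ s t, s ≤ t → ∀ A, MeasurableSet[𝓕 s] A →
        ∫ ω in A, stoppedProcess N τ t ω ∂P = ∫ ω in A, stoppedProcess N τ s ω ∂P := by
  set θ : ℝ≥0 → Ω → ℝ≥0 := fun t ω => (min (t : WithTop ℝ≥0) (τ ω)).untopA with hθ
  have hθc : ∀ t ω, ((θ t ω : ℝ≥0) : WithTop ℝ≥0) = min (t : WithTop ℝ≥0) (τ ω) := fun t ω =>
    coe_untopA_of_ne_top (ne_top_of_le_ne_top WithTop.coe_ne_top (min_le_left _ _))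
  have hθt : ∀ t ω, θ t ω ≤ t := fun t ω => by
    rw [← WithTop.coe_le_coe, hθc]
    exact min_le_left _ _
  have hθs : ∀ t, IsStoppingTime 𝓕 fun ω => ((θ t ω : ℝ≥0) : WithTop ℝ≥0) := fun t => by
    simp only [hθc, min_comm (t : WithTop ℝ≥0)]
    exact hτ.min_const t
  have hint : ∀ t, Integrable (stoppedProcess N τ t) P := fun t =>
    (hN.optional_sampling hrc (hθs t) (s := 0) (fun ω => zero_le) (hθt t)).1
  refine ⟨hint, fun s t hst A hA => ?_⟩
  -- On `s < τ`, sampling at this time, which lies in `[s, t]`, gives the stopped value; on the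
  -- complement the stopped process is constant over `[s, t]`.
  have hρ : IsStoppingTime 𝓕 fun ω => ((max (θ t ω) s : ℝ≥0) : WithTop ℝ≥0) := by
    simp only [WithTop.coe_max]
    exact (hθs t).max_const s
  have hkey := (hN.optional_sampling hrc hρ (s := s) (t := t) (fun ω => le_max_right _ _)
    (fun ω => max_le (hθt t ω) hst)).2
  have hτm : MeasurableSet[𝓕 s] {ω | (s : WithTop ℝ≥0) < τ ω} := hτ.measurableSet_gt s
  have hsplit : ∀ f : Ω → ℝ, Integrable f P → ∫ ω in A, f ω ∂P =
      ∫ ω in A ∩ {ω | (s : WithTop ℝ≥0) < τ ω}, f ω ∂P +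
        ∫ ω in A \ {ω | (s : WithTop ℝ≥0) < τ ω}, f ω ∂P := fun f hf =>
    (integral_inter_add_sdiff (𝓕.le s _ hτm) hf.integrableOn).symm
  rw [hsplit _ (hint t), hsplit _ (hint s)]
  have hA1 : MeasurableSet[𝓕 s] (A ∩ {ω | (s : WithTop ℝ≥0) < τ ω}) := hA.inter hτm
  have hA2 : MeasurableSet[𝓕 s] (A \ {ω | (s : WithTop ℝ≥0) < τ ω}) := hA.diff hτm
  congr 1
  · have e1 : ∫ ω in A ∩ {ω | (s : WithTop ℝ≥0) < τ ω}, stoppedProcess N τ t ω ∂P =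
        ∫ ω in A ∩ {ω | (s : WithTop ℝ≥0) < τ ω}, N (max (θ t ω) s) ω ∂P := by
      refine setIntegral_congr_fun (𝓕.le s _ hA1) fun ω hω => ?_
      have h : s ≤ θ t ω := by
        rw [← WithTop.coe_le_coe, hθc]
        exact le_min (WithTop.coe_le_coe.2 hst) (le_of_lt hω.2)
      change N (θ t ω) ω = N (max (θ t ω) s) ω
      rw [max_eq_left h]
    have e2 : ∫ ω in A ∩ {ω | (s : WithTop ℝ≥0) < τ ω}, stoppedProcess N τ s ω ∂P =
        ∫ ω in A ∩ {ω | (s : WithTop ℝ≥0) < τ ω}, N s ω ∂P := by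
      refine setIntegral_congr_fun (𝓕.le s _ hA1) fun ω hω => ?_
      have h : θ s ω = s := by
        rw [← WithTop.coe_inj, hθc]
        exact min_eq_left (le_of_lt hω.2)
      change N (θ s ω) ω = N s ω
      rw [h]
    rw [e1, e2, hkey _ hA1]
  · refine setIntegral_congr_fun (𝓕.le s _ hA2) fun ω hω => ?_
    have hle : τ ω ≤ s := not_lt.1 hω.2
    have h : θ t ω = θ s ω := by
      rw [← WithTop.coe_inj, hθc, hθc, min_eq_right hle,
        min_eq_right (hle.trans (WithTop.coe_le_coe.2 hst))]
    change N (θ t ω) ω = N (θ s ω) ω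
    rw [h]

end OptionalStopping

/-! ### Stopping a single path -/

section StoppedPath

/-- The time `t ∧ τ`. -/
noncomputable def minTime (t : ℝ≥0) (τ : WithTop ℝ≥0) : ℝ≥0 := (min (t : WithTop ℝ≥0) τ).untopA

lemma coe_minTime (t : ℝ≥0) (τ : WithTop ℝ≥0) :
    ((minTime t τ : ℝ≥0) : WithTop ℝ≥0) = min (t : WithTop ℝ≥0) τ :=
  coe_untopA_of_ne_top (ne_top_of_le_ne_top WithTop.coe_ne_top (min_le_left _ _))

lemma minTime_le (t : ℝ≥0) (τ : WithTop ℝ≥0) : minTime t τ ≤ t := by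
  rw [← WithTop.coe_le_coe, coe_minTime]
  exact min_le_left _ _

lemma minTime_of_le {t : ℝ≥0} {τ : WithTop ℝ≥0} (h : (t : WithTop ℝ≥0) ≤ τ) :
    minTime t τ = t := by
  rw [← WithTop.coe_inj, coe_minTime, min_eq_left h]

lemma minTime_coe (t r : ℝ≥0) : minTime t r = min t r := by
  rw [← WithTop.coe_inj, coe_minTime, WithTop.coe_min]

lemma minTime_top (t : ℝ≥0) : minTime t ⊤ = t := minTime_of_le le_top

lemma minTime_minTime (t : ℝ≥0) (σ τ : WithTop ℝ≥0) :
    minTime (minTime t σ) τ = minTime (minTime t τ) σ := by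
  rw [← WithTop.coe_inj, coe_minTime, coe_minTime, coe_minTime, coe_minTime, min_right_comm]

lemma stoppedProcess_eq_minTime {Ω β : Type*} (u : ℝ≥0 → Ω → β) (τ : Ω → WithTop ℝ≥0) (t : ℝ≥0)
    (ω : Ω) : stoppedProcess u τ t ω = u (minTime t (τ ω)) ω := rfl

lemma continuousWithinAt_stopped {β : Type*} [TopologicalSpace β] {u : ℝ≥0 → β}
    (hu : ∀ t, ContinuousWithinAt u (Set.Ici t) t) (τ : WithTop ℝ≥0) (t : ℝ≥0) :
    ContinuousWithinAt (fun s => u (minTime s τ)) (Set.Ici t) t := by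
  induction τ using WithTop.recTopCoe with
  | top => simpa only [minTime_top] using hu t
  | coe r =>
    simp only [minTime_coe]
    refine (hu (min t r)).comp (f := fun s : ℝ≥0 => min s r) (by fun_prop) fun s hs => ?_
    exact min_le_min_right r hs

end StoppedPath

/-! ### Level times and stopped prices -/

namespace Market

open RCLLPath

section LevelTime

variable {d : ℕ} {F : Type*} [TopologicalSpace F]

lemma price_continuousWithinAt (ω : RCLLPath (State d F)) (t : ℝ≥0) :
    ContinuousWithinAt (fun s => price s ω) (Set.Ici t) t :=
  (continuous_fst.comp continuous_snd).continuousAt.comp_continuousWithinAt (ω.rightCont' t)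

lemma price_stopAt (t s : ℝ≥0) (ω : RCLLPath (State d F)) :
    price s (stopAt t ω) = price (min s t) ω := rfl

lemma exists_norm_price_le (ω : RCLLPath (State d F)) (T : ℝ≥0) :
    ∃ C : ℝ, ∀ s ≤ T, ‖price s ω‖ ≤ C := by
  have h := induction_of_small_oscillation
    (ω.comp (fun x : State d F => x.2.1) (continuous_fst.comp continuous_snd)) one_pos
    (fun t => ∃ C : ℝ, ∀ s < t, ‖price s ω‖ ≤ C) ⟨0, fun s hs => absurd hs not_lt_zero⟩ ?_ (T + 1)
  · obtain ⟨C, hC⟩ := h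
    exact ⟨C, fun s hs => hC s (hs.trans_lt (lt_add_one T))⟩
  · rintro s s' - a ha ⟨C, hC⟩
    refine ⟨max C (‖a‖ + 1), fun r hr => ?_⟩
    rcases lt_or_ge r s with h | h
    · exact (hC r h).trans (le_max_left _ _)
    · have h1 : dist (price r ω) a < 1 := ha r ⟨h, hr⟩
      rw [dist_eq_norm] at h1
      refine le_trans ?_ (le_max_right _ _)
      linarith [norm_le_norm_add_norm_sub' (price r ω) a]

/-- The running supremum of the norm of the price over `[0, t]` is at least `n`. -/
def Reaches (n : ℕ) (t : ℝ≥0) (ω : RCLLPath (State d F)) : Prop :=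
  ∀ c : ℚ, (c : ℝ) < n → ∃ s ≤ t, (c : ℝ) < ‖price s ω‖

lemma Reaches.mono {n : ℕ} {s t : ℝ≥0} {ω : RCLLPath (State d F)} (h : Reaches n s ω)
    (hst : s ≤ t) : Reaches n t ω := fun c hc => by
  obtain ⟨r, hr, hcr⟩ := h c hc
  exact ⟨r, hr.trans hst, hcr⟩

lemma Reaches.anti_level {n m : ℕ} {t : ℝ≥0} {ω : RCLLPath (State d F)} (h : Reaches m t ω)
    (hnm : n ≤ m) : Reaches n t ω := fun c hc => h c (hc.trans_le (by exact_mod_cast hnm))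

lemma reaches_of_le_norm {n : ℕ} {t : ℝ≥0} {ω : RCLLPath (State d F)}
    (h : (n : ℝ) ≤ ‖price t ω‖) : Reaches n t ω :=
  fun _ hc => ⟨t, le_rfl, hc.trans_le h⟩

lemma reaches_stopAt {n : ℕ} {s t : ℝ≥0} (hst : s ≤ t) (ω : RCLLPath (State d F)) :
    Reaches n s (stopAt t ω) ↔ Reaches n s ω := by
  refine forall₂_congr fun c _ => exists_congr fun r => and_congr_right fun hr => ?_
  rw [price_stopAt, min_eq_left (hr.trans hst)]

/-- A second rational `c'` leaves room: if the norm is at most `c` up to `t`, right-continuity keeps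
it below `c'` a little longer. Hence the infimum defining `levelTime` is attained. -/
lemma reaches_of_forall_gt {n : ℕ} {t : ℝ≥0} {ω : RCLLPath (State d F)}
    (h : ∀ s > t, Reaches n s ω) : Reaches n t ω := by
  intro c hc
  obtain ⟨c', hcc', hc'⟩ := exists_rat_btwn hc
  by_contra! hcon
  have h1 : ∀ᶠ s in 𝓝[≥] t, ‖price s ω‖ < c' :=
    (price_continuousWithinAt ω t).norm.eventually (gt_mem_nhds ((hcon t le_rfl).trans_lt hcc'))
  obtain ⟨b, hb, hbs⟩ := (mem_nhdsGE_iff_exists_Ico_subset).1 h1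
  obtain ⟨s, hts, hsb⟩ := exists_between (show t < b from hb)
  obtain ⟨r, hrs, hr⟩ := h s hts c' hc'
  rcases le_or_gt r t with hrt | hrt
  · linarith [hcon r hrt]
  · have : ‖price r ω‖ < c' := hbs ⟨hrt.le, hrs.trans_lt hsb⟩
    linarith

open Classical in
/-- The first time at which the running supremum of the norm of the price is at least `n`. Unlike
the exit time, it is a stopping time of the raw filtration. -/
noncomputable def levelTime (n : ℕ) (ω : RCLLPath (State d F)) : WithTop ℝ≥0 :=
  if ∃ t, Reaches n t ω then ((sInf {t | Reaches n t ω} : ℝ≥0) : WithTop ℝ≥0) else ⊤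

lemma levelTime_le_iff {n : ℕ} {t : ℝ≥0} {ω : RCLLPath (State d F)} :
    levelTime n ω ≤ t ↔ Reaches n t ω := by
  rw [levelTime]
  split_ifs with h
  · rw [WithTop.coe_le_coe]
    refine ⟨fun hle => (reaches_of_forall_gt fun s hs => ?_ : Reaches n t ω),
      fun h => csInf_le (OrderBot.bddBelow _) h⟩
    obtain ⟨r, hr, hrs⟩ := exists_lt_of_csInf_lt h (hle.trans_lt hs)
    exact Reaches.mono hr hrs.le
  · exact ⟨fun hle => absurd hle (not_le.2 (WithTop.coe_lt_top t)), fun h' => absurd ⟨t, h'⟩ h⟩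

lemma lt_levelTime_iff {n : ℕ} {t : ℝ≥0} {ω : RCLLPath (State d F)} :
    (t : WithTop ℝ≥0) < levelTime n ω ↔ ¬ Reaches n t ω := by
  rw [← levelTime_le_iff, not_le]

lemma bot_lt_levelTime_iff {n : ℕ} {ω : RCLLPath (State d F)} :
    ⊥ < levelTime n ω ↔ ¬ Reaches n 0 ω := by
  rw [← lt_levelTime_iff]
  rfl

lemma norm_price_lt_of_lt_levelTime {n : ℕ} {t : ℝ≥0} {ω : RCLLPath (State d F)}
    (h : (t : WithTop ℝ≥0) < levelTime n ω) : ‖price t ω‖ < n := by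
  by_contra hcon
  exact lt_levelTime_iff.1 h (reaches_of_le_norm (not_lt.1 hcon))

lemma levelTime_mono (ω : RCLLPath (State d F)) : Monotone fun n => levelTime n ω := by
  intro n m hnm
  refine le_of_forall_ge fun c hc => ?_
  induction c using WithTop.recTopCoe with
  | top => exact le_top
  | coe t => exact levelTime_le_iff.2 ((levelTime_le_iff.1 hc).anti_level hnm)

lemma tendsto_levelTime (ω : RCLLPath (State d F)) :
    Tendsto (fun n => levelTime n ω) atTop (𝓝 ⊤) := by
  refine tendsto_order.2 ⟨fun a ha => ?_, fun a ha => absurd ha (by simp)⟩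
  lift a to ℝ≥0 using ha.ne
  obtain ⟨C, hC⟩ := exists_norm_price_le ω a
  obtain ⟨n₀, hn₀⟩ := exists_nat_gt C
  filter_upwards [eventually_ge_atTop n₀] with n hn
  rw [lt_levelTime_iff]
  intro h
  obtain ⟨c, hc1, hc2⟩ := exists_rat_btwn (hn₀.trans_le (by exact_mod_cast hn : (n₀ : ℝ) ≤ n))
  obtain ⟨s, hs, hcs⟩ := h c hc2
  linarith [hC s hs]

/-- Whether the level is reached by a time before `t` can be read off the path stopped at `t`; this
makes the stopped price adapted to the raw filtration. -/
lemma minTime_levelTime_stopAt (n : ℕ) (t : ℝ≥0) (ω : RCLLPath (State d F)) :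
    minTime t (levelTime n (stopAt t ω)) = minTime t (levelTime n ω) := by
  rw [← WithTop.coe_inj, coe_minTime, coe_minTime]
  refine eq_of_forall_ge_iff fun c => ?_
  rw [min_le_iff, min_le_iff]
  rcases le_or_gt (t : WithTop ℝ≥0) c with h | h
  · exact iff_of_true (Or.inl h) (Or.inl h)
  · lift c to ℝ≥0 using (h.trans_le le_top).ne
    rw [levelTime_le_iff, levelTime_le_iff, reaches_stopAt (WithTop.coe_lt_coe.1 h).le]

/-- The price process stopped at the `n`-th level time, and set to zero if that time is zero. -/
noncomputable def stoppedPrice (n : ℕ) : ℝ≥0 → RCLLPath (State d F) → EuclideanSpace ℝ (Fin d) :=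
  stoppedProcess (fun i => {ω | ⊥ < levelTime n ω}.indicator (price i)) (levelTime n)

lemma stoppedPrice_of_lt {n : ℕ} {ω : RCLLPath (State d F)} (h : ⊥ < levelTime n ω) (t : ℝ≥0) :
    stoppedPrice n t ω = price (minTime t (levelTime n ω)) ω :=
  Set.indicator_of_mem (s := {ω | ⊥ < levelTime n ω}) h _

lemma stoppedPrice_of_not_lt {n : ℕ} {ω : RCLLPath (State d F)} (h : ¬ ⊥ < levelTime n ω)
    (t : ℝ≥0) : stoppedPrice n t ω = 0 :=
  Set.indicator_of_notMem (s := {ω | ⊥ < levelTime n ω}) h _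

lemma stoppedPrice_stopAt (n : ℕ) (t : ℝ≥0) (ω : RCLLPath (State d F)) :
    stoppedPrice n t (stopAt t ω) = stoppedPrice n t ω := by
  have hiff : ⊥ < levelTime n (stopAt t ω) ↔ ⊥ < levelTime n ω := by
    rw [bot_lt_levelTime_iff, bot_lt_levelTime_iff, reaches_stopAt zero_le]
  by_cases h : ⊥ < levelTime n ω
  · rw [stoppedPrice_of_lt h, stoppedPrice_of_lt (hiff.2 h), minTime_levelTime_stopAt, price_stopAt,
      min_eq_left (minTime_le _ _)]
  · rw [stoppedPrice_of_not_lt h, stoppedPrice_of_not_lt (mt hiff.1 h)]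

lemma stoppedPrice_continuousWithinAt (n : ℕ) (ω : RCLLPath (State d F)) (t : ℝ≥0) :
    ContinuousWithinAt (fun s => stoppedPrice n s ω) (Set.Ici t) t := by
  by_cases h : ⊥ < levelTime n ω
  · simp only [stoppedPrice_of_lt h]
    exact continuousWithinAt_stopped (price_continuousWithinAt ω) _ t
  · simp only [stoppedPrice_of_not_lt h]
    exact continuousWithinAt_const

/-- Before the level time the norm is below `n`, and from then on the stopped price is frozen. This
domination by a single later value carries all later limit arguments. -/
lemma norm_stoppedPrice_le (n : ℕ) {s t : ℝ≥0} (hst : s ≤ t) (ω : RCLLPath (State d F)) :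
    ‖stoppedPrice n s ω‖ ≤ n + ‖stoppedPrice n t ω‖ := by
  by_cases h : ⊥ < levelTime n ω
  · rw [stoppedPrice_of_lt h, stoppedPrice_of_lt h]
    rcases lt_or_ge (s : WithTop ℝ≥0) (levelTime n ω) with hs | hs
    · rw [minTime_of_le hs.le]
      exact (norm_price_lt_of_lt_levelTime hs).le.trans (le_add_of_nonneg_right (norm_nonneg _))
    · have : minTime s (levelTime n ω) = minTime t (levelTime n ω) := by
        rw [← WithTop.coe_inj, coe_minTime, coe_minTime, min_eq_right hs,
          min_eq_right (hs.trans (WithTop.coe_le_coe.2 hst))]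
      rw [this]
      exact le_add_of_nonneg_left n.cast_nonneg
  · rw [stoppedPrice_of_not_lt h, norm_zero]
    positivity

lemma norm_stoppedPrice_zero_le (n : ℕ) (ω : RCLLPath (State d F)) :
    ‖stoppedPrice n 0 ω‖ ≤ n := by
  by_cases h : ⊥ < levelTime n ω
  · rw [stoppedPrice_of_lt h, minTime_of_le zero_le]
    exact (norm_price_lt_of_lt_levelTime h).le
  · rw [stoppedPrice_of_not_lt h, norm_zero]
    positivity

end LevelTime

/-! ### Measurability of level times and stopped prices -/

section LevelTimeMeasurability

variable {d : ℕ} {F : Type*} [TopologicalSpace F] [TopologicalSpace.MetrizableSpace F]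
  [SecondCountableTopology F] [MeasurableSpace F] [BorelSpace F]

lemma measurable_price (t : ℝ≥0) :
    Measurable (price t : RCLLPath (State d F) → EuclideanSpace ℝ (Fin d)) :=
  (measurable_fst.comp measurable_snd).comp (measurable_apply t)

/-- Right-continuity gives a rational time for `s < t`; the endpoint itself is reached by truncating
a rational beyond `t`. -/
lemma exists_rat_lt_norm_price_iff {c : ℝ} {t : ℝ≥0} {ω : RCLLPath (State d F)} :
    (∃ s ≤ t, c < ‖price s ω‖) ↔ ∃ q : ℚ≥0, c < ‖price (min (q : ℝ≥0) t) ω‖ := by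
  constructor
  · rintro ⟨s, hst, hs⟩
    rcases hst.eq_or_lt with rfl | hlt
    · obtain ⟨q, hq, -⟩ := exists_nnrat_btwn (lt_add_one s)
      exact ⟨q, by rwa [min_eq_right hq.le]⟩
    · have h1 : ∀ᶠ r in 𝓝[≥] s, c < ‖price r ω‖ :=
        (price_continuousWithinAt ω s).norm.eventually (lt_mem_nhds hs)
      obtain ⟨b, hb, hbs⟩ := (mem_nhdsGE_iff_exists_Ico_subset).1 h1
      obtain ⟨q, hq1, hq2⟩ := exists_nnrat_btwn (lt_min hb hlt)
      refine ⟨q, ?_⟩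
      rw [min_eq_left (hq2.le.trans (min_le_right _ _))]
      exact hbs ⟨hq1.le, hq2.trans_le (min_le_left _ _)⟩
  · rintro ⟨q, hq⟩
    exact ⟨_, min_le_right _ _, hq⟩

lemma measurable_reaches (n : ℕ) (t : ℝ≥0) :
    Measurable fun ω : RCLLPath (State d F) => Reaches n t ω := by
  simp only [Reaches, exists_rat_lt_norm_price_iff]
  exact .forall fun c => .forall fun _ => .exists fun q =>
    measurableSet_setOfPred.1 (measurableSet_lt measurable_const (measurable_price _).norm)

lemma isStoppingTime_levelTime (n : ℕ) :
    IsStoppingTime (rawFiltration (State d F)) (levelTime n) := by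
  intro t
  simp only [levelTime_le_iff]
  refine @measurableSet_setOfPred _ (rawFiltration (State d F) t) _ |>.2
    (measurable_rawFiltration_of_stopAt (measurable_reaches n t) fun ω => ?_)
  exact propext (reaches_stopAt le_rfl ω)

lemma measurable_stoppedPrice (n : ℕ) (t : ℝ≥0) :
    Measurable (stoppedPrice n t : RCLLPath (State d F) → EuclideanSpace ℝ (Fin d)) := by
  have hσ := isStoppingTime_levelTime (d := d) (F := F) n
  have hmin : Measurable fun ω : RCLLPath (State d F) => minTime t (levelTime n ω) := by
    refine measurable_of_Iic fun s => ?_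
    have : (fun ω : RCLLPath (State d F) => minTime t (levelTime n ω)) ⁻¹' Set.Iic s =
        {ω | t ≤ s ∨ Reaches n s ω} := by
      ext ω
      rw [Set.mem_preimage, Set.mem_Iic, ← WithTop.coe_le_coe, coe_minTime, min_le_iff,
        levelTime_le_iff, WithTop.coe_le_coe]
      rfl
    rw [this]
    exact measurableSet_setOfPred.2 (measurable_const.or (measurable_reaches n s))
  have hA : MeasurableSet {ω : RCLLPath (State d F) | ⊥ < levelTime n ω} :=
    (rawFiltration (State d F)).le 0 _ (hσ.measurableSet_gt 0)
  have h : (stoppedPrice n t : RCLLPath (State d F) → EuclideanSpace ℝ (Fin d)) =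
      {ω | ⊥ < levelTime n ω}.indicator fun ω => (ω (minTime t (levelTime n ω))).2.1 := by
    funext ω
    by_cases h : ⊥ < levelTime n ω
    · rw [stoppedPrice_of_lt h, Set.indicator_of_mem (s := {ω | ⊥ < levelTime n ω}) h]
      rfl
    · rw [stoppedPrice_of_not_lt h, Set.indicator_of_notMem (s := {ω | ⊥ < levelTime n ω}) h]
  rw [h]
  exact ((measurable_fst.comp measurable_snd).comp
    (measurable_uncurry_apply.comp (hmin.prodMk measurable_id))).indicator hA

lemma stronglyAdapted_stoppedPrice (n : ℕ) :
    StronglyAdapted (rawFiltration (State d F)) (stoppedPrice n) := fun t =>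
  (measurable_rawFiltration_of_stopAt (measurable_stoppedPrice n t)
    (stoppedPrice_stopAt n t)).stronglyMeasurable

lemma isLocalizingSequence_levelTime (Q : Measure (RCLLPath (State d F))) :
    IsLocalizingSequence (rawFiltration (State d F)) levelTime Q where
  isStoppingTime := isStoppingTime_levelTime
  tendsto_top := ae_of_all _ tendsto_levelTime
  mono := ae_of_all _ levelTime_mono

end LevelTimeMeasurability

end Market

/-! ### Criteria for martingales and integrability -/

section MartingaleAux

variable {Ω : Type*} {m0 : MeasurableSpace Ω} {P : Measure Ω} [IsProbabilityMeasure P]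
  {𝓕 : Filtration ℝ≥0 m0}

lemma MeasureTheory.Martingale.eval_euclidean {ι : Type*} [Fintype ι]
    {Y : ℝ≥0 → Ω → EuclideanSpace ℝ ι} (hY : Martingale Y 𝓕 P) (i : ι) :
    Martingale (fun t ω => Y t ω i) 𝓕 P := by
  refine ⟨fun t => (EuclideanSpace.proj (𝕜 := ℝ) i).continuous.comp_stronglyMeasurable (hY.1 t),
    fun s t hst => ?_⟩
  have h := (EuclideanSpace.proj (𝕜 := ℝ) i).comp_condExp_comm (m := 𝓕 s) (hY.integrable t)
  filter_upwards [h, hY.2 s t hst] with ω h1 h2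
  refine h1.symm.trans ?_
  rw [Function.comp_apply, h2]
  rfl

lemma MeasureTheory.martingale_of_setIntegral_eq {G : Type*} [NormedAddCommGroup G]
    [NormedSpace ℝ G] [CompleteSpace G] {Y : ℝ≥0 → Ω → G} (hY : StronglyAdapted 𝓕 Y)
    (hint : ∀ t, Integrable (Y t) P)
    (h : ∀ s t, s ≤ t → ∀ A, MeasurableSet[𝓕 s] A → ∫ ω in A, Y t ω ∂P = ∫ ω in A, Y s ω ∂P) :
    Martingale Y 𝓕 P :=
  ⟨hY, fun s t hst => (ae_eq_condExp_of_forall_setIntegral_eq (𝓕.le s) (hint t)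
    (fun _ _ _ => (hint s).integrableOn) (fun A hA _ => (h s t hst A hA).symm)
    (hY s).aestronglyMeasurable).symm⟩

/-- Fatou's lemma, as a criterion for integrability of a limit. -/
lemma MeasureTheory.integrable_of_tendsto_of_integral_le {f : ℕ → Ω → ℝ} {g : Ω → ℝ} {b C : ℝ}
    (hf : ∀ k, Integrable (f k) P) (hb : ∀ k, ∀ᵐ ω ∂P, -b ≤ f k ω) (hC : ∀ k, ∫ ω, f k ω ∂P ≤ C)
    (hg : AEStronglyMeasurable g P)
    (hlim : ∀ᵐ ω ∂P, Tendsto (fun k => f k ω) atTop (𝓝 (g ω))) : Integrable g P := by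
  have hgb : ∀ᵐ ω ∂P, 0 ≤ g ω + b := by
    filter_upwards [ae_all_iff.2 hb, hlim] with ω h1 h2
    linarith [ge_of_tendsto' h2 h1]
  have key : Integrable (fun ω => g ω + b) P := by
    refine ⟨hg.add_const b, ?_⟩
    rw [hasFiniteIntegral_iff_ofReal hgb]
    have h1 : ∫⁻ ω, ENNReal.ofReal (g ω + b) ∂P ≤
        liminf (fun k => ∫⁻ ω, ENNReal.ofReal (f k ω + b) ∂P) atTop := by
      refine le_trans (le_of_eq ?_) (lintegral_liminf_le' fun k =>
        ((hf k).aemeasurable.add_const b).ennreal_ofReal)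
      refine lintegral_congr_ae ?_
      filter_upwards [hlim] with ω h
      exact ((ENNReal.tendsto_ofReal (h.add_const b)).liminf_eq).symm
    refine h1.trans_lt (lt_of_le_of_lt ?_ (ENNReal.ofReal_lt_top (r := C + b)))
    refine liminf_le_of_le (by isBoundedDefault) fun a ha => ?_
    obtain ⟨k, hk⟩ := ha.exists
    refine hk.trans ?_
    have hint : Integrable (fun ω => f k ω + b) P := (hf k).add (integrable_const b)
    rw [← ofReal_integral_eq_lintegral_ofReal hint
      (by filter_upwards [hb k] with ω h; exact neg_le_iff_add_nonneg.1 h)]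
    refine ENNReal.ofReal_le_ofReal ?_
    rw [integral_add (hf k) (integrable_const b)]
    simpa using hC k
  refine (key.sub (integrable_const b)).congr (Eventually.of_forall fun ω => ?_)
  simp

end MartingaleAux

/-! ### Laws under which a process is a martingale -/

namespace RCLLPath

variable {E : Type*} [TopologicalSpace E] [TopologicalSpace.MetrizableSpace E]
  [SecondCountableTopology E] [MeasurableSpace E] [BorelSpace E]
  {G : Type*} [NormedAddCommGroup G] [NormedSpace ℝ G]

/-- A monotone class argument over the countable `π`-system of preimages of rational half-lines. The
whole space is not among them, so its integral is assumed separately, for the sake of complements.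
-/
lemma setIntegral_stopAt_preimage_eq {Q : Measure (RCLLPath E)} [IsProbabilityMeasure Q]
    {e : RCLLPath E → ℝ} (he : MeasurableEmbedding e) {f g : RCLLPath E → G}
    (hf : Integrable f Q) (hg : Integrable g Q) (s : ℝ≥0)
    (huniv : ∫ ω, f ω ∂Q = ∫ ω, g ω ∂Q)
    (h : ∀ c : ℚ, ∫ ω in stopAt s ⁻¹' (e ⁻¹' Set.Iic (c : ℝ)), f ω ∂Q =
      ∫ ω in stopAt s ⁻¹' (e ⁻¹' Set.Iic (c : ℝ)), g ω ∂Q)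
    {A : Set (RCLLPath E)} (hA : MeasurableSet[rawFiltration E s] A) :
    ∫ ω in A, f ω ∂Q = ∫ ω in A, g ω ∂Q := by
  rw [rawFiltration_eq_comap_stopAt] at hA
  obtain ⟨B, hB, rfl⟩ := hA
  have hgen : (inferInstance : MeasurableSpace (RCLLPath E)) = MeasurableSpace.generateFrom
      {A | ∃ C ∈ ⋃ c : ℚ, {Set.Iic (c : ℝ)}, e ⁻¹' C = A} := by
    rw [← he.comap_eq, BorelSpace.measurable_eq (α := ℝ), Real.borel_eq_generateFrom_Iic_rat,
      MeasurableSpace.comap_generateFrom]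
    rfl
  have hm : ∀ {B : Set (RCLLPath E)}, MeasurableSet B → MeasurableSet (stopAt s ⁻¹' B) :=
    fun hB => measurable_stopAt s hB
  induction B, hB using MeasurableSpace.induction_on_inter hgen
    (Real.isPiSystem_Iic_rat.comap e) with
  | empty => simp
  | basic B hB =>
    obtain ⟨C, hC, rfl⟩ := hB
    obtain ⟨c, rfl⟩ := Set.mem_iUnion.1 hC
    exact h c
  | compl B hB ih =>
    rw [Set.preimage_compl, setIntegral_compl (hm hB) hf, setIntegral_compl (hm hB) hg, huniv, ih]
  | iUnion B hd hB ih =>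
    have hd' : Pairwise (Function.onFun Disjoint fun i => stopAt s ⁻¹' B i) :=
      fun i j hij => (hd hij).preimage _
    rw [Set.preimage_iUnion, integral_iUnion (fun i => hm (hB i)) hd' hf.integrableOn,
      integral_iUnion (fun i => hm (hB i)) hd' hg.integrableOn]
    exact tsum_congr ih

/-- The set of laws under which a given adapted, right-continuous process is a martingale is
Borel, as long as the process is controlled by its later values. -/
theorem measurableSet_martingale [MeasurableSpace G] [BorelSpace G] [CompleteSpace G]
    [SecondCountableTopology G] {e : RCLLPath E → ℝ} (he : MeasurableEmbedding e)
    {Y : ℝ≥0 → RCLLPath E → G} (hY : StronglyAdapted (rawFiltration E) Y)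
    (hrc : ∀ ω t, ContinuousWithinAt (fun u => Y u ω) (Set.Ici t) t) {C : ℝ}
    (hC : ∀ s t, s ≤ t → ∀ ω, ‖Y s ω‖ ≤ C + ‖Y t ω‖) :
    MeasurableSet {Q : ProbabilityMeasure (RCLLPath E) |
      Martingale Y (rawFiltration E) (Q : Measure (RCLLPath E))} := by
  have hYm : ∀ t, StronglyMeasurable (Y t) := fun t => (hY t).mono ((rawFiltration E).le t)
  let κ : Kernel (ProbabilityMeasure (RCLLPath E)) (RCLLPath E) :=
    ⟨fun Q => Q, measurable_subtype_coe⟩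
  -- Integer times suffice for integrability, since later values control earlier ones. Rational
  -- times suffice for the identities, by right limits.
  have hset : {Q : ProbabilityMeasure (RCLLPath E) |
      Martingale Y (rawFiltration E) (Q : Measure (RCLLPath E))} =
      {Q : ProbabilityMeasure (RCLLPath E) |
        (∀ N : ℕ, ∫⁻ ω, ‖Y N ω‖ₑ ∂(Q : Measure (RCLLPath E)) < ⊤) ∧
        ∀ q q' : ℚ≥0, q ≤ q' →
          ∫ ω, Y q' ω ∂(Q : Measure (RCLLPath E)) = ∫ ω, Y q ω ∂(Q : Measure (RCLLPath E)) ∧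
          ∀ c : ℚ, ∫ ω in stopAt (q : ℝ≥0) ⁻¹' (e ⁻¹' Set.Iic (c : ℝ)), Y q' ω
              ∂(Q : Measure (RCLLPath E)) =
            ∫ ω in stopAt (q : ℝ≥0) ⁻¹' (e ⁻¹' Set.Iic (c : ℝ)), Y q ω
              ∂(Q : Measure (RCLLPath E))} := by
    ext Q
    constructor
    · intro h
      refine ⟨fun N => (h.integrable N).2, fun q q' hq => ⟨?_, fun c => ?_⟩⟩
      · simpa using (h.setIntegral_eq (i := (q : ℝ≥0)) (j := (q' : ℝ≥0)) (by exact_mod_cast hq)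
          (@MeasurableSet.univ _ (rawFiltration E q))).symm
      · refine (h.setIntegral_eq (i := (q : ℝ≥0)) (j := (q' : ℝ≥0)) (by exact_mod_cast hq) ?_).symm
        rw [rawFiltration_eq_comap_stopAt]
        exact ⟨_, he.measurable measurableSet_Iic, rfl⟩
    · rintro ⟨h1, h2⟩
      have hN : ∀ N : ℕ, Integrable (Y N) (Q : Measure (RCLLPath E)) := fun N =>
        ⟨(hYm N).aestronglyMeasurable, h1 N⟩
      have hbound : ∀ N : ℕ, Integrable (fun ω => C + ‖Y N ω‖) (Q : Measure (RCLLPath E)) :=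
        fun N => (integrable_const C).add (hN N).norm
      have hint : ∀ t, Integrable (Y t) (Q : Measure (RCLLPath E)) := fun t => by
        obtain ⟨N, hN⟩ := exists_nat_ge t
        exact (hbound N).mono' (hYm t).aestronglyMeasurable
          (Eventually.of_forall fun ω => hC t N hN ω)
      have hrat : ∀ (q q' : ℚ≥0), q ≤ q' → ∀ A, MeasurableSet[rawFiltration E (q : ℝ≥0)] A →
          ∫ ω in A, Y q' ω ∂(Q : Measure (RCLLPath E)) =
            ∫ ω in A, Y q ω ∂(Q : Measure (RCLLPath E)) := fun q q' hq A hA =>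
        setIntegral_stopAt_preimage_eq he (hint _) (hint _) _ (h2 q q' hq).1 (h2 q q' hq).2 hA
      -- Dominated convergence, with `C + ‖Y N‖` for an integer `N` beyond `t + 1` as the dominating
      -- function.
      have hlim : ∀ (t : ℝ≥0) (r : ℕ → ℚ≥0), Tendsto r atTop (ratRight t) →
          ∀ A, Tendsto (fun n => ∫ ω in A, Y (r n) ω ∂(Q : Measure (RCLLPath E))) atTop
            (𝓝 (∫ ω in A, Y t ω ∂(Q : Measure (RCLLPath E)))) := by
        intro t r hr A
        obtain ⟨N, hN⟩ := exists_nat_ge (t + 1)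
        have hr' : Tendsto (fun n => (r n : ℝ≥0)) atTop (𝓝[>] t) := tendsto_comap.comp hr
        refine tendsto_integral_filter_of_dominated_convergence (fun ω => C + ‖Y N ω‖)
          (Eventually.of_forall fun n => (hYm _).aestronglyMeasurable) ?_
          (hbound N).integrableOn ?_
        · filter_upwards [hr'.eventually (Ioo_mem_nhdsGT (lt_add_one t))] with n hn
          exact Eventually.of_forall fun ω => hC _ _ (hn.2.le.trans hN) ω
        · exact Eventually.of_forall fun ω => ((hrc ω t).mono_left
            (nhdsWithin_mono _ Set.Ioi_subset_Ici_self)).comp hr'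
      refine martingale_of_setIntegral_eq hY hint fun s t hst A hA => ?_
      rcases hst.eq_or_lt with rfl | hlt
      · rfl
      obtain ⟨r, hsr, -, hr⟩ := exists_seq_ratRight s
      obtain ⟨u, htu, -, hu⟩ := exists_seq_ratRight t
      have hr' : Tendsto (fun n => (r n : ℝ≥0)) atTop (𝓝[>] s) := tendsto_comap.comp hr
      refine tendsto_nhds_unique (hlim t u hu A) ((hlim s r hr A).congr' ?_)
      filter_upwards [hr'.eventually (Ioo_mem_nhdsGT hlt)] with n hn
      exact (hrat (r n) (u n) (by exact_mod_cast (hn.2.trans (htu n)).le) A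
        ((rawFiltration E).mono (hsr n).le A hA)).symm
  have hi : ∀ (t : ℝ≥0) {A : Set (RCLLPath E)}, MeasurableSet A →
      Measurable fun Q : ProbabilityMeasure (RCLLPath E) =>
        ∫ ω in A, Y t ω ∂(Q : Measure (RCLLPath E)) := by
    intro t A hA
    have : StronglyMeasurable fun Q => ∫ ω, A.indicator (Y t) ω ∂κ Q :=
      ((hYm t).indicator hA).integral_kernel
    simp only [integral_indicator hA] at this
    exact this.measurable
  have hi' : ∀ t : ℝ≥0, Measurable fun Q : ProbabilityMeasure (RCLLPath E) =>
      ∫ ω, Y t ω ∂(Q : Measure (RCLLPath E)) := fun t => by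
    simpa using hi t MeasurableSet.univ
  rw [hset]
  refine measurableSet_setOfPred.2 (.and (.forall fun N => ?_) (.forall fun q => .forall fun q' =>
    .imp measurable_const (.and ?_ (.forall fun c => ?_))))
  · have : Measurable fun Q => ∫⁻ ω, ‖Y N ω‖ₑ ∂κ Q := (hYm N).enorm.lintegral_kernel
    exact measurableSet_setOfPred.1 (measurableSet_lt this measurable_const)
  · exact measurableSet_setOfPred.1 (measurableSet_eq_fun (hi' _) (hi' _))
  · have hm := measurable_stopAt (E := E) q (he.measurable (measurableSet_Iic (a := (c : ℝ))))
    exact measurableSet_setOfPred.1 (measurableSet_eq_fun (hi _ hm) (hi _ hm))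

end RCLLPath

/-! ### From local martingales to stopped martingales -/

namespace Market

open RCLLPath

section LocalMartingale

variable {d : ℕ} {F : Type*} [TopologicalSpace F] [TopologicalSpace.MetrizableSpace F]
  [SecondCountableTopology F] [MeasurableSpace F] [BorelSpace F]

open Classical in
/-- A coordinate of the `n`-th stopped price, stopped once more at `τ` and set to zero if `τ` is
zero. -/
noncomputable def doublyStopped (n : ℕ) (τ : RCLLPath (State d F) → WithTop ℝ≥0) (i : Fin d)
    (t : ℝ≥0) (ω : RCLLPath (State d F)) : ℝ :=
  if ⊥ < τ ω then stoppedPrice n (minTime t (τ ω)) ω i else 0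

/-- Optional stopping at `levelTime n` of the martingale stopped at `τ`. The set where the level
time is positive is known at time zero, so restricting to it preserves the identities. -/
lemma martingale_doublyStopped {Q : Measure (RCLLPath (State d F))} [IsProbabilityMeasure Q] (n : ℕ)
    {τ : RCLLPath (State d F) → WithTop ℝ≥0}
    (hτ : Martingale (stoppedProcess (fun i => {ω | ⊥ < τ ω}.indicator (price i)) τ)
      (rawFiltration (State d F)) Q) (i : Fin d) :
    (∀ t, Integrable (doublyStopped n τ i t) Q) ∧ ∀ s t, s ≤ t →
      ∀ A, MeasurableSet[rawFiltration (State d F) s] A →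
        ∫ ω in A, doublyStopped n τ i t ω ∂Q = ∫ ω in A, doublyStopped n τ i s ω ∂Q := by
  set u : ℝ≥0 → RCLLPath (State d F) → ℝ := fun t ω =>
    stoppedProcess (fun i => {ω | ⊥ < τ ω}.indicator (price i)) τ t ω i with hu_def
  have hu1 : ∀ t ω, ⊥ < τ ω → u t ω = price (minTime t (τ ω)) ω i := fun t ω h => by
    simp only [hu_def, stoppedProcess_eq_minTime]
    rw [Set.indicator_of_mem (s := {ω | ⊥ < τ ω}) h]
  have hu0 : ∀ t ω, ¬ ⊥ < τ ω → u t ω = 0 := fun t ω h => by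
    simp only [hu_def, stoppedProcess_eq_minTime]
    rw [Set.indicator_of_notMem (s := {ω | ⊥ < τ ω}) h]
    rfl
  have hrc : ∀ ω t, ContinuousWithinAt (fun s => u s ω) (Set.Ici t) t := by
    intro ω t
    by_cases h : ⊥ < τ ω
    · simp only [hu1 _ ω h]
      exact (EuclideanSpace.proj (𝕜 := ℝ) i).continuous.continuousAt.comp_continuousWithinAt
        (continuousWithinAt_stopped (price_continuousWithinAt ω) (τ ω) t)
    · simp only [hu0 _ ω h]
      exact continuousWithinAt_const
  obtain ⟨h1, h2⟩ := (hτ.eval_euclidean i).optional_stopping hrc (isStoppingTime_levelTime n)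
  set A₀ : Set (RCLLPath (State d F)) := {ω | ⊥ < levelTime n ω} with hA₀_def
  have hA₀ : MeasurableSet[rawFiltration (State d F) 0] A₀ :=
    (isStoppingTime_levelTime n).measurableSet_gt 0
  have heq : ∀ t, doublyStopped n τ i t = A₀.indicator (stoppedProcess u (levelTime n) t) := by
    intro t
    funext ω
    rw [doublyStopped]
    by_cases hσ : ⊥ < levelTime n ω
    · rw [Set.indicator_of_mem (show ω ∈ A₀ from hσ), stoppedProcess_eq_minTime]
      split_ifs with hρ
      · rw [hu1 _ ω hρ, stoppedPrice_of_lt hσ, minTime_minTime]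
      · rw [hu0 _ ω hρ]
    · rw [Set.indicator_of_notMem (show ω ∉ A₀ from hσ), stoppedPrice_of_not_lt hσ]
      simp
  refine ⟨fun t => ?_, fun s t hst A hA => ?_⟩
  · rw [heq]
    exact (h1 t).indicator ((rawFiltration _).le 0 _ hA₀)
  · rw [heq, heq, setIntegral_indicator ((rawFiltration _).le 0 _ hA₀),
      setIntegral_indicator ((rawFiltration _).le 0 _ hA₀)]
    exact h2 s t hst _ (hA.inter ((rawFiltration (State d F)).mono zero_le _ hA₀))

lemma abs_doublyStopped_le (n : ℕ) (τ : RCLLPath (State d F) → WithTop ℝ≥0) (i : Fin d) (t : ℝ≥0)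
    (ω : RCLLPath (State d F)) : |doublyStopped n τ i t ω| ≤ n + ‖stoppedPrice n t ω‖ := by
  rw [doublyStopped]
  split_ifs
  · exact (PiLp.norm_apply_le _ i).trans (norm_stoppedPrice_le n (minTime_le _ _) ω)
  · rw [abs_zero]
    positivity

lemma doublyStopped_zero_le (n : ℕ) (τ : RCLLPath (State d F) → WithTop ℝ≥0) (i : Fin d)
    (ω : RCLLPath (State d F)) : doublyStopped n τ i 0 ω ≤ n := by
  rw [doublyStopped, minTime_of_le zero_le]
  split_ifs
  · exact (le_abs_self _).trans
      ((PiLp.norm_apply_le _ i).trans (norm_stoppedPrice_zero_le n ω))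
  · positivity

/-- If the price process is a local martingale, then its stopped versions are martingales as soon
as they are bounded from below. -/
theorem martingale_stoppedPrice {Q : Measure (RCLLPath (State d F))} [IsProbabilityMeasure Q]
    {n : ℕ} {b : ℝ} (hb0 : 0 ≤ b) (hb : ∀ᵐ ω ∂Q, ∀ t i, -b ≤ stoppedPrice n t ω i)
    (h : Locally (fun Y => Martingale Y (rawFiltration (State d F)) Q) (rawFiltration (State d F))
      price Q) :
    Martingale (stoppedPrice n) (rawFiltration (State d F)) Q := by
  obtain ⟨ρ, hρ, hN⟩ := h
  have hd := fun k i => martingale_doublyStopped n (hN k) i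
  have hlim : ∀ᵐ ω ∂Q, ∀ t i,
      Tendsto (fun k => doublyStopped n (ρ k) i t ω) atTop (𝓝 (stoppedPrice n t ω i)) := by
    filter_upwards [hρ.tendsto_top] with ω hω t i
    -- The sequence is eventually constant, once the localizing time exceeds `t`.
    refine tendsto_const_nhds.congr' ?_
    filter_upwards [hω.eventually (lt_mem_nhds (WithTop.coe_lt_top t))] with k hk
    rw [doublyStopped, if_pos (bot_le.trans_lt hk), minTime_of_le hk.le]
  have hm : ∀ t (i : Fin d), AEStronglyMeasurable
      (fun ω : RCLLPath (State d F) => stoppedPrice n t ω i) Q := fun t i =>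
    (EuclideanSpace.proj (𝕜 := ℝ) i).continuous.comp_aestronglyMeasurable
      (measurable_stoppedPrice n t).aestronglyMeasurable
  have hlower : ∀ k i t, ∀ᵐ ω ∂Q, -b ≤ doublyStopped n (ρ k) i t ω := fun k i t => by
    filter_upwards [hb] with ω hω
    rw [doublyStopped]
    split_ifs
    · exact hω _ i
    · linarith
  have hint : ∀ t (i : Fin d), Integrable (fun ω => stoppedPrice n t ω i) Q := fun t i => by
    -- Fatou's lemma: the doubly stopped prices are at least `-b`, and their expectation equals the
    -- one at time zero, where they are at most `n`.
    refine integrable_of_tendsto_of_integral_le (C := n) (fun k => (hd k i).1 t)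
      (fun k => hlower k i t) (fun k => ?_) (hm t i) (hlim.mono fun ω hω => hω t i)
    have h0 := (hd k i).2 0 t zero_le Set.univ MeasurableSet.univ
    rw [setIntegral_univ, setIntegral_univ] at h0
    rw [h0]
    refine (integral_mono ((hd k i).1 0) (integrable_const (n : ℝ))
      (doublyStopped_zero_le n (ρ k) i)).trans (by simp)
  have hintY : ∀ t, Integrable (stoppedPrice n t) Q := fun t => Integrable.of_eval_piLp (hint t)
  refine martingale_of_setIntegral_eq (stronglyAdapted_stoppedPrice n) hintY
    fun s t hst A hA => ?_
  -- With the stopped price now integrable, `abs_doublyStopped_le` dominates uniformly in `k`, and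
  -- the martingale identities pass to the limit.
  have hconv : ∀ r (i : Fin d), Tendsto (fun k => ∫ ω in A, doublyStopped n (ρ k) i r ω ∂Q) atTop
      (𝓝 (∫ ω in A, stoppedPrice n r ω i ∂Q)) := fun r i =>
    tendsto_integral_of_dominated_convergence (fun ω => n + ‖stoppedPrice n r ω‖)
      (fun k => ((hd k i).1 r).aestronglyMeasurable.restrict)
      ((integrable_const _).add (hintY r).norm).integrableOn
      (fun k => Eventually.of_forall fun ω => abs_doublyStopped_le n (ρ k) i r ω)
      (ae_restrict_of_ae (hlim.mono fun ω hω => hω r i))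
  ext i
  rw [eval_integral_piLp fun i => (hint t i).integrableOn,
    eval_integral_piLp fun i => (hint s i).integrableOn]
  exact tendsto_nhds_unique (hconv t i)
    ((hconv s i).congr fun k => ((hd k i).2 s t hst A hA).symm)

end LocalMartingale

/-! ### Lower bounds at the level times -/

section LowerBound

variable {d : ℕ} {F : Type*} [TopologicalSpace F]

lemma exitTime_eq_of_forall_lt {n : ℕ} {r : ℝ≥0} {ω : RCLLPath (State d F)}
    (h : ∀ s < r, ‖price s ω‖ < n) (hr : (n : ℝ) ≤ ‖price r ω‖) : exitTime n ω = r := by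
  have hle : ∀ s, (n : ℝ) ≤ ‖price s ω‖ → r ≤ s := fun s hs => by
    by_contra hcon
    exact (h s (not_le.1 hcon)).not_ge hs
  rw [exitTime, hittingAfter, if_pos ⟨r, zero_le, hr⟩, WithTop.coe_inj]
  refine le_antisymm (csInf_le (OrderBot.bddBelow _) ⟨zero_le, hr⟩)
    (le_csInf ⟨r, zero_le, hr⟩ fun s hs => hle s hs.2)

/-- The level time may come before the exit time, when the norm tends to `n` from the left without
attaining it. If the norm at the stopped time is below `n`, the value is at least `-n`; otherwise
that time is the exit time and `a` is a bound. -/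
lemma neg_le_stoppedPrice {n : ℕ} {a : ℝ} {ω : RCLLPath (State d F)}
    (ha : ∀ t i, a ≤ stoppedProcess price (exitTime n) t ω i) (t : ℝ≥0) (i : Fin d) :
    -max (n : ℝ) (-a) ≤ stoppedPrice n t ω i := by
  have hn : (0 : ℝ) ≤ max (n : ℝ) (-a) := le_max_of_le_left n.cast_nonneg
  have hnorm : ∀ s, ‖price s ω‖ ≤ n → -max (n : ℝ) (-a) ≤ price s ω i := fun s hs => by
    have h1 := (abs_le.1 (PiLp.norm_apply_le (price s ω) i)).1
    have h2 := le_max_left (n : ℝ) (-a)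
    linarith
  by_cases hσ : ⊥ < levelTime n ω
  · rw [stoppedPrice_of_lt hσ]
    set r := minTime t (levelTime n ω) with hr_def
    rcases le_or_gt (n : ℝ) ‖price r ω‖ with hr | hr
    · have hlt : ∀ s < r, ‖price s ω‖ < n := fun s hs => by
        refine norm_price_lt_of_lt_levelTime ((WithTop.coe_lt_coe.2 hs).trans_le ?_)
        rw [hr_def, coe_minTime]
        exact min_le_right _ _
      have h1 := ha r i
      rw [stoppedProcess_eq_minTime, exitTime_eq_of_forall_lt hlt hr, minTime_of_le le_rfl] at h1
      have h2 := le_max_right (n : ℝ) (-a)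
      linarith
    · exact hnorm r hr.le
  · rw [stoppedPrice_of_not_lt hσ]
    simp

end LowerBound

/-! ### Local-martingale measures through level times -/

section Characterization

variable {d : ℕ} {F : Type*} [TopologicalSpace F] [T2Space F] [LocallyCompactSpace F]
  [SecondCountableTopology F] [MeasurableSpace F] [BorelSpace F]
  {P : State d F → ProbabilityMeasure (RCLLPath (State d F))}

/-- The assumed bound covers starting prices of norm below `n`. For the others the level time is
zero and the stopped price vanishes by convention. -/
lemma ae_neg_le_stoppedPrice (hMarkov : IsCanonicalStrongMarkov P)
    (hBelow : UniformlyLocallyBoundedBelow P) (x : State d F) (n : ℕ) :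
    ∃ b : ℝ, 0 ≤ b ∧ ∀ᵐ ω ∂(P x : Measure (RCLLPath (State d F))), ∀ t i,
      -b ≤ stoppedPrice n t ω i := by
  obtain ⟨a, ha⟩ := hBelow n
  rcases lt_or_ge ‖x.2.1‖ n with hx | hx
  · refine ⟨max (n : ℝ) (-a), le_max_of_le_left n.cast_nonneg, ?_⟩
    filter_upwards [ha x hx] with ω hω
    exact neg_le_stoppedPrice hω
  · refine ⟨0, le_rfl, ?_⟩
    filter_upwards [hMarkov.start x] with ω hω t i
    have h0 : ¬ ⊥ < levelTime n ω := by
      rw [bot_lt_levelTime_iff, not_not]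
      refine reaches_of_le_norm ?_
      rw [price, hω]
      exact hx
    rw [stoppedPrice_of_not_lt h0]
    simp

/-- The local-martingale measures are the equivalent measures which turn all the stopped price
processes into martingales. -/
theorem mem_martingaleMeasures_iff (hMarkov : IsCanonicalStrongMarkov P)
    (hBelow : UniformlyLocallyBoundedBelow P) (x : State d F)
    (Q : ProbabilityMeasure (RCLLPath (State d F))) :
    Q ∈ martingaleMeasures P x ↔
      (Q : Measure (RCLLPath (State d F))) ≪ (P x : Measure (RCLLPath (State d F))) ∧
      (P x : Measure (RCLLPath (State d F))) ≪ (Q : Measure (RCLLPath (State d F))) ∧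
      ∀ n, Martingale (stoppedPrice n) (rawFiltration (State d F))
        (Q : Measure (RCLLPath (State d F))) := by
  refine and_congr_right fun hQP => and_congr_right fun _ => ⟨fun h n => ?_, fun h => ?_⟩
  · obtain ⟨b, hb0, hb⟩ := ae_neg_le_stoppedPrice hMarkov hBelow x n
    exact martingale_stoppedPrice hb0 (hQP.ae_le hb) h
  · exact ⟨levelTime, isLocalizingSequence_levelTime _, h⟩

end Characterization

end Market

/-- A locally compact Hausdorff space with a countable base is Polish. -/
lemma polishSpace_of_locallyCompact_secondCountable (F : Type*) [TopologicalSpace F] [T2Space F]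
    [LocallyCompactSpace F] [SecondCountableTopology F] : PolishSpace F := by
  let _ := TopologicalSpace.metrizableSpaceMetric F
  have hpolish : PolishSpace (UniformSpace.Completion F) := inferInstance
  have hemb : IsEmbedding ((↑) : F → UniformSpace.Completion F) :=
    UniformSpace.Completion.isUniformEmbedding_coe F |>.isEmbedding
  -- A locally compact space is open in its completion: near a point, the dense image lies in a
  -- compact set, which is closed and so contains a full neighbourhood.
  have hopen : IsOpen (Set.range ((↑) : F → UniformSpace.Completion F)) := by
    rw [isOpen_iff_mem_nhds]
    rintro _ ⟨x, rfl⟩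
    obtain ⟨K, hK, hxK⟩ := exists_compact_mem_nhds x
    rw [hemb.nhds_eq_comap] at hxK
    obtain ⟨V, hV, hVK⟩ := hxK
    obtain ⟨U, hUV, hU, hxU⟩ := mem_nhds_iff.1 hV
    refine mem_of_superset (hU.mem_nhds hxU) ?_
    have h1 : U ⊆ closure (U ∩ Set.range ((↑) : F → UniformSpace.Completion F)) :=
      UniformSpace.Completion.denseRange_coe.open_subset_closure_inter hU
    have h2 : U ∩ Set.range ((↑) : F → UniformSpace.Completion F) ⊆ (↑) '' K := by
      rintro _ ⟨hy, y, rfl⟩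
      exact ⟨y, hVK (hUV hy), rfl⟩
    have hcl := (hK.image (UniformSpace.Completion.continuous_coe F)).isClosed
    exact h1.trans ((closure_minimal h2 hcl).trans (Set.image_subset_range _ _))
  have := hopen.polishSpace
  exact hemb.toHomeomorph.isClosedEmbedding.polishSpace

/-! ### The Borel graph and its analytic image -/

namespace Market

open RCLLPath

section Main

variable {d : ℕ} {F : Type*} [TopologicalSpace F] [T2Space F] [LocallyCompactSpace F]
  [SecondCountableTopology F] [MeasurableSpace F] [BorelSpace F]
  {P : State d F → ProbabilityMeasure (RCLLPath (State d F))}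

lemma exists_measurableEmbedding_real_path :
    ∃ e : RCLLPath (State d F) → ℝ, MeasurableEmbedding e := by
  have := polishSpace_of_locallyCompact_secondCountable F
  exact ⟨_, (measurableEmbedding_embeddingReal _).comp measurableEmbedding_ratRestrict⟩

lemma measurable_of_isCanonicalStrongMarkov (hMarkov : IsCanonicalStrongMarkov P) :
    Measurable P := by
  have h := hMarkov.borel
  rwa [← BorelSpace.measurable_eq (α := State d F),
    ← BorelSpace.measurable_eq (α := ProbabilityMeasure (RCLLPath (State d F)))] at h

lemma measurableSet_absolutelyContinuous {α Ω : Type*} [MeasurableSpace α] [MeasurableSpace Ω]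
    [MeasurableSpace.CountablyGenerated Ω] {μ ν : α → ProbabilityMeasure Ω} (hμ : Measurable μ)
    (hν : Measurable ν) : MeasurableSet {a | (μ a : Measure Ω) ≪ (ν a : Measure Ω)} := by
  let κ : Kernel α Ω := ⟨fun a => (μ a : Measure Ω), measurable_subtype_coe.comp hμ⟩
  let η : Kernel α Ω := ⟨fun a => (ν a : Measure Ω), measurable_subtype_coe.comp hν⟩
  have : IsMarkovKernel κ := ⟨fun a => inferInstanceAs (IsProbabilityMeasure (μ a : Measure Ω))⟩
  have : IsMarkovKernel η := ⟨fun a => inferInstanceAs (IsProbabilityMeasure (ν a : Measure Ω))⟩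
  exact Kernel.measurableSet_absolutelyContinuous κ η

theorem measurableSet_graph_martingaleMeasures (hMarkov : IsCanonicalStrongMarkov P)
    (hBelow : UniformlyLocallyBoundedBelow P) :
    MeasurableSet {p : State d F × ProbabilityMeasure (RCLLPath (State d F)) |
      p.2 ∈ martingaleMeasures P p.1} := by
  obtain ⟨e, he⟩ := exists_measurableEmbedding_real_path (d := d) (F := F)
  have hP : Measurable fun p : State d F × ProbabilityMeasure (RCLLPath (State d F)) => P p.1 :=
    (measurable_of_isCanonicalStrongMarkov hMarkov).comp measurable_fst
  have hn : ∀ n, MeasurableSet {Q : ProbabilityMeasure (RCLLPath (State d F)) |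
      Martingale (stoppedPrice n) (rawFiltration (State d F))
        (Q : Measure (RCLLPath (State d F)))} := fun n =>
    measurableSet_martingale he (stronglyAdapted_stoppedPrice n)
      (stoppedPrice_continuousWithinAt n) fun s t hst ω => norm_stoppedPrice_le n hst ω
  simp only [mem_martingaleMeasures_iff hMarkov hBelow, Set.ofPred_and, Set.ofPred_forall]
  exact (measurableSet_absolutelyContinuous measurable_snd hP).inter
    ((measurableSet_absolutelyContinuous hP measurable_snd).inter
      (MeasurableSet.iInter fun n => measurable_snd (hn n)))

theorem analyticSet_graph_augFamily (hMarkov : IsCanonicalStrongMarkov P)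
    (hBelow : UniformlyLocallyBoundedBelow P) :
    AnalyticSet {p : AugState d F × ProbabilityMeasure (RCLLPath (AugState d F)) |
      p.2 ∈ augFamily P p.1} := by
  have := polishSpace_of_locallyCompact_secondCountable F
  -- The parametrization of laws by `ℚ → ℝ` needs a nonempty path space.
  rcases isEmpty_or_nonempty (RCLLPath (State d F)) with hempty | hne
  · have : IsEmpty (AugState d F) := ⟨fun y => hempty.false (const y.1)⟩
    rw [Set.eq_empty_of_isEmpty {p : AugState d F × ProbabilityMeasure (RCLLPath (AugState d F)) |
      p.2 ∈ augFamily P p.1}]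
    exact analyticSet_empty
  obtain ⟨e, he⟩ := exists_measurableEmbedding_real_path (d := d) (F := F)
  obtain ⟨g, hg, hsurj⟩ := ProbabilityMeasure.exists_measurable_surjective he
  have hP := measurable_of_isCanonicalStrongMarkov hMarkov
  have hS : MeasurableSet {x : AugState d F × (ℚ → ℝ) | g x.2 ∈ martingaleMeasures P x.1.1} :=
    ((measurable_fst.comp measurable_fst).prodMk (hg.comp measurable_snd))
      (measurableSet_graph_martingaleMeasures hMarkov hBelow)
  have hf : Measurable fun x : AugState d F × (ℚ → ℝ) =>
      (x.1, densityLaw (x.1.2, P x.1.1, g x.2)) :=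
    measurable_fst.prodMk (measurable_densityLaw.comp ((measurable_snd.comp measurable_fst).prodMk
      ((hP.comp (measurable_fst.comp measurable_fst)).prodMk (hg.comp measurable_snd))))
  -- The parameter `c` stands for the measure `g c`, so the source is the Polish space `AugState d F
  -- × (ℚ → ℝ)`.
  convert hS.analyticSet_image hf using 1
  ext ⟨y, R⟩
  constructor
  · rintro ⟨Q, hQ, Z, hZ, hR⟩
    obtain ⟨c, rfl⟩ := hsurj Q
    refine ⟨(y, c), hQ, Prod.ext rfl (Subtype.ext ?_)⟩
    exact (augLaw_congr (isDensityProcess_densityProcess hQ.1) hZ y.2).trans hR.symm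
  · rintro ⟨⟨y', c⟩, hQ, h⟩
    obtain ⟨rfl, rfl⟩ := Prod.ext_iff.1 h
    exact ⟨g c, hQ, _, isDensityProcess_densityProcess hQ.1, rfl⟩

end Main

end Market

theorem mainTheorem8 {d : ℕ} {F : Type*} [TopologicalSpace F] [T2Space F] [LocallyCompactSpace F]
    [SecondCountableTopology F] [MeasurableSpace F] [BorelSpace F]
    (P : Market.State d F → ProbabilityMeasure (RCLLPath (Market.State d F)))
    (hMarkov : Market.IsCanonicalStrongMarkov P)
    (hHorizon : Market.HasFiniteHorizon P)
    (hNFLVR : Market.NFLVR P)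
    (hBelow : Market.UniformlyLocallyBoundedBelow P) :
    AnalyticSet {p : Market.AugState d F × ProbabilityMeasure (RCLLPath (Market.AugState d F)) |
      p.2 ∈ Market.augFamily P p.1} ∧
    (∀ P₀ Q₀ : ProbabilityMeasure (RCLLPath (Market.State d F)),
      (Q₀ : Measure (RCLLPath (Market.State d F))) ≪ (P₀ : Measure (RCLLPath (Market.State d F))) →
        ∃ Z, Market.IsDensityProcess P₀ Q₀ Z) ∧
    ∃ ζ : {p : ProbabilityMeasure (RCLLPath (Market.State d F)) ×
          ProbabilityMeasure (RCLLPath (Market.State d F)) //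
            (p.2 : Measure (RCLLPath (Market.State d F))) ≪
              (p.1 : Measure (RCLLPath (Market.State d F)))} →
        ProbabilityMeasure (RCLLPath (Market.AugState d F)),
      Measurable[borel _, borel _] ζ ∧
      ∀ p Z, Market.IsDensityProcess p.1.1 p.1.2 Z →
        (ζ p : Measure (RCLLPath (Market.AugState d F))) = Market.augLaw p.1.1 1 Z := by
  refine ⟨Market.analyticSet_graph_augFamily hMarkov hBelow,
    fun P₀ Q₀ hQP => ⟨_, Market.isDensityProcess_densityProcess hQP⟩,
    fun p => Market.densityLaw (1, p.1.1, p.1.2), ?_,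
    fun p Z hZ => Market.augLaw_congr (Market.isDensityProcess_densityProcess p.2) hZ 1⟩
  rw [← BorelSpace.measurable_eq, ← BorelSpace.measurable_eq]
  exact Market.measurable_densityLaw.comp (measurable_const.prodMk measurable_subtype_coe)
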